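/- **Setting.** Let $U=\mathbb R^{\infty}$ (sequences indexed by $\mathbb N=\{1,2,\dots\}$), let $\gamma=\bigotimes_{j\in\mathbb N}N(0,1)$ be the standard Gaussian product measure on $U$ and $\gamma_N$ that on $\mathbb R^N$. Let $X$ be a complex separable Hilbert space, $b=(b_j)_{j\in\mathbb N}\in(0,\infty)^\infty$, $\xi,\delta>0$. A vector $\varrho\in(0,\infty)^N$ is *$(b,\xi)$-admissible* if $\sum_{j=1}^N b_j\varrho_j\le\xi$. A function $u\in L^2(U,X;\gamma)$ is *$(b,\xi,\delta,X)$-holomorphic* if there are functions $u_N:\mathbb R^N\to X$ ($N\in\mathbb N$) such that 1. for every $N$ and every admissible $\varrho\in(0,\infty)^N$, $u_N$ has a holomorphic extension (again denoted $u_N$) to $\{z\in\mathbb C^N:|\operatorname{Im}z_j|<\varrho_j\ \forall j\}$, and $u_N(y_1,\dots,y_N)=u_M(y_1,\dots,y_N,0,\dots,0)$ for all $N<M$ and $y\in\mathbb R^N$; 2. for every $N$ there is $\varphi_N:\mathbb R^N\to[0,\infty)$ with $\|\varphi_N\|_{L^2(\mathbb R^N;\gamma_N)}\le\delta$ and $\|u_N(y+z)\|_X\le\varphi_N(y)$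 for all $y\in\mathbb R^N$, all admissible $\varrho$ and all $z\in\mathbb C^N$ with $|z_j|<\varrho_j$ for all $j$; 3. with $\tilde u_N(y):=u_N(y_1,\dots,y_N)$ for $y\in U$, $\lim_{N\to\infty}\|u-\tilde u_N\|_{L^2(U,X;\gamma)}=0$. Point values of such a $u$ are understood as $u(y_1,\dots,y_N,0,0,\dots):=u_N(y_1,\dots,y_N)$. Let $\mathcal F$ be the set of finitely supported sequences $\nu\in\mathbb N_0^{\infty}$, ordered componentwise. For $n\in\mathbb N_0$ let $\chi_{n,0}<\dots<\chi_{n,n}$ be the Gauss–Hermite points, i.e. the roots of the probabilists' Hermite polynomial of degree $n+1$. Let $I_n$ be the univariate Lagrange interpolation operator at these points, and $I_{-1}:=0$. For finite $\Lambda\subseteq\mathcal F$, the Smolyak interpolation operator and its set of interpolation points are $$\mathbf I_\Lambda:=\sum_{\nu\in\Lambda}\bigotimes_{j\in\mathbb N}(I_{\nu_j}-I_{\nu_j-1}),\qquad \mathrm{pts}(\Lambda):=\{(\chi_{\nu_j,\mu_j})_{j\in\mathbb N}:\nu\in\Lambda,\ \mu\in\mathcal F,\ \mu\le\nu\}.$$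 **Theorem.** Let $p\in(0,2/3)$, let $b\in(0,\infty)^\infty$ with $b\in\ell^p(\mathbb N)$, and let $u$ be $(b,\xi,\delta,X)$-holomorphic. Let $K>0$, $\tau>0$ and $r\in\mathbb N$ be such that $\frac{(r-\tau)\,p}{2(1-p)}>2$ (for example $\tau=3$ and $r>4/p-1$). For $j\in\mathbb N$, $\nu\in\mathcal F$ and $\varepsilon>0$ set $$\varrho_j:=b_j^{p-1}\frac{\xi}{4\sqrt{r!}\,\|b\|_{\ell^p}},\qquad c_{1,\nu}:=\prod_{j\in\operatorname{supp}\nu}\max\{1,K\varrho_j\}^{2}\,\nu_j^{\,r-\tau},\qquad \Lambda_{1,\varepsilon}:=\{\nu\in\mathcal F:c_{1,\nu}^{-1}\ge\varepsilon\},$$ where $\|b\|_{\ell^p}=(\sum_j b_j^p)^{1/p}$. Then every $\Lambda_{1,\varepsilon}$, $\varepsilon>0$, is finite and downward closed (with $\nu$ it contains every $\mu\le\nu$), and there exist $C>0$ and, for every $n\in\mathbb N$, a number $\varepsilon_n>0$ such that $|\mathrm{pts}(\Lambda_{1,\varepsilon_n})|\le n$ and $$\|u-\mathbf I_{\Lambda_{1,\varepsilon_n}}u\|_{L^2(U,X;\gamma)}\le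 C\,n^{-\frac1p+\frac32}.$$ -/

import Mathlib

open MeasureTheory ProbabilityTheory Filter Topology
open scoped ENNReal

noncomputable section

namespace SparseGrid

/-- The standard Gaussian product measure on `U = ℝ^∞`. -/
def gammaInf : Measure (ℕ → ℝ) :=
  Measure.infinitePi (fun _ : ℕ => gaussianReal 0 1)

/-- The standard Gaussian measure on `ℝ^N`. -/
def gammaFin (N : ℕ) : Measure (Fin N → ℝ) :=
  Measure.pi (fun _ : Fin N => gaussianReal 0 1)

/-! ### Holomorphy -/

/-- `ϱ ∈ (0,∞)^N` is `(b, ξ)`-admissible. -/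
def Admissible (b : ℕ → ℝ) (ξ : ℝ) {N : ℕ} (ϱ : Fin N → ℝ) : Prop :=
  (∀ j, 0 < ϱ j) ∧ ∑ j : Fin N, b j * ϱ j ≤ ξ

/-- The product of strips `|Im z_j| < ϱ_j`. -/
def strip {N : ℕ} (ϱ : Fin N → ℝ) : Set (Fin N → ℂ) :=
  {z | ∀ j, |(z j).im| < ϱ j}

/-- The polydisc `|z_j| < ϱ_j`. -/
def polydisc {N : ℕ} (ϱ : Fin N → ℝ) : Set (Fin N → ℂ) :=
  {z | ∀ j, ‖z j‖ < ϱ j}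

/-- The function on `U` that depends on the first `N` coordinates only, through `f`. -/
def liftFin {X : Type*} {N : ℕ} (f : (Fin N → ℝ) → X) : (ℕ → ℝ) → X :=
  fun y => f (fun i => y i)

/-- The vector `(y_1, …, y_N, 0, …, 0) ∈ ℝ^M`. -/
def padZero {N : ℕ} (M : ℕ) (y : Fin N → ℝ) : Fin M → ℝ :=
  fun i => if h : (i : ℕ) < N then y ⟨i, h⟩ else 0

/-- `u` is `(b, ξ, δ, X)`-holomorphic, with the functions `u_N : ℝ^N → X` of the definition
being `uN N` for `N ≥ 1` (the value `uN 0` is irrelevant). The holomorphic extension of `u_N` to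
a strip is unique, so that the bound by `φ` may be stated together with its existence. -/
structure IsHolomorphicVia {X : Type*} [NormedAddCommGroup X] [InnerProductSpace ℂ X]
    (b : ℕ → ℝ) (ξ δ : ℝ) (u : (ℕ → ℝ) → X) (uN : (N : ℕ) → (Fin N → ℝ) → X) : Prop where
  memLp : MemLp u 2 gammaInf
  extension : ∀ N : ℕ, 0 < N → ∃ φ : (Fin N → ℝ) → ℝ,
    (∀ y, 0 ≤ φ y) ∧ MemLp φ 2 (gammaFin N) ∧
    eLpNorm φ 2 (gammaFin N) ≤ ENNReal.ofReal δ ∧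
    ∀ ϱ : Fin N → ℝ, Admissible b ξ ϱ → ∃ F : (Fin N → ℂ) → X,
      DifferentiableOn ℂ F (strip ϱ) ∧
      (∀ y : Fin N → ℝ, F (fun i => (y i : ℂ)) = uN N y) ∧
      ∀ y : Fin N → ℝ, ∀ z ∈ polydisc ϱ, ‖F (fun i => (y i : ℂ) + z i)‖ ≤ φ y
  consistent : ∀ N M : ℕ, 0 < N → N < M → ∀ y : Fin N → ℝ, uN N y = uN M (padZero M y)
  tendsto : Tendsto (fun N => eLpNorm (fun y => u y - liftFin (uN N) y) 2 gammaInf) atTop (𝓝 0)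

open Classical in
/-- The point values `u(y_1, …, y_N, 0, 0, …) := u_N(y_1, …, y_N)` at sequences `y` with finitely
many nonzero entries. The value `0` elsewhere is never used. -/
def pointEval {X : Type*} [Zero X] (uN : (N : ℕ) → (Fin N → ℝ) → X) : (ℕ → ℝ) → X :=
  fun y => if h : ∃ N : ℕ, 0 < N ∧ ∀ j, N ≤ j → y j = 0 then liftFin (uN (Nat.find h)) y else 0

/-! ### Smolyak interpolation -/

/-- The Gauss-Hermite points `χ_{n,0} < ⋯ < χ_{n,n}`, the roots of the Hermite polynomial of
degree `n + 1` in increasing order. -/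
def gaussHermite (n j : ℕ) : ℝ :=
  ((((Polynomial.hermite (n + 1)).map (Int.castRingHom ℝ)).roots.toFinset).sort).getD j 0

/-- The `j`-th Lagrange basis polynomial for the nodes `χ_{n,0}, …, χ_{n,n}`. -/
def lagrangeBasis (n j : ℕ) (y : ℝ) : ℝ :=
  ∏ i ∈ (Finset.range (n + 1)).erase j,
    (y - gaussHermite n i) / (gaussHermite n j - gaussHermite n i)

/-- The grid point `(χ_{ν_j, μ_j})_j`. -/
def gridPoint (ν μ : ℕ →₀ ℕ) : ℕ → ℝ := fun j => gaussHermite (ν j) (μ j)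

/-- The tensorized interpolation operator `I_ν`; the factors with `ν_j = 0` equal `1`. -/
def tensorInterp {X : Type*} [NormedAddCommGroup X] [InnerProductSpace ℂ X]
    (ν : ℕ →₀ ℕ) (f : (ℕ → ℝ) → X) (y : ℕ → ℝ) : X :=
  ∑ μ ∈ Finset.Icc 0 ν,
    ((∏ j ∈ ν.support, lagrangeBasis (ν j) (μ j) (y j) : ℝ) : ℂ) • f (gridPoint ν μ)

/-- The operator `⨂_j (I_{ν_j} - I_{ν_j - 1})` with `I_{-1} = 0`, multiplied out:
the set `s` collects the coordinates in which `- I_{ν_j - 1}` is taken, and it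
lies in the support of `ν` because `I_{-1} = 0`. -/
def tensorDiff {X : Type*} [NormedAddCommGroup X] [InnerProductSpace ℂ X]
    (ν : ℕ →₀ ℕ) (f : (ℕ → ℝ) → X) (y : ℕ → ℝ) : X :=
  ∑ s ∈ ν.support.powerset,
    (-1 : ℂ) ^ s.card • tensorInterp (ν - ∑ j ∈ s, Finsupp.single j 1) f y

/-- The Smolyak interpolation operator `I_Λ` for a finite set `Λ`. -/
def smolyak {X : Type*} [NormedAddCommGroup X] [InnerProductSpace ℂ X]
    (Λ : Finset (ℕ →₀ ℕ)) (f : (ℕ → ℝ) → X) (y : ℕ → ℝ) : X :=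
  ∑ ν ∈ Λ, tensorDiff ν f y

/-- The interpolation points used by `I_Λ`. -/
def pts (Λ : Set (ℕ →₀ ℕ)) : Set (ℕ → ℝ) :=
  {x | ∃ ν ∈ Λ, ∃ μ ≤ ν, x = gridPoint ν μ}

/-! ### The multiindex sets -/

/-- `ϱ_j = b_j^{p-1} ξ / (4 √(r!) ‖b‖_{ℓ^p})`. -/
def varrho (b : ℕ → ℝ) (p ξ : ℝ) (r : ℕ) (j : ℕ) : ℝ :=
  b j ^ (p - 1) * (ξ / (4 * √(r.factorial : ℝ) * (∑' i, |b i| ^ p) ^ (1 / p)))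

/-- `c_{k,ν} = ∏_{j ∈ supp ν} max{1, K ϱ_j}^{2k} ν_j^{r-τ}`. -/
def weight (k : ℕ) (K τ : ℝ) (r : ℕ) (ϱ : ℕ → ℝ) (ν : ℕ →₀ ℕ) : ℝ :=
  ∏ j ∈ ν.support, max 1 (K * ϱ j) ^ (2 * k) * (ν j : ℝ) ^ ((r : ℝ) - τ)

/-- `Λ_ε = {ν : c_ν⁻¹ ≥ ε}`. -/
def indexSet (c : (ℕ →₀ ℕ) → ℝ) (ε : ℝ) : Set (ℕ →₀ ℕ) := {ν | ε ≤ (c ν)⁻¹}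

end SparseGrid

end

open SparseGrid

noncomputable section

namespace SparseGrid

/-! ### Hermite polynomials -/

/-! Write c_ν for the weight, B_j = max{1, Kϱ_j}² and t = p/(2(1-p)), and expand u_N in normalized
Hermite polynomials H_ν with coefficients f_ν. A Smolyak operator over a downward closed Λ
reproduces H_ν for ν ∈ Λ. The error is therefore at most the sum over ν ∉ Λ of ‖f_ν‖ times the L²
norm of (I - I_Λ)H_ν.

Stability. The L² norm of a Lagrange basis function at a Gauss-Hermite node χ is κ(χ)^{-1/2}, where
κ is the inverse Christoffel function. At the nodes of I_n every normalized Hermite polynomial, of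
whatever degree, satisfies h_k(χ)² ≤ κ(χ) (`hermiteN_sq_le`, which applies because χ² ≤ 4n). Hence
I_n h_k has norm at most n + 1 for all k (`eLpNorm_interp_hermiteN_le`), and tensorization gives ‖(I
- I_Λ)H_ν‖ ≤ 2P_ν with P_ν = ∏ 8ν_j² over the support (`eLpNorm_hermiteSeq_sub_smolyak_le`).

Decay. Average F(y + R e^{iθ}) against ∏ e^{-iα_jθ_j} h_{μ_j}(y_j). Cauchy's formula turns the
angular integral into ∂^α F, and Gaussian integration by parts turns that into the Hermite
coefficient of order μ + α, with an explicit factor. Choosing an order α = a(ν) for each ν and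
setting μ = ν - a(ν) yields distinct members of one orthonormal system, so Bessel's inequality
bounds ∑ w_ν ‖f_ν‖² by ∫ φ² (`sum_weight_mul_hermiteCoeff_sq_le`). The radii R_j are half of the
admissible radii, which are proportional to b_j^{p-1}. Differentiating to order at most S = r + 4
makes w_ν dominate P_ν² c_ν, up to one constant D per active coordinate
(`exists_prod_sq_mul_prodWeight_le`).

Counting. B_j^{-t} is at most a constant times b_j^p, so the series of c_ν^{-t} ∏ D(1 + ν_j) over
the support converges as soon as (r-τ)t > 2 (`summable_prodWeight_rpow`). With D = 1 and value Z it
bounds the number of points by Z ε^{-t}.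

Conclusion. Outside Λ_ε one has c_ν^{-1} ≤ ε^{1-t} c_ν^{-t}. Cauchy-Schwarz then bounds the error by
a constant times ε^{(1-t)/2}, uniformly in N, and N → ∞ transfers the bound to u. Taking ε =
(Z/n)^{1/t} gives the rate, since (1-t)/(2t) = 1/p - 3/2. The condition p < 2/3 is t < 1.

Interpolation needs point values, so the Hermite series must converge pointwise and not merely in
L²; this is `hasSum_hermiteProd_smul`. -/

open Polynomial in
/-- The probabilists' Hermite polynomial of degree `n`, evaluated at `x`. -/
def hermiteEval {A : Type*} [CommRing A] (n : ℕ) (x : A) : A := aeval x (hermite n)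

section Algebra

open Polynomial

theorem derivative_hermite_succ (n : ℕ) :
    derivative (hermite (n + 1)) = ((n : ℤ[X]) + 1) * hermite n := by
  induction n with
  | zero => simp
  | succ n ih =>
    have h1 := hermite_succ (n + 1)
    have h2 := hermite_succ n
    rw [h1, ih]
    simp only [derivative_sub, derivative_mul, derivative_X, derivative_add,
      derivative_natCast, derivative_one]
    rw [ih, h2]
    push_cast
    ring

theorem hermite_add_two (n : ℕ) :
    hermite (n + 2) = X * hermite (n + 1) - ((n : ℤ[X]) + 1) * hermite n := by
  rw [hermite_succ (n + 1), derivative_hermite_succ]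

variable {A : Type*} [CommRing A]

@[simp] theorem hermiteEval_zero (x : A) : hermiteEval 0 x = 1 := by
  simp [hermiteEval]

@[simp] theorem hermiteEval_one (x : A) : hermiteEval 1 x = x := by
  simp [hermiteEval]

theorem hermiteEval_add_two (n : ℕ) (x : A) :
    hermiteEval (n + 2) x = x * hermiteEval (n + 1) x - ((n : A) + 1) * hermiteEval n x := by
  rw [hermiteEval, hermite_add_two]
  simp only [hermiteEval, map_sub, map_mul, map_add, aeval_X, map_natCast, map_one]

/-- The Christoffel-Darboux formula. -/
theorem christoffel_darboux {F : Type*} [Field F] [CharZero F] (n : ℕ) (x y : F) :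
    (x - y) * ∑ l ∈ Finset.range (n + 1), hermiteEval l x * hermiteEval l y / (l.factorial : F) =
      (hermiteEval (n + 1) x * hermiteEval n y - hermiteEval n x * hermiteEval (n + 1) y) /
        (n.factorial : F) := by
  induction n with
  | zero => simp
  | succ n ih =>
    rw [Finset.sum_range_succ, mul_add, ih, hermiteEval_add_two, hermiteEval_add_two,
      Nat.factorial_succ]
    have h1 : (n.factorial : F) ≠ 0 := by exact_mod_cast n.factorial_ne_zero
    have h2 : (n : F) + 1 ≠ 0 := by exact_mod_cast n.succ_ne_zero
    push_cast
    field_simp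
    ring

/-- The confluent form of the Christoffel-Darboux formula. -/
theorem christoffel_darboux_diag {F : Type*} [Field F] [CharZero F] (n : ℕ) (x : F) :
    ∑ l ∈ Finset.range (n + 1), hermiteEval l x ^ 2 / (l.factorial : F) =
      (hermiteEval (n + 1) x ^ 2 + ((n : F) + 1) * hermiteEval n x ^ 2 -
        x * hermiteEval (n + 1) x * hermiteEval n x) / (n.factorial : F) := by
  induction n with
  | zero => simp; ring
  | succ n ih =>
    rw [Finset.sum_range_succ, ih, hermiteEval_add_two, Nat.factorial_succ]
    have h1 : (n.factorial : F) ≠ 0 := by exact_mod_cast n.factorial_ne_zero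
    have h2 : (n : F) + 1 ≠ 0 := by exact_mod_cast n.succ_ne_zero
    push_cast
    field_simp
    ring

end Algebra

/-- The `L²`-normalized Hermite polynomial. -/
def hermiteN (n : ℕ) (x : ℝ) : ℝ := hermiteEval n x / √(n.factorial : ℝ)

theorem hermiteN_sq (n : ℕ) (x : ℝ) :
    hermiteN n x ^ 2 = hermiteEval n x ^ 2 / (n.factorial : ℝ) := by
  rw [hermiteN, div_pow, Real.sq_sqrt (by positivity)]

@[simp] theorem hermiteN_zero (x : ℝ) : hermiteN 0 x = 1 := by simp [hermiteN]

theorem hermiteN_mul (n : ℕ) (x y : ℝ) :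
    hermiteN n x * hermiteN n y = hermiteEval n x * hermiteEval n y / (n.factorial : ℝ) := by
  have : √(n.factorial : ℝ) * √(n.factorial : ℝ) = n.factorial := Real.mul_self_sqrt (by positivity)
  rw [hermiteN, hermiteN, div_mul_div_comm, this]

/-- The inverse of the Christoffel function, `∑_{l < n} h_l(x)²`. -/
def christoffelInv (n : ℕ) (x : ℝ) : ℝ := ∑ l ∈ Finset.range n, hermiteN l x ^ 2

theorem christoffelInv_pos (n : ℕ) (x : ℝ) : 0 < christoffelInv (n + 1) x := by
  unfold christoffelInv
  refine Finset.sum_pos' (fun i _ => sq_nonneg _) ⟨0, by simp, by simp⟩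

/-- The confluent Christoffel-Darboux formula writes the right side as a quadratic form in the
values of degrees k and k + 1. Completing the square in the lower one leaves the factor 1 -
x²/(4(k+1)) on the other. -/
theorem sub_mul_hermiteN_sq_le (m k : ℕ) (x : ℝ) (hx : x ^ 2 ≤ 4 * m) :
    ((k : ℝ) + 1 - m) * hermiteN (k + 1) x ^ 2 ≤ christoffelInv (k + 1) x := by
  have h := christoffel_darboux_diag k x
  simp only [← hermiteN_sq] at h
  rw [christoffelInv, h, hermiteN_sq, Nat.factorial_succ]
  have h1 : (0 : ℝ) < (k.factorial : ℝ) := by exact_mod_cast k.factorial_pos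
  have h2 : (0 : ℝ) < (k : ℝ) + 1 := by positivity
  push_cast
  rw [le_div_iff₀ h1]
  set a := hermiteEval (k + 1) x
  set c := hermiteEval k x
  have h3 : ((k : ℝ) + 1 - m) * (a ^ 2 / (((k : ℝ) + 1) * k.factorial)) * k.factorial =
      ((k : ℝ) + 1 - m) * a ^ 2 / ((k : ℝ) + 1) := by
    field_simp
  rw [h3, div_le_iff₀ h2]
  nlinarith [sq_nonneg (2 * ((k : ℝ) + 1) * c - x * a), mul_nonneg (sub_nonneg.2 hx) (sq_nonneg a)]

/-- For `x² ≤ 4m` all normalized Hermite polynomials are controlled by the first `m + 1`. -/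
theorem hermiteN_sq_le (m k : ℕ) (x : ℝ) (hx : x ^ 2 ≤ 4 * m) :
    hermiteN k x ^ 2 ≤ christoffelInv (m + 1) x := by
  rcases le_or_gt k m with h | h
  · exact Finset.single_le_sum (f := fun l => hermiteN l x ^ 2) (fun i _ => sq_nonneg _)
      (Finset.mem_range.2 (by omega))
  -- Growth is at most linear: the preceding inequality at k = m + i has prefactor i + 1, which
  -- cancels the factor in the induction hypothesis, so each new term is at most the sum of the
  -- first m + 1.
  · have key : ∀ i : ℕ, christoffelInv (m + i + 1) x ≤ (i + 1) * christoffelInv (m + 1) x := by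
      intro i
      induction i with
      | zero => simp
      | succ i ih =>
        have h1 := sub_mul_hermiteN_sq_le m (m + i) x hx
        have h2 : christoffelInv (m + (i + 1) + 1) x =
            christoffelInv (m + i + 1) x + hermiteN (m + i + 1) x ^ 2 := by
          simp only [christoffelInv, ← add_assoc]
          rw [Finset.sum_range_succ]
        rw [h2]
        push_cast at h1 ⊢
        have h3 : ((i : ℝ) + 1) * hermiteN (m + i + 1) x ^ 2 ≤
            (i + 1) * christoffelInv (m + 1) x := by
          refine le_trans (le_of_eq ?_) (h1.trans ih)
          ring
        have h4 := le_of_mul_le_mul_left h3 (by positivity)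
        linarith
    obtain ⟨i, rfl⟩ : ∃ i, k = m + i + 1 := ⟨k - m - 1, by omega⟩
    have h1 := sub_mul_hermiteN_sq_le m (m + i) x hx
    have h2 := key i
    push_cast at h1
    have h3 : ((i : ℝ) + 1) * hermiteN (m + i + 1) x ^ 2 ≤
        (i + 1) * christoffelInv (m + 1) x := by
      refine le_trans (le_of_eq ?_) (h1.trans h2)
      ring
    exact le_of_mul_le_mul_left h3 (by positivity)

/-! ### Zeros of Hermite polynomials -/

/-- If x² > 4m, the ratios q_k = He_{k+1}(x)/(x He_k(x)) stay at least 1/2 for k ≤ m, because the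
recurrence reads q_{k+1} = 1 - (k+1)/(x² q_k). So He_{m+1} cannot vanish at x. The claim `key` is
q_k ≥ 1/2 with denominators cleared. -/
theorem sq_lt_of_hermiteEval_eq_zero (m : ℕ) (x : ℝ) (hx : hermiteEval (m + 1) x = 0) :
    x ^ 2 ≤ 4 * m := by
  by_contra! hlt
  rcases eq_or_ne x 0 with rfl | hx0
  · have : (0 : ℝ) ≤ 4 * m := by positivity
    norm_num at hlt
    linarith
  have hx2 : 0 < x ^ 2 := by positivity
  have key : ∀ k ≤ m, hermiteEval k x ≠ 0 ∧
      x ^ 2 * hermiteEval k x ^ 2 ≤ 2 * (x * hermiteEval k x * hermiteEval (k + 1) x) := by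
    intro k
    induction k with
    | zero => intro _; simp; nlinarith
    | succ k ih =>
      intro hk
      obtain ⟨h1, h2⟩ := ih (by omega)
      have h4 : 0 < x ^ 2 * hermiteEval k x ^ 2 := by positivity
      have h3 : hermiteEval (k + 1) x ≠ 0 := by
        intro h
        rw [h] at h2
        linarith
      refine ⟨h3, ?_⟩
      rw [hermiteEval_add_two]
      set a := hermiteEval (k + 1) x
      set c := hermiteEval k x
      have hkm : ((k : ℝ) + 1) ≤ m := by exact_mod_cast hk
      have h5 : x ^ 2 * c ^ 2 * (4 * (k + 1) * a ^ 2) ≤ x ^ 2 * c ^ 2 * (x ^ 2 * a ^ 2) := by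
        have : 4 * ((k : ℝ) + 1) ≤ x ^ 2 := by linarith
        gcongr
      have h6 : 0 < x * c * a := by linarith
      have h7 : 2 * (k + 1) * (x * c * a) ≤ x ^ 2 * a ^ 2 := by
        have h8 : (x ^ 2 * c ^ 2) * (2 * (k + 1) * (x * c * a)) ≤
            2 * (x * c * a) * (2 * (k + 1) * (x * c * a)) := by
          gcongr
        have h9 : 2 * (x * c * a) * (2 * (k + 1) * (x * c * a)) =
          x ^ 2 * c ^ 2 * (4 * (k + 1) * a ^ 2) := by ring
        exact le_of_mul_le_mul_left ((h8.trans h9.le).trans h5) h4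
      nlinarith
  obtain ⟨h1, h2⟩ := key m le_rfl
  rw [hx] at h2
  have : 0 < x ^ 2 * hermiteEval m x ^ 2 := by positivity
  linarith

section Roots

open Polynomial

/-- The real Hermite polynomial of degree `n`. -/
def hermiteReal (n : ℕ) : ℝ[X] := (hermite n).map (Int.castRingHom ℝ)

theorem eval_hermiteReal (n : ℕ) (x : ℝ) : (hermiteReal n).eval x = hermiteEval n x := by
  rw [hermiteReal, hermiteEval, eval_map, aeval_def]
  rfl

theorem hermiteReal_monic (n : ℕ) : (hermiteReal n).Monic := (hermite_monic n).map _

theorem natDegree_hermiteReal (n : ℕ) : (hermiteReal n).natDegree = n := by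
  rw [hermiteReal, (hermite_monic n).natDegree_map, natDegree_hermite]

theorem hermiteEval_conj (n : ℕ) (z : ℂ) :
    hermiteEval n ((starRingEnd ℂ) z) = (starRingEnd ℂ) (hermiteEval n z) := by
  induction n using Nat.strong_induction_on with
  | _ n ih =>
    match n with
    | 0 => simp
    | 1 => simp
    | n + 2 =>
      rw [hermiteEval_add_two, hermiteEval_add_two, ih (n + 1) (by omega), ih n (by omega)]
      simp

/-- Apply Christoffel-Darboux to z and its conjugate: the right side vanishes, while the sum on the
left is a positive sum of squared moduli, so z equals its conjugate. -/
theorem im_eq_zero_of_hermiteEval_eq_zero (n : ℕ) (z : ℂ) (hz : hermiteEval (n + 1) z = 0) :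
    z.im = 0 := by
  have h := christoffel_darboux n z ((starRingEnd ℂ) z)
  simp only [hermiteEval_conj, hz, map_zero, zero_mul, mul_zero, sub_zero, zero_div] at h
  rcases mul_eq_zero.1 h with h | h
  · have := Complex.conj_eq_iff_im.1 (sub_eq_zero.1 h).symm
    exact this
  · exfalso
    have h1 : ∑ l ∈ Finset.range (n + 1), hermiteEval l z * (starRingEnd ℂ) (hermiteEval l z) /
        (l.factorial : ℂ) =
        ((∑ l ∈ Finset.range (n + 1), ‖hermiteEval l z‖ ^ 2 / (l.factorial : ℝ) : ℝ) : ℂ) := by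
      push_cast
      refine Finset.sum_congr rfl fun l _ => ?_
      rw [Complex.mul_conj']
    rw [h1, Complex.ofReal_eq_zero] at h
    have h2 : 0 < ∑ l ∈ Finset.range (n + 1), ‖hermiteEval l z‖ ^ 2 / (l.factorial : ℝ) :=
      Finset.sum_pos' (fun i _ => by positivity) ⟨0, by simp, by simp⟩
    linarith

theorem hermiteReal_splits (n : ℕ) : (hermiteReal n).Splits := by
  rcases n with _ | n
  · simp [hermiteReal]
  have hC : ((hermiteReal (n + 1)).map (algebraMap ℝ ℂ)).Splits := IsAlgClosed.splits _
  refine Splits.of_splits_map_of_injective (algebraMap ℝ ℂ).injective hC fun a ha => ?_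
  have h1 : hermiteEval (n + 1) a = 0 := by
    have h2 := (mem_roots'.1 ha).2
    rw [IsRoot.def, hermiteReal, Polynomial.map_map, eval_map] at h2
    rw [hermiteEval, aeval_def, show algebraMap ℤ ℂ = (algebraMap ℝ ℂ).comp (Int.castRingHom ℝ)
      from RingHom.ext_int _ _]
    exact h2
  exact ⟨a.re, Complex.ext (by simp) (by simp [im_eq_zero_of_hermiteEval_eq_zero n a h1])⟩

theorem hermiteEval_ne_zero_of_succ {n : ℕ} {x : ℝ} (hx : hermiteEval (n + 1) x = 0) :
    hermiteEval n x ≠ 0 := by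
  intro h
  have h1 := christoffel_darboux_diag n x
  simp only [← hermiteN_sq, hx, h] at h1
  have := christoffelInv_pos n x
  rw [christoffelInv, h1] at this
  simp at this

/-- All roots are real by `hermiteReal_splits`. They are simple because the derivative is a multiple
of the preceding Hermite polynomial, which has no zero in common. -/
theorem card_roots_hermiteReal (n : ℕ) : (hermiteReal n).roots.toFinset.card = n := by
  have hne : hermiteReal n ≠ 0 := (hermiteReal_monic n).ne_zero
  have hnd : (hermiteReal n).roots.Nodup := by
    rcases n with _ | n
    · simp [hermiteReal]
    rw [Multiset.nodup_iff_count_le_one]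
    intro a
    rw [count_roots]
    by_contra! hlt
    obtain ⟨h1, h2⟩ := (one_lt_rootMultiplicity_iff_isRoot hne).1 hlt
    rw [IsRoot.def, eval_hermiteReal] at h1
    rw [IsRoot.def, hermiteReal, derivative_map, derivative_hermite_succ] at h2
    simp only [Polynomial.map_mul, Polynomial.map_add, Polynomial.map_natCast, Polynomial.map_one,
      eval_mul, eval_add, eval_natCast, eval_one] at h2
    rcases mul_eq_zero.1 h2 with h2 | h2
    · have : (0 : ℝ) < (n : ℝ) + 1 := by positivity
      linarith
    · exact hermiteEval_ne_zero_of_succ h1 ((eval_hermiteReal n a).symm.trans h2)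
  rw [Multiset.toFinset_card_of_nodup hnd, ← (hermiteReal_splits n).natDegree_eq_card_roots,
    natDegree_hermiteReal]

theorem gaussHermite_mem {n i : ℕ} (hi : i ≤ n) :
    gaussHermite n i ∈ (hermiteReal (n + 1)).roots.toFinset := by
  -- There are exactly n + 1 roots, so the default value in `gaussHermite` is never reached.
  have hl : i < ((hermiteReal (n + 1)).roots.toFinset.sort).length := by
    rw [Finset.length_sort, card_roots_hermiteReal]; omega
  have : gaussHermite n i = ((hermiteReal (n + 1)).roots.toFinset.sort)[i] :=
    List.getD_eq_getElem _ _ hl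
  rw [this, ← Finset.mem_sort (· ≤ ·)]
  exact List.getElem_mem _

theorem hermiteEval_gaussHermite {n i : ℕ} (hi : i ≤ n) :
    hermiteEval (n + 1) (gaussHermite n i) = 0 := by
  have h := gaussHermite_mem hi
  rw [Multiset.mem_toFinset] at h
  have := (mem_roots'.1 h).2
  rwa [IsRoot.def, eval_hermiteReal] at this

theorem gaussHermite_injOn (n : ℕ) :
    Set.InjOn (gaussHermite n) (Finset.range (n + 1) : Finset ℕ) := by
  intro i hi j hj h
  rw [Finset.mem_coe, Finset.mem_range] at hi hj
  have hlen : ((hermiteReal (n + 1)).roots.toFinset.sort).length = n + 1 := by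
    rw [Finset.length_sort, card_roots_hermiteReal]
  have e : ∀ i < n + 1, ∀ h : i < ((hermiteReal (n + 1)).roots.toFinset.sort).length,
      gaussHermite n i = ((hermiteReal (n + 1)).roots.toFinset.sort)[i] := fun i _ hl =>
    List.getD_eq_getElem _ _ hl
  rw [e i hi (by omega), e j hj (by omega)] at h
  exact (List.Nodup.getElem_inj_iff (Finset.sort_nodup _ _)).1 h

@[simp] theorem gaussHermite_zero_zero : gaussHermite 0 0 = 0 := by
  simpa using hermiteEval_gaussHermite (le_refl 0)

/-! ### Lagrange interpolation at the Gauss-Hermite points -/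

theorem lagrangeBasis_eq_eval (n i : ℕ) (y : ℝ) :
    lagrangeBasis n i y = (Lagrange.basis (Finset.range (n + 1)) (gaussHermite n) i).eval y := by
  rw [Lagrange.basis, eval_prod, lagrangeBasis]
  refine Finset.prod_congr rfl fun j _ => ?_
  rw [Lagrange.basisDivisor]
  simp only [eval_mul, eval_C, eval_sub, eval_X]
  rw [div_eq_inv_mul]

/-- The univariate interpolation operator at the Gauss-Hermite points. -/
def interp (n : ℕ) (f : ℝ → ℝ) (y : ℝ) : ℝ :=
  ∑ i ∈ Finset.range (n + 1), lagrangeBasis n i y * f (gaussHermite n i)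

theorem interp_eval_of_degree_lt {n : ℕ} {q : ℝ[X]} (hq : q.degree < (n + 1 : ℕ)) (y : ℝ) :
    interp n (fun x => q.eval x) y = q.eval y := by
  have h := Lagrange.eq_interpolate (s := Finset.range (n + 1)) (v := gaussHermite n)
    (gaussHermite_injOn n) (f := q) (by rwa [Finset.card_range])
  conv_rhs => rw [h]
  rw [Lagrange.interpolate_apply, eval_finsetSum, interp]
  refine Finset.sum_congr rfl fun i _ => ?_
  rw [eval_mul, eval_C, lagrangeBasis_eq_eval, mul_comm]

theorem hermiteN_eq_eval (k : ℕ) (y : ℝ) :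
    hermiteN k y = (C (√(k.factorial : ℝ))⁻¹ * hermiteReal k).eval y := by
  rw [eval_mul, eval_C, eval_hermiteReal, hermiteN, div_eq_inv_mul]

theorem interp_hermiteN_of_le {n k : ℕ} (hk : k ≤ n) (y : ℝ) :
    interp n (hermiteN k) y = hermiteN k y := by
  have h := interp_eval_of_degree_lt (n := n) (q := C (√(k.factorial : ℝ))⁻¹ * hermiteReal k) ?_ y
  · simpa only [← hermiteN_eq_eval] using h
  · rw [degree_C_mul (inv_ne_zero (by positivity)),
      degree_eq_natDegree (hermiteReal_monic k).ne_zero, natDegree_hermiteReal]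
    exact_mod_cast Nat.lt_succ_of_le hk

/-- The Lagrange basis in terms of the Christoffel-Darboux kernel. -/
theorem lagrangeBasis_eq_kernel {n i : ℕ} (hi : i ≤ n) (y : ℝ) :
    lagrangeBasis n i y = (∑ l ∈ Finset.range (n + 1),
      hermiteN l (gaussHermite n i) * hermiteN l y) / christoffelInv (n + 1) (gaussHermite n i) := by
  -- At two distinct nodes the right side of Christoffel-Darboux vanishes, so the kernel is zero
  -- there.
  have hz : ∀ j ∈ Finset.range (n + 1), j ≠ i → ∑ l ∈ Finset.range (n + 1),
      hermiteN l (gaussHermite n i) * hermiteN l (gaussHermite n j) = 0 := by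
    intro j hj hji
    have hj' : j ≤ n := Nat.lt_succ_iff.1 (Finset.mem_range.1 hj)
    have h := christoffel_darboux n (gaussHermite n i) (gaussHermite n j)
    simp only [hermiteEval_gaussHermite hi, hermiteEval_gaussHermite hj', zero_mul, mul_zero,
      sub_zero, zero_div, ← hermiteN_mul] at h
    refine (mul_eq_zero.1 h).resolve_left (sub_ne_zero.2 fun he => hji ?_)
    exact (gaussHermite_injOn n (by simpa using Nat.lt_succ_of_le hi) hj he).symm
  -- The kernel has degree at most n in its second argument, so it equals its own interpolant, which
  -- by `hz` has a single nonzero nodal value.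
  have hlin : ∀ x, interp n (fun y => ∑ l ∈ Finset.range (n + 1),
      hermiteN l (gaussHermite n i) * hermiteN l y) x = ∑ l ∈ Finset.range (n + 1),
      hermiteN l (gaussHermite n i) * hermiteN l x := by
    intro x
    simp only [interp, Finset.mul_sum]
    rw [Finset.sum_comm]
    refine Finset.sum_congr rfl fun l hl => ?_
    rw [← interp_hermiteN_of_le (Nat.lt_succ_iff.1 (Finset.mem_range.1 hl)) x, interp,
      Finset.mul_sum]
    exact Finset.sum_congr rfl fun j _ => by ring
  rw [← hlin y, interp, Finset.sum_eq_single i]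
  · rw [eq_div_iff (christoffelInv_pos n _).ne', christoffelInv]
    simp only [sq]
  · intro j hj hji
    rw [hz j hj hji, mul_zero]
  · intro h
    exact absurd (Finset.mem_range.2 (Nat.lt_succ_of_le hi)) h

end Roots

/-! ### The univariate Gaussian measure -/

/-- The standard Gaussian measure on `ℝ`. -/
abbrev gauss : Measure ℝ := gaussianReal 0 1

theorem continuous_hermiteEval (n : ℕ) : Continuous (hermiteEval n : ℝ → ℝ) := by
  have : (hermiteEval n : ℝ → ℝ) = fun x => (hermiteReal n).eval x := by
    ext x; rw [eval_hermiteReal]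
  rw [this]
  exact (hermiteReal n).continuous

theorem hasDerivAt_hermiteEval_succ (n : ℕ) (x : ℝ) :
    HasDerivAt (hermiteEval (n + 1)) (((n : ℝ) + 1) * hermiteEval n x) x := by
  have h := (hermiteReal (n + 1)).hasDerivAt x
  have h2 : (hermiteReal (n + 1)).derivative.eval x = ((n : ℝ) + 1) * hermiteEval n x := by
    rw [hermiteReal, Polynomial.derivative_map, derivative_hermite_succ, ← eval_hermiteReal,
      hermiteReal]
    simp
  rw [h2] at h
  exact h.congr_of_eventuallyEq (Eventually.of_forall fun y => (eval_hermiteReal _ y).symm)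

/-- All finite exponents are treated together because the recurrence multiplies by x and Hölder's
inequality then doubles the exponent. -/
theorem memLp_hermiteEval (n : ℕ) : ∀ p : ℝ≥0∞, p ≠ ∞ → MemLp (hermiteEval n) p gauss := by
  induction n using Nat.strong_induction_on with
  | _ n ih =>
    match n with
    | 0 =>
      intro p _
      have : (hermiteEval 0 : ℝ → ℝ) = fun _ => 1 := by ext; simp
      rw [this]; exact memLp_const 1
    | 1 =>
      intro p hp
      have : (hermiteEval 1 : ℝ → ℝ) = id := by ext; simp
      rw [this]; exact memLp_id_gaussianReal' p hp
    | n + 2 =>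
      intro p hp
      have hp2 : 2 * p ≠ ∞ := ENNReal.mul_ne_top (by simp) hp
      have : (hermiteEval (n + 2) : ℝ → ℝ) = (fun x => id x * hermiteEval (n + 1) x) -
          fun x => ((n : ℝ) + 1) * hermiteEval n x := by
        ext x; simp [hermiteEval_add_two]
      rw [this]
      have : ENNReal.HolderTriple (2 * p) (2 * p) p := ⟨by
        rw [ENNReal.mul_inv (by simp) (by simp), ← two_mul, ← mul_assoc,
          ENNReal.mul_inv_cancel (by simp) (by simp), one_mul]⟩
      exact (MemLp.mul' (ih (n + 1) (by omega) (2 * p) hp2)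
        (memLp_id_gaussianReal' (2 * p) hp2)).sub ((ih n (by omega) p hp).const_mul _)

section Vector

variable {X : Type*} [NormedAddCommGroup X] [NormedSpace ℝ X]

theorem integrable_gauss_iff (f : ℝ → X) :
    Integrable f gauss ↔ Integrable (fun x => gaussianPDFReal 0 1 x • f x) := by
  rw [gauss, gaussianReal_of_var_ne_zero _ one_ne_zero,
    integrable_withDensity_iff_integrable_smul' (measurable_gaussianPDF _ _)
      (ae_of_all _ fun _ => gaussianPDF_lt_top)]
  simp only [toReal_gaussianPDF]

theorem integrable_hermiteEval_smul (m : ℕ) {g : ℝ → X} (hg : MemLp g 2 gauss) :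
    Integrable (fun x => hermiteEval m x • g x) gauss :=
  memLp_one_iff_integrable.1 (MemLp.smul (p := 2) (q := 2) hg (memLp_hermiteEval m 2 (by simp)))

/-- Rodrigues' formula in differentiated form; it is why integration by parts raises the Hermite
degree by one. -/
theorem hasDerivAt_hermiteEval_mul_pdf (m : ℕ) (x : ℝ) :
    HasDerivAt (fun x => gaussianPDFReal 0 1 x * hermiteEval m x)
      (-(gaussianPDFReal 0 1 x * hermiteEval (m + 1) x)) x := by
  have h1 : HasDerivAt (gaussianPDFReal 0 1) (-x * gaussianPDFReal 0 1 x) x := by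
    have h2 : HasDerivAt (fun x : ℝ => -(x - 0) ^ 2 / (2 * ((1 : NNReal) : ℝ))) (-x) x := by
      have h3 := (((hasDerivAt_id x).sub_const 0).pow 2).neg.div_const (2 * ((1 : NNReal) : ℝ))
      refine h3.congr_deriv ?_
      simp
      ring
    rw [gaussianPDFReal_def]
    refine (h2.exp.const_mul _).congr_deriv ?_
    ring
  rcases m with _ | m
  · refine (h1.mul_const (1 : ℝ)).congr_deriv ?_ |>.congr_of_eventuallyEq
      (Eventually.of_forall fun y => by simp)
    simp; ring
  · refine (h1.mul (hasDerivAt_hermiteEval_succ m x)).congr_deriv ?_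
    rw [hermiteEval_add_two]
    ring

/-- Gaussian integration by parts against Hermite polynomials. -/
theorem integral_hermiteEval_smul_deriv (m : ℕ) {g g' : ℝ → X}
    (hd : ∀ x, HasDerivAt g (g' x) x) (hg : MemLp g 2 gauss) (hg' : MemLp g' 2 gauss) :
    ∫ x, hermiteEval m x • g' x ∂gauss = ∫ x, hermiteEval (m + 1) x • g x ∂gauss := by
  rw [gauss, integral_gaussianReal_eq_integral_smul one_ne_zero,
    integral_gaussianReal_eq_integral_smul one_ne_zero]
  have i1 := (integrable_gauss_iff _).1 (integrable_hermiteEval_smul m hg')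
  have i2 := (integrable_gauss_iff _).1 (integrable_hermiteEval_smul (m + 1) hg)
  have i3 := (integrable_gauss_iff _).1 (integrable_hermiteEval_smul m hg)
  have h := integral_bilinear_hasDerivAt_right_eq_neg_left_of_integrable
    (L := ContinuousLinearMap.lsmul ℝ ℝ) (u := fun x => gaussianPDFReal 0 1 x * hermiteEval m x)
    (v := g) (u' := fun x => -(gaussianPDFReal 0 1 x * hermiteEval (m + 1) x)) (v' := g')
    (fun x _ => hasDerivAt_hermiteEval_mul_pdf m x) (fun x _ => hd x)
    (by simpa [mul_smul] using i1) (by simpa [mul_smul] using i2.neg)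
    (by simpa [mul_smul] using i3)
  simpa [mul_smul, integral_neg] using h

end Vector

theorem integral_hermiteEval_mul (m n : ℕ) :
    ∫ x, hermiteEval m x * hermiteEval n x ∂gauss = if m = n then (n.factorial : ℝ) else 0 := by
  have h0 : ∀ m : ℕ, ∫ x, hermiteEval (m + 1) x * hermiteEval 0 x ∂gauss = 0 := by
    intro m
    have h := integral_hermiteEval_smul_deriv m (g := fun _ => (1 : ℝ)) (g' := fun _ => 0)
      (fun x => hasDerivAt_const x 1) (memLp_const 1) (memLp_const 0)
    simpa using h.symm
  induction n generalizing m with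
  | zero =>
    rcases m with _ | m
    · simp
    · rw [h0]; simp
  | succ n ih =>
    rcases m with _ | m
    · have := h0 n
      simp only [mul_comm] at this ⊢
      rw [this]; simp
    · have h := integral_hermiteEval_smul_deriv m (g := hermiteEval (n + 1))
        (g' := fun x => ((n : ℝ) + 1) * hermiteEval n x) (hasDerivAt_hermiteEval_succ n)
        (memLp_hermiteEval _ 2 (by simp)) ((memLp_hermiteEval _ 2 (by simp)).const_mul _)
      simp only [smul_eq_mul] at h
      rw [← h]
      have h2 : ∀ x : ℝ, hermiteEval m x * (((n : ℝ) + 1) * hermiteEval n x) =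
        ((n : ℝ) + 1) * (hermiteEval m x * hermiteEval n x) := fun x => by ring
      simp only [h2]
      rw [integral_const_mul, ih]
      simp only [Nat.add_right_cancel_iff, Nat.factorial_succ]
      split_ifs <;> push_cast <;> ring

theorem memLp_hermiteN (n : ℕ) (p : ℝ≥0∞) (hp : p ≠ ∞) : MemLp (hermiteN n) p gauss := by
  have : hermiteN n = fun x => (√(n.factorial : ℝ))⁻¹ * hermiteEval n x := by
    ext x; rw [hermiteN, div_eq_inv_mul]
  rw [this]
  exact (memLp_hermiteEval n p hp).const_mul _

theorem continuous_hermiteN (n : ℕ) : Continuous (hermiteN n) :=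
  (continuous_hermiteEval n).div_const _

theorem integral_hermiteN_mul (m n : ℕ) :
    ∫ x, hermiteN m x * hermiteN n x ∂gauss = if m = n then 1 else 0 := by
  have h : ∀ x, hermiteN m x * hermiteN n x =
      (√(m.factorial : ℝ) * √(n.factorial : ℝ))⁻¹ * (hermiteEval m x * hermiteEval n x) := by
    intro x; rw [hermiteN, hermiteN]; field_simp
  simp only [h]
  rw [integral_const_mul, integral_hermiteEval_mul]
  split_ifs with h
  · subst h
    rw [Real.mul_self_sqrt (by positivity), inv_mul_cancel₀ (by positivity)]
  · simp

/-! ### Norms of interpolants of Hermite polynomials -/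

theorem continuous_lagrangeBasis (n i : ℕ) : Continuous (lagrangeBasis n i) := by
  unfold lagrangeBasis
  fun_prop

theorem memLp_lagrangeBasis {n i : ℕ} (hi : i ≤ n) : MemLp (lagrangeBasis n i) 2 gauss := by
  have : lagrangeBasis n i = fun y => ∑ l ∈ Finset.range (n + 1),
      (hermiteN l (gaussHermite n i) / christoffelInv (n + 1) (gaussHermite n i)) * hermiteN l y := by
    ext y
    rw [lagrangeBasis_eq_kernel hi, Finset.sum_div]
    exact Finset.sum_congr rfl fun l _ => by ring
  rw [this]
  exact memLp_finsetSum _ fun l _ => (memLp_hermiteN l 2 (by simp)).const_mul _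

/-- In the kernel representation the coefficients in the orthonormal basis are h_l(χ)/κ, whose
squares sum to κ/κ². -/
theorem integral_lagrangeBasis_sq {n i : ℕ} (hi : i ≤ n) :
    ∫ y, lagrangeBasis n i y ^ 2 ∂gauss = (christoffelInv (n + 1) (gaussHermite n i))⁻¹ := by
  have hI : ∀ l k : ℕ, Integrable (fun y => hermiteN l y * hermiteN k y) gauss := fun l k =>
    MemLp.integrable_mul (p := 2) (q := 2) (memLp_hermiteN l 2 (by simp))
      (memLp_hermiteN k 2 (by simp))
  set χ := gaussHermite n i
  set κ := christoffelInv (n + 1) χ with hκ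
  have hκ0 : 0 < κ := christoffelInv_pos n χ
  have h : ∀ y, lagrangeBasis n i y ^ 2 = ∑ l ∈ Finset.range (n + 1), ∑ k ∈ Finset.range (n + 1),
      (hermiteN l χ * hermiteN k χ / κ ^ 2) * (hermiteN l y * hermiteN k y) := by
    intro y
    rw [lagrangeBasis_eq_kernel hi, div_pow, sq (Finset.sum _ _), Finset.sum_mul_sum,
      Finset.sum_div]
    refine Finset.sum_congr rfl fun l _ => ?_
    rw [Finset.sum_div]
    exact Finset.sum_congr rfl fun k _ => by ring
  simp only [h]
  rw [integral_finsetSum _ fun l _ => integrable_finsetSum _ fun k _ => (hI l k).const_mul _]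
  have h2 : ∀ l ∈ Finset.range (n + 1), ∫ y, ∑ k ∈ Finset.range (n + 1),
      (hermiteN l χ * hermiteN k χ / κ ^ 2) * (hermiteN l y * hermiteN k y) ∂gauss =
      hermiteN l χ ^ 2 / κ ^ 2 := by
    intro l hl
    rw [integral_finsetSum _ fun k _ => (hI l k).const_mul _]
    simp only [integral_const_mul, integral_hermiteN_mul]
    simp only [mul_ite, mul_one, mul_zero, Finset.sum_ite_eq, if_pos hl]
    ring
  rw [Finset.sum_congr rfl h2, ← Finset.sum_div]
  change κ / κ ^ 2 = κ⁻¹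
  field_simp

/-- The `L²` norm of a real function on the line. -/
theorem eLpNorm_two_eq {Ω : Type*} [MeasurableSpace Ω] {μ : Measure Ω} {f : Ω → ℝ}
    (hf : MemLp f 2 μ) : eLpNorm f 2 μ = ENNReal.ofReal (√(∫ x, f x ^ 2 ∂μ)) := by
  rw [hf.eLpNorm_eq_integral_rpow_norm (by simp) (by simp)]
  congr 1
  rw [Real.sqrt_eq_rpow]
  simp

theorem eLpNorm_hermiteN (n : ℕ) : eLpNorm (hermiteN n) 2 gauss = 1 := by
  rw [eLpNorm_two_eq (memLp_hermiteN n 2 (by simp))]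
  simp only [sq, integral_hermiteN_mul]
  simp

theorem continuous_interp (n : ℕ) (f : ℝ → ℝ) : Continuous (interp n f) := by
  unfold interp
  exact continuous_finsetSum _ fun i _ => (continuous_lagrangeBasis n i).mul_const _

/-- Each of the n + 1 Lagrange terms has norm |h_k(χ)| κ(χ)^{-1/2} ≤ 1. That the bound does not
depend on k is essential, since all Hermite modes outside Λ enter the error. -/
theorem eLpNorm_interp_hermiteN_le (n k : ℕ) :
    eLpNorm (interp n (hermiteN k)) 2 gauss ≤ (n + 1 : ℕ) := by
  have h1 : interp n (hermiteN k) = ∑ i ∈ Finset.range (n + 1),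
      (hermiteN k (gaussHermite n i)) • lagrangeBasis n i := by
    ext y; simp [interp, Finset.sum_apply, mul_comm]
  rw [h1]
  refine (eLpNorm_sum_le (fun i _ => ((continuous_lagrangeBasis n i).const_smul
    (hermiteN k (gaussHermite n i))).aestronglyMeasurable) (by norm_num)).trans ?_
  refine (Finset.sum_le_card_nsmul _ _ 1 fun i hi => ?_).trans (by simp)
  have hi' : i ≤ n := Nat.lt_succ_iff.1 (Finset.mem_range.1 hi)
  rw [eLpNorm_const_smul, eLpNorm_two_eq (memLp_lagrangeBasis hi'), integral_lagrangeBasis_sq hi']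
  set χ := gaussHermite n i
  have h2 := hermiteN_sq_le n k χ (sq_lt_of_hermiteEval_eq_zero n χ (hermiteEval_gaussHermite hi'))
  have h3 := christoffelInv_pos n χ
  rw [← ofReal_norm, ← ENNReal.ofReal_mul (norm_nonneg _), ← ENNReal.ofReal_one]
  refine ENNReal.ofReal_le_ofReal ?_
  rw [Real.norm_eq_abs, ← Real.sqrt_sq_eq_abs, ← Real.sqrt_mul (sq_nonneg _), Real.sqrt_le_one]
  rw [← div_eq_mul_inv]
  exact (div_le_one h3).2 h2

/-- The difference `I_n - I_{n-1}` of univariate interpolation operators, with `I_{-1} = 0`. -/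
def interpDiff (n : ℕ) (f : ℝ → ℝ) (y : ℝ) : ℝ :=
  interp n f y - if n = 0 then 0 else interp (n - 1) f y

theorem sum_interpDiff (n : ℕ) (f : ℝ → ℝ) (y : ℝ) :
    ∑ m ∈ Finset.range (n + 1), interpDiff m f y = interp n f y := by
  induction n with
  | zero => simp [interpDiff]
  | succ n ih => rw [Finset.sum_range_succ, ih]; simp [interpDiff]

theorem interpDiff_hermiteN_of_lt {n k : ℕ} (h : k < n) (y : ℝ) :
    interpDiff n (hermiteN k) y = 0 := by
  rw [interpDiff, if_neg (by omega), interp_hermiteN_of_le h.le,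
    interp_hermiteN_of_le (by omega), sub_self]

theorem continuous_interpDiff (n : ℕ) (f : ℝ → ℝ) : Continuous (interpDiff n f) := by
  unfold interpDiff
  split_ifs
  · exact (continuous_interp n f).sub continuous_const
  · exact (continuous_interp n f).sub (continuous_interp _ f)

theorem eLpNorm_interpDiff_hermiteN_le (n k : ℕ) :
    eLpNorm (interpDiff n (hermiteN k)) 2 gauss ≤ ENNReal.ofReal (2 * (n + 1)) := by
  have key : ENNReal.ofReal (2 * (n + 1)) = (n + 1 : ℕ) + (n + 1 : ℕ) := by
    rw [two_mul, ENNReal.ofReal_add (by positivity) (by positivity),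
      show ((n : ℝ) + 1) = ((n + 1 : ℕ) : ℝ) by push_cast; ring, ENNReal.ofReal_natCast]
  rw [key]
  unfold interpDiff
  split_ifs with h
  · simp only [sub_zero]
    exact (eLpNorm_interp_hermiteN_le n k).trans le_self_add
  · refine (eLpNorm_sub_le (continuous_interp n _).aestronglyMeasurable
      (continuous_interp (n - 1) _).aestronglyMeasurable (by norm_num)).trans ?_
    refine add_le_add (eLpNorm_interp_hermiteN_le n k)
      ((eLpNorm_interp_hermiteN_le (n - 1) k).trans ?_)
    exact_mod_cast (by omega)

/-! ### Cauchy's formula and Hermite coefficients -/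

/-- The uniform probability measure on `(0, 2π]`. -/
def angle : Measure ℝ := ENNReal.ofReal (2 * Real.pi)⁻¹ • volume.restrict (Set.Ioc 0 (2 * Real.pi))

instance : IsProbabilityMeasure angle := ⟨by
  have := Real.pi_pos
  rw [angle, Measure.smul_apply, Measure.restrict_apply_univ, Real.volume_Ioc, smul_eq_mul,
    ← ENNReal.ofReal_mul (by positivity), sub_zero, inv_mul_cancel₀ (by positivity),
    ENNReal.ofReal_one]⟩

theorem integral_angle {X : Type*} [NormedAddCommGroup X] [NormedSpace ℝ X] (f : ℝ → X) :
    ∫ θ, f θ ∂angle = (2 * Real.pi)⁻¹ • ∫ θ in (0 : ℝ)..2 * Real.pi, f θ := by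
  have := Real.pi_pos
  rw [angle, integral_smul_measure, intervalIntegral.integral_of_le (by positivity),
    ENNReal.toReal_ofReal (by positivity)]

/-- The character `θ ↦ exp(i l θ)`. -/
def character (l : ℤ) (θ : ℝ) : ℂ := Complex.exp (l * θ * Complex.I)

theorem continuous_character (l : ℤ) : Continuous (character l) := by
  unfold character; fun_prop

theorem norm_character (l : ℤ) (θ : ℝ) : ‖character l θ‖ = 1 := by
  have := Complex.norm_exp_ofReal_mul_I (l * θ)
  simpa [character] using this

theorem character_mul (l m : ℤ) (θ : ℝ) : character l θ * character m θ = character (l + m) θ := by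
  rw [character, character, character, ← Complex.exp_add]
  push_cast
  ring_nf

theorem conj_character (l : ℤ) (θ : ℝ) : (starRingEnd ℂ) (character l θ) = character (-l) θ := by
  rw [character, ← Complex.exp_conj, character]
  simp

theorem integral_character (l : ℤ) : ∫ θ, character l θ ∂angle = if l = 0 then 1 else 0 := by
  rw [integral_angle]
  split_ifs with h
  · subst h
    have := Real.pi_pos
    simp only [character, Int.cast_zero, zero_mul, Complex.exp_zero]
    simp
    field_simp
  · have hl : (l : ℂ) * Complex.I ≠ 0 := by simp [h]
    have h1 : ∀ θ : ℝ, character l θ = Complex.exp (l * Complex.I * θ) := fun θ => by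
      rw [character]; ring_nf
    simp only [h1]
    rw [integral_exp_mul_complex hl]
    have h2 : Complex.exp (l * Complex.I * ((2 * Real.pi : ℝ) : ℂ)) = 1 := by
      rw [Complex.exp_eq_one_iff]
      exact ⟨l, by push_cast; ring⟩
    rw [h2]
    simp

/-- The horizontal strip `|Im z| < ρ`. -/
def strip₁ (ρ : ℝ) : Set ℂ := {z | |z.im| < ρ}

theorem isOpen_strip₁ (ρ : ℝ) : IsOpen (strip₁ ρ) :=
  isOpen_lt (by fun_prop) continuous_const

theorem ofReal_add_mem_strip₁ {ρ : ℝ} (y : ℝ) {w : ℂ} (hw : ‖w‖ < ρ) : (y : ℂ) + w ∈ strip₁ ρ := by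
  have := Complex.abs_im_le_norm w
  simp only [strip₁, Set.mem_ofPred_eq, Complex.add_im, Complex.ofReal_im, zero_add]
  linarith

theorem diffContOnCl_ball_of_strip₁ {X : Type*} [NormedAddCommGroup X] [NormedSpace ℂ X]
    {h : ℂ → X} {ρ R : ℝ} (hh : DifferentiableOn ℂ h (strip₁ ρ)) (hRρ : R < ρ) (y : ℝ) :
    DiffContOnCl ℂ h (Metric.ball (y : ℂ) R) := by
  refine (hh.mono fun z hz => ?_).diffContOnCl
  have hz' := Metric.closure_ball_subset_closedBall hz
  rw [mem_closedBall_iff_norm] at hz'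
  have := ofReal_add_mem_strip₁ y (lt_of_le_of_lt hz' hRρ)
  simpa using this

section Cauchy

variable {X : Type*} [NormedAddCommGroup X] [NormedSpace ℂ X] [CompleteSpace X]

/-- Cauchy's formula for the l-th derivative, with the circle parametrized by a uniform angle. -/
theorem integral_character_smul_circle {h : ℂ → X} {y : ℂ} {R : ℝ} (hR : 0 < R)
    (hh : DiffContOnCl ℂ h (Metric.ball y R)) (l : ℕ) :
    ∫ θ, character (-l) θ • h (y + R * character 1 θ) ∂angle =
      ((R ^ l / l.factorial : ℝ) : ℂ) • iteratedDeriv l h y := by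
  have h1 := hh.circleIntegral_one_div_sub_center_pow_smul hR l
  rw [circleIntegral] at h1
  have h2 : ∀ θ : ℝ, deriv (circleMap y R) θ • (1 / (circleMap y R θ - y) ^ (l + 1)) •
      h (circleMap y R θ) = (Complex.I * ((R : ℂ) ^ l)⁻¹) •
        (character (-l) θ • h (y + R * character 1 θ)) := by
    intro θ
    have e1 : circleMap y R θ = y + R * character 1 θ := by
      simp [circleMap, character]
    have hR' : (R : ℂ) ≠ 0 := by exact_mod_cast hR.ne'
    have e2 : character (-l) θ = (Complex.exp (θ * Complex.I) ^ l)⁻¹ := by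
      rw [character, ← Complex.exp_nat_mul, ← Complex.exp_neg]
      push_cast; ring_nf
    rw [e1, deriv_circleMap, smul_smul, smul_smul, circleMap, e2]
    congr 1
    have e3 : character 1 θ = Complex.exp (θ * Complex.I) := by simp [character]
    rw [e3]
    have := Complex.exp_ne_zero (θ * Complex.I)
    field_simp
    ring
  simp only [h2] at h1
  rw [intervalIntegral.integral_smul] at h1
  rw [integral_angle]
  have hpi := Real.pi_pos
  have hR' : (R : ℂ) ≠ 0 := by exact_mod_cast hR.ne'
  have hpi' : (Real.pi : ℂ) ≠ 0 := by exact_mod_cast hpi.ne'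
  have hl' : (l.factorial : ℂ) ≠ 0 := by exact_mod_cast l.factorial_ne_zero
  have h3 := congrArg (fun x => ((2 * Real.pi * Complex.I)⁻¹ * (R : ℂ) ^ l) • x) h1
  simp only [smul_smul] at h3
  rw [← Complex.coe_smul]
  convert h3 using 2
  · push_cast; field_simp
  · push_cast; field_simp

variable {h : ℂ → X} {ρ R : ℝ} {φ : ℝ → ℝ}

theorem hasDerivAt_iteratedDeriv (hh : DifferentiableOn ℂ h (strip₁ ρ)) (hρ : 0 < ρ) (l : ℕ)
    (y : ℝ) : HasDerivAt (fun y : ℝ => iteratedDeriv l h (y : ℂ))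
      (iteratedDeriv (l + 1) h (y : ℂ)) y := by
  have hy : (y : ℂ) ∈ strip₁ ρ := by simpa using ofReal_add_mem_strip₁ y (w := 0) (by simpa)
  have ha : AnalyticAt ℂ h (y : ℂ) :=
    (hh.analyticOnNhd (isOpen_strip₁ ρ)) _ hy
  have hd : DifferentiableAt ℂ (iteratedDeriv l h) (y : ℂ) := by
    rw [iteratedDeriv_eq_iterate]
    exact (ha.iterated_deriv l).differentiableAt
  have h1 := hd.hasDerivAt
  rw [← iteratedDeriv_succ] at h1
  have h2 := h1.scomp y (Complex.ofRealCLM.hasDerivAt (x := y))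
  simpa using! h2

/-- Cauchy's estimate on the circle of radius R about y bounds the derivative by l!/R^l times φ(y).
-/
theorem memLp_iteratedDeriv (hh : DifferentiableOn ℂ h (strip₁ ρ)) (hR : 0 < R) (hRρ : R < ρ)
    (hφ : Integrable (fun y => φ y ^ 2) gauss)
    (hb : ∀ (y : ℝ) (w : ℂ), ‖w‖ < ρ → ‖h (y + w)‖ ≤ φ y) (l : ℕ) :
    MemLp (fun y : ℝ => iteratedDeriv l h (y : ℂ)) 2 gauss := by
  have hc : Continuous (fun y : ℝ => iteratedDeriv l h (y : ℂ)) :=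
    continuous_iff_continuousAt.2 fun y =>
      (hasDerivAt_iteratedDeriv hh (hR.trans hRρ) l y).continuousAt
  rw [memLp_two_iff_integrable_sq_norm hc.aestronglyMeasurable]
  refine (hφ.const_mul ((l.factorial / R ^ l) ^ 2)).mono'
    (hc.norm.pow 2).aestronglyMeasurable (ae_of_all _ fun y => ?_)
  have h1 := Complex.norm_iteratedDeriv_le_of_forall_mem_sphere_norm_le l hR
    (diffContOnCl_ball_of_strip₁ hh hRρ y) (C := φ y) fun z hz => by
      rw [mem_sphere_iff_norm] at hz
      simpa using hb y (z - y) (by rw [hz]; exact hRρ)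
  rw [Real.norm_eq_abs, abs_of_nonneg (by positivity), ← mul_pow]
  refine pow_le_pow_left₀ (norm_nonneg _) (h1.trans (le_of_eq ?_)) 2
  ring

theorem integral_hermiteEval_smul_iteratedDeriv (hh : DifferentiableOn ℂ h (strip₁ ρ)) (hR : 0 < R)
    (hRρ : R < ρ) (hφ : Integrable (fun y => φ y ^ 2) gauss)
    (hb : ∀ (y : ℝ) (w : ℂ), ‖w‖ < ρ → ‖h (y + w)‖ ≤ φ y) (l m : ℕ) :
    ∫ y : ℝ, hermiteEval m y • iteratedDeriv l h (y : ℂ) ∂gauss =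
      ∫ y : ℝ, hermiteEval (m + l) y • h (y : ℂ) ∂gauss := by
  induction l generalizing m with
  | zero => simp
  | succ l ih =>
    rw [integral_hermiteEval_smul_deriv m (hasDerivAt_iteratedDeriv hh (hR.trans hRρ) l)
      (memLp_iteratedDeriv hh hR hRρ hφ hb l) (memLp_iteratedDeriv hh hR hRρ hφ hb (l + 1)),
      ih (m + 1)]
    simp only [add_assoc, add_comm 1 l]

/-- Averaging a holomorphic function over circles against a character and a Hermite polynomial
produces a Hermite coefficient of higher order. -/
theorem integral_character_hermiteEval_smul (hh : DifferentiableOn ℂ h (strip₁ ρ)) (hR : 0 < R)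
    (hRρ : R < ρ) (hφ : Integrable (fun y => φ y ^ 2) gauss)
    (hb : ∀ (y : ℝ) (w : ℂ), ‖w‖ < ρ → ‖h (y + w)‖ ≤ φ y) (l m : ℕ) :
    ∫ ω : ℝ × ℝ, (character (-l) ω.2 * (hermiteEval m ω.1 : ℝ)) •
        h (ω.1 + R * character 1 ω.2) ∂(gauss.prod angle) =
      ∫ ω : ℝ × ℝ, ((R ^ l / l.factorial * hermiteEval (m + l) ω.1 : ℝ) : ℂ) • h ω.1
        ∂(gauss.prod angle) := by
  have hcont : Continuous (fun ω : ℝ × ℝ => h (ω.1 + R * character 1 ω.2)) := by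
    refine hh.continuousOn.comp_continuous ?_ fun ω => ofReal_add_mem_strip₁ _ ?_
    · have := continuous_character 1
      fun_prop
    · rw [norm_mul, norm_character, mul_one, Complex.norm_real, Real.norm_of_nonneg hR.le]
      exact hRρ
  have hφ2 : ∀ y, 0 ≤ φ y := fun y => (norm_nonneg _).trans (hb y 0 (by simpa using hR.trans hRρ))
  have hInt : Integrable (fun ω : ℝ × ℝ => (character (-l) ω.2 * (hermiteEval m ω.1 : ℝ)) •
        h (ω.1 + R * character 1 ω.2)) (gauss.prod angle) := by
    have h1 : Integrable (fun y => hermiteEval m y ^ 2 + φ y ^ 2) gauss :=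
      ((memLp_hermiteEval m 2 (by simp)).integrable_sq).add hφ
    have h2 := h1.comp_fst (ν := angle)
    refine h2.mono' ?_ (ae_of_all _ fun ω => ?_)
    · have c1 := continuous_character (-l)
      have c2 := continuous_hermiteEval m
      exact (((c1.comp continuous_snd).mul (Complex.continuous_ofReal.comp
        (c2.comp continuous_fst))).smul hcont).aestronglyMeasurable
    · rw [norm_smul, norm_mul, norm_character, one_mul, Complex.norm_real, Real.norm_eq_abs]
      have h3 := hb ω.1 (R * character 1 ω.2) (by
        rw [norm_mul, norm_character, mul_one, Complex.norm_real, Real.norm_of_nonneg hR.le]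
        exact hRρ)
      have h4 : |hermiteEval m ω.1| * ‖h (ω.1 + R * character 1 ω.2)‖ ≤
          |hermiteEval m ω.1| * φ ω.1 := by gcongr
      nlinarith [sq_nonneg (|hermiteEval m ω.1| - φ ω.1), sq_abs (hermiteEval m ω.1),
        hφ2 ω.1, abs_nonneg (hermiteEval m ω.1)]
  rw [integral_prod _ hInt]
  have hinner : ∀ y : ℝ, ∫ θ, (character (-l) θ * (hermiteEval m y : ℝ)) •
      h (y + R * character 1 θ) ∂angle = (R ^ l / l.factorial : ℝ) •
        (hermiteEval m y • iteratedDeriv l h (y : ℂ)) := by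
    intro y
    simp only [mul_comm (character _ _) ((hermiteEval m y : ℝ) : ℂ), mul_smul]
    rw [integral_smul, integral_character_smul_circle hR (diffContOnCl_ball_of_strip₁ hh hRρ y),
      Complex.coe_smul, Complex.coe_smul, smul_comm]
  simp only [hinner]
  rw [integral_smul, integral_hermiteEval_smul_iteratedDeriv hh hR hRρ hφ hb]
  -- The target integrand is independent of the angle. Keeping the angle in the measure lets
  -- coordinates be converted one at a time on a fixed product space.
  have hr := integral_fun_fst (μ := gauss) (ν := angle)
    (fun y : ℝ => ((R ^ l / l.factorial * hermiteEval (m + l) y : ℝ) : ℂ) • h y)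
  rw [hr]
  simp only [probReal_univ, one_smul, Complex.coe_smul, mul_smul]
  rw [integral_smul]

end Cauchy

/-! ### Bessel's inequality for vector-valued functions -/

/-- Expand the nonnegative integral of ‖∑ ψ_k c_k - G‖². The real part of the cross term and the
squared norm of the projection both integrate to ∑ ‖c_k‖². -/
theorem sum_norm_sq_integral_le {Ω X ι : Type*} [MeasurableSpace Ω] {μ : Measure Ω}
    [NormedAddCommGroup X] [InnerProductSpace ℂ X] [CompleteSpace X] [DecidableEq ι]
    {S : Finset ι} {ψ : ι → Ω → ℂ} {G : Ω → X} (hG : MemLp G 2 μ) (hψ : ∀ k, MemLp (ψ k) 2 μ)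
    (horth : ∀ k l, ∫ ω, (starRingEnd ℂ) (ψ k ω) * ψ l ω ∂μ = if k = l then 1 else 0) :
    ∑ k ∈ S, ‖∫ ω, (starRingEnd ℂ) (ψ k ω) • G ω ∂μ‖ ^ 2 ≤ ∫ ω, ‖G ω‖ ^ 2 ∂μ := by
  set c : ι → X := fun k => ∫ ω, (starRingEnd ℂ) (ψ k ω) • G ω ∂μ with hc
  have hconj : ∀ k, MemLp (fun ω => (starRingEnd ℂ) (ψ k ω)) 2 μ := fun k =>
    (hψ k).star
  have hWk : ∀ k, MemLp (fun ω => ψ k ω • c k) 2 μ := fun k => by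
    have := (hψ k).continuousLinearMap_comp ((ContinuousLinearMap.id ℂ ℂ).smulRight (c k))
    simpa using! this
  have hW : MemLp (fun ω => ∑ k ∈ S, ψ k ω • c k) 2 μ := memLp_finsetSum _ fun k _ => hWk k
  have hψG : ∀ k, Integrable (fun ω => (starRingEnd ℂ) (ψ k ω) • G ω) μ := fun k =>
    memLp_one_iff_integrable.1 (MemLp.smul (p := 2) (q := 2) hG (hconj k))
  have hψψ : ∀ k l, Integrable (fun ω => (starRingEnd ℂ) (ψ k ω) * ψ l ω) μ := fun k l =>
    MemLp.integrable_mul (p := 2) (q := 2) (hconj k) (hψ l)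
  have e1 : ∀ ω, inner ℂ (∑ k ∈ S, ψ k ω • c k) (G ω) =
      ∑ k ∈ S, inner ℂ (c k) ((starRingEnd ℂ) (ψ k ω) • G ω) := fun ω => by
    rw [sum_inner]
    exact Finset.sum_congr rfl fun k _ => by rw [inner_smul_left, inner_smul_right]
  have e2 : ∀ ω, inner ℂ (∑ k ∈ S, ψ k ω • c k) (∑ k ∈ S, ψ k ω • c k) =
      ∑ k ∈ S, ∑ l ∈ S, ((starRingEnd ℂ) (ψ k ω) * ψ l ω) * inner ℂ (c k) (c l) := fun ω => by
    rw [sum_inner]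
    refine Finset.sum_congr rfl fun k _ => ?_
    rw [inner_sum]
    refine Finset.sum_congr rfl fun l _ => ?_
    rw [inner_smul_left, inner_smul_right]
    ring
  have i1 : ∫ ω, inner ℂ (∑ k ∈ S, ψ k ω • c k) (G ω) ∂μ = ((∑ k ∈ S, ‖c k‖ ^ 2 : ℝ) : ℂ) := by
    simp only [e1]
    rw [integral_finsetSum _ fun k _ => (hψG k).const_inner _]
    push_cast
    refine Finset.sum_congr rfl fun k _ => ?_
    rw [integral_inner (hψG k)]
    exact inner_self_eq_norm_sq_to_K (c k)
  have i2 : ∫ ω, inner ℂ (∑ k ∈ S, ψ k ω • c k) (∑ k ∈ S, ψ k ω • c k) ∂μ =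
      ((∑ k ∈ S, ‖c k‖ ^ 2 : ℝ) : ℂ) := by
    simp only [e2]
    rw [integral_finsetSum _ fun k _ => integrable_finsetSum _ fun l _ => (hψψ k l).mul_const _]
    push_cast
    refine Finset.sum_congr rfl fun k hk => ?_
    rw [integral_finsetSum _ fun l _ => (hψψ k l).mul_const _]
    simp only [integral_mul_const, horth, ite_mul, one_mul, zero_mul, Finset.sum_ite_eq, if_pos hk]
    exact inner_self_eq_norm_sq_to_K (c k)
  have hI1 : Integrable (fun ω => inner ℂ (∑ k ∈ S, ψ k ω • c k) (G ω)) μ := by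
    simp only [e1]
    exact integrable_finsetSum _ fun k _ => (hψG k).const_inner _
  have hI2 : Integrable (fun ω => ‖∑ k ∈ S, ψ k ω • c k‖ ^ 2) μ := hW.integrable_norm_pow (by simp)
  have hI3 : Integrable (fun ω => ‖G ω‖ ^ 2) μ := hG.integrable_norm_pow (by simp)
  have j2 : ∫ ω, ‖∑ k ∈ S, ψ k ω • c k‖ ^ 2 ∂μ = ∑ k ∈ S, ‖c k‖ ^ 2 := by
    have : ∀ ω, inner ℂ (∑ k ∈ S, ψ k ω • c k) (∑ k ∈ S, ψ k ω • c k) =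
        ((‖∑ k ∈ S, ψ k ω • c k‖ ^ 2 : ℝ) : ℂ) := fun ω => by
      rw [inner_self_eq_norm_sq_to_K]; push_cast; rfl
    simp only [this] at i2
    rw [integral_complex_ofReal] at i2
    exact_mod_cast i2
  have j1 : ∫ ω, (inner ℂ (∑ k ∈ S, ψ k ω • c k) (G ω)).re ∂μ = ∑ k ∈ S, ‖c k‖ ^ 2 := by
    have := integral_re hI1
    rw [i1] at this
    exact this.trans (Complex.ofReal_re _)
  have hnn : 0 ≤ ∫ ω, (‖∑ k ∈ S, ψ k ω • c k‖ ^ 2 -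
      2 * (inner ℂ (∑ k ∈ S, ψ k ω • c k) (G ω)).re + ‖G ω‖ ^ 2) ∂μ := by
    refine integral_nonneg fun ω => ?_
    have := norm_sub_sq (𝕜 := ℂ) (∑ k ∈ S, ψ k ω • c k) (G ω)
    simp only [RCLike.re_to_complex] at this
    simp only [Pi.zero_apply]
    rw [← this]
    positivity
  have hI4 : Integrable (fun ω => (inner ℂ (∑ k ∈ S, ψ k ω • c k) (G ω)).re) μ := hI1.re
  have hI5 : Integrable (fun ω => ‖∑ k ∈ S, ψ k ω • c k‖ ^ 2 -
      2 * (inner ℂ (∑ k ∈ S, ψ k ω • c k) (G ω)).re) μ := hI2.sub (hI4.const_mul 2)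
  rw [integral_add hI5 hI3, integral_sub hI2 (hI4.const_mul 2),
    integral_const_mul, j1, j2] at hnn
  linarith

/-! ### Multivariate Hermite coefficients of holomorphic functions -/

/-- The tensorized Hermite polynomial in `N` variables. -/
def hermiteProd {N : ℕ} (ν : Fin N → ℕ) (y : Fin N → ℝ) : ℝ := ∏ j, hermiteN (ν j) (y j)

/-- The Hermite coefficients of a function of `N` variables. -/
def hermiteCoeff {X : Type*} [NormedAddCommGroup X] [NormedSpace ℝ X] {N : ℕ}
    (f : (Fin N → ℝ) → X) (ν : Fin N → ℕ) : X :=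
  ∫ y, hermiteProd ν y • f y ∂gammaFin N

/-- The law of a Gaussian variable together with an independent uniform angle. -/
abbrev gaussAngle : Measure (ℝ × ℝ) := gauss.prod angle

/-- The product of `gaussAngle` over `N` coordinates. -/
abbrev gaussAnglePi (N : ℕ) : Measure (Fin N → ℝ × ℝ) := Measure.pi fun _ => gaussAngle

section Mixed

variable {N : ℕ} (s : Finset (Fin N)) (R : Fin N → ℝ) (α μ : Fin N → ℕ)

/-- The displacement from the real point, which moves on circles in the coordinates outside `s`. -/
def circleShift (ω : Fin N → ℝ × ℝ) : Fin N → ℂ :=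
  fun j => if j ∈ s then 0 else R j * character 1 (ω j).2

/-- The kernels against which the function is integrated: a character times a Hermite
polynomial outside `s`, and a Hermite polynomial of higher order in `s`. -/
def circleKernel (j : Fin N) (a : ℝ × ℝ) : ℂ :=
  if j ∈ s then ((R j ^ α j / (α j).factorial * hermiteEval (μ j + α j) a.1 : ℝ) : ℂ)
  else character (-(α j)) a.2 * (hermiteEval (μ j) a.1 : ℝ)

theorem continuous_circleKernel (j : Fin N) : Continuous (circleKernel s R α μ j) := by
  unfold circleKernel
  have c1 := continuous_character (-(α j))
  have c2 := continuous_hermiteEval (μ j)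
  have c3 := continuous_hermiteEval (μ j + α j)
  split_ifs <;> fun_prop

theorem integrable_norm_circleKernel_sq (j : Fin N) :
    Integrable (fun a => ‖circleKernel s R α μ j a‖ ^ 2) gaussAngle := by
  unfold circleKernel
  split_ifs
  · have h := (((memLp_hermiteEval (μ j + α j) 2 (by simp)).const_mul
      (R j ^ α j / (α j).factorial)).integrable_norm_pow (by simp)).comp_fst (ν := angle)
    refine h.congr (ae_of_all _ fun a => ?_)
    simp only [Complex.norm_real]
  · have h := ((memLp_hermiteEval (μ j) 2 (by simp)).integrable_norm_pow (by simp)).comp_fst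
      (ν := angle)
    refine h.congr (ae_of_all _ fun a => ?_)
    simp only [norm_mul, norm_character, one_mul, Complex.norm_real]

theorem memLp_prod_circleKernel :
    MemLp (fun ω : Fin N → ℝ × ℝ => ∏ j, circleKernel s R α μ j (ω j)) 2 (gaussAnglePi N) := by
  have hc : Continuous (fun ω : Fin N → ℝ × ℝ => ∏ j, circleKernel s R α μ j (ω j)) :=
    continuous_finsetProd _ fun j _ => (continuous_circleKernel s R α μ j).comp (continuous_apply j)
  rw [memLp_two_iff_integrable_sq_norm hc.aestronglyMeasurable]
  have := Integrable.fintype_prod (μ := fun _ : Fin N => gaussAngle)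
    (f := fun j a => ‖circleKernel s R α μ j a‖ ^ 2) fun j =>
      integrable_norm_circleKernel_sq s R α μ j
  refine this.congr (ae_of_all _ fun ω => ?_)
  simp only [norm_prod, Finset.prod_pow]

end Mixed

theorem measurePreserving_fst_gaussAnglePi (N : ℕ) :
    MeasurePreserving (fun (ω : Fin N → ℝ × ℝ) j => (ω j).1) (gaussAnglePi N) (gammaFin N) :=
  measurePreserving_pi _ _ fun _ => measurePreserving_fst

/-- A holomorphic function on a product of strips with an `L²` bound on polydiscs. -/
structure StripBound {X : Type*} [NormedAddCommGroup X] [InnerProductSpace ℂ X] {N : ℕ}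
    (ρ : Fin N → ℝ) (φ : (Fin N → ℝ) → ℝ) (F : (Fin N → ℂ) → X) : Prop where
  memLp : MemLp φ 2 (gammaFin N)
  diff : DifferentiableOn ℂ F (strip ρ)
  bound : ∀ y : Fin N → ℝ, ∀ z ∈ polydisc ρ, ‖F (fun i => (y i : ℂ) + z i)‖ ≤ φ y

section Strip

variable {X : Type*} [NormedAddCommGroup X] [InnerProductSpace ℂ X] {N : ℕ}
  {ρ R : Fin N → ℝ} {φ : (Fin N → ℝ) → ℝ} {F : (Fin N → ℂ) → X}

theorem circleShift_mem_polydisc (hR : ∀ j, 0 < R j) (hRρ : ∀ j, R j < ρ j) (s : Finset (Fin N))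
    (ω : Fin N → ℝ × ℝ) : circleShift s R ω ∈ polydisc ρ := by
  intro j
  unfold circleShift
  split_ifs
  · simpa using (hR j).trans (hRρ j)
  · rw [norm_mul, norm_character, mul_one, Complex.norm_real, Real.norm_of_nonneg (hR j).le]
    exact hRρ j

theorem add_mem_strip {z : Fin N → ℂ} (hz : z ∈ polydisc ρ) (y : Fin N → ℝ) :
    (fun i => (y i : ℂ) + z i) ∈ strip ρ := by
  intro j
  have := Complex.abs_im_le_norm (z j)
  have h2 := hz j
  simp only [Complex.add_im, Complex.ofReal_im, zero_add]
  linarith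

theorem continuous_comp_circleShift (hF : StripBound ρ φ F) (hR : ∀ j, 0 < R j)
    (hRρ : ∀ j, R j < ρ j) (s : Finset (Fin N)) :
    Continuous (fun ω : Fin N → ℝ × ℝ => F (fun i => ((ω i).1 : ℂ) + circleShift s R ω i)) := by
  refine hF.diff.continuousOn.comp_continuous ?_ fun ω =>
    add_mem_strip (circleShift_mem_polydisc hR hRρ s ω) _
  refine continuous_pi fun j => ?_
  have := continuous_character 1
  unfold circleShift
  split_ifs <;> fun_prop

theorem memLp_comp_circleShift (hF : StripBound ρ φ F) (hR : ∀ j, 0 < R j)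
    (hRρ : ∀ j, R j < ρ j) (s : Finset (Fin N)) :
    MemLp (fun ω : Fin N → ℝ × ℝ => F (fun i => ((ω i).1 : ℂ) + circleShift s R ω i)) 2
      (gaussAnglePi N) := by
  have h := hF.memLp.comp_measurePreserving (measurePreserving_fst_gaussAnglePi N)
  refine h.mono (continuous_comp_circleShift hF hR hRρ s).aestronglyMeasurable
    (ae_of_all _ fun ω => ?_)
  exact (hF.bound _ _ (circleShift_mem_polydisc hR hRρ s ω)).trans (le_abs_self _)

theorem integrable_circleKernel_smul (hF : StripBound ρ φ F) (hR : ∀ j, 0 < R j)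
    (hRρ : ∀ j, R j < ρ j) (s : Finset (Fin N)) (α μ : Fin N → ℕ) :
    Integrable (fun ω : Fin N → ℝ × ℝ => (∏ j, circleKernel s R α μ j (ω j)) •
      F (fun i => ((ω i).1 : ℂ) + circleShift s R ω i)) (gaussAnglePi N) :=
  memLp_one_iff_integrable.1 (MemLp.smul (p := 2) (q := 2)
    (memLp_comp_circleShift hF hR hRρ s) (memLp_prod_circleKernel s R α μ))

end Strip

/-! ### Converting one coordinate from a circle average to a higher Hermite order -/

section Coordinate

theorem measurePreserving_insertNth {E : Type} [MeasurableSpace E] (m : Measure E)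
    [SigmaFinite m] {n : ℕ} (j : Fin (n + 1)) :
    MeasurePreserving (fun q : E × (Fin n → E) => (j.insertNth q.1 q.2 : Fin (n + 1) → E))
      (m.prod (Measure.pi fun _ => m)) (Measure.pi fun _ => m) :=
  (measurePreserving_piFinSuccAbove (fun _ : Fin (n + 1) => m) j).symm

theorem integral_pi_insertNth {E : Type} [MeasurableSpace E] (m : Measure E) [SigmaFinite m]
    {X : Type*} [NormedAddCommGroup X] [NormedSpace ℝ X] {n : ℕ} (j : Fin (n + 1))
    {f : (Fin (n + 1) → E) → X} (hf : Integrable f (Measure.pi fun _ => m)) :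
    ∫ ω, f ω ∂(Measure.pi fun _ => m) =
      ∫ ω' : Fin n → E, ∫ a, f (j.insertNth a ω') ∂m ∂(Measure.pi fun _ => m) := by
  have hmp := measurePreserving_insertNth m j
  have hemb : MeasurableEmbedding
      (fun q : E × (Fin n → E) => (j.insertNth q.1 q.2 : Fin (n + 1) → E)) :=
    (MeasurableEquiv.piFinSuccAbove (fun _ : Fin (n + 1) => E) j).symm.measurableEmbedding
  rw [← hmp.integral_comp hemb, integral_prod_symm]
  exact (hmp.integrable_comp_emb hemb).2 hf

variable {X : Type*} [NormedAddCommGroup X] [InnerProductSpace ℂ X] [CompleteSpace X] {n : ℕ}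
  {ρ R : Fin (n + 1) → ℝ} {φ : (Fin (n + 1) → ℝ) → ℝ} {F : (Fin (n + 1) → ℂ) → X}

/-- Fubini isolates coordinate j. For almost all values of the others, the slice of F is holomorphic
on a strip with a square integrable majorant, and the one-variable identity applies to it. -/
theorem integral_circleKernel_smul_insert (hF : StripBound ρ φ F) (hR : ∀ j, 0 < R j)
    (hRρ : ∀ j, R j < ρ j) (s : Finset (Fin (n + 1))) (α μ : Fin (n + 1) → ℕ) {j : Fin (n + 1)}
    (hj : j ∉ s) :
    ∫ ω, (∏ j, circleKernel s R α μ j (ω j)) •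
      F (fun i => ((ω i).1 : ℂ) + circleShift s R ω i) ∂gaussAnglePi (n + 1) =
    ∫ ω, (∏ i, circleKernel (insert j s) R α μ i (ω i)) •
      F (fun i => ((ω i).1 : ℂ) + circleShift (insert j s) R ω i) ∂gaussAnglePi (n + 1) := by
  rw [integral_pi_insertNth gaussAngle j (integrable_circleKernel_smul hF hR hRρ s α μ),
    integral_pi_insertNth gaussAngle j (integrable_circleKernel_smul hF hR hRρ _ α μ)]
  have hφ2 : Integrable (fun y => φ y ^ 2) (gammaFin (n + 1)) := hF.memLp.integrable_sq
  -- Square integrability of the majorant passes only to almost every slice, so the inner integrals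
  -- are compared almost everywhere.
  have hsl : ∀ᵐ y' ∂gammaFin n, Integrable (fun a => φ (j.insertNth a y') ^ 2) gauss :=
    (((measurePreserving_insertNth gauss j).integrable_comp_emb
      (MeasurableEquiv.piFinSuccAbove (fun _ : Fin (n + 1) => ℝ) j).symm.measurableEmbedding).2
        hφ2).prod_left_ae
  have hsl' := (measurePreserving_fst_gaussAnglePi n).quasiMeasurePreserving.ae hsl
  refine integral_congr_ae ?_
  filter_upwards [hsl'] with b hb
  have hne : ∀ i, j.succAbove i ≠ j := fun i => Fin.succAbove_ne j i
  have hmem : ∀ i, j.succAbove i ∈ insert j s ↔ j.succAbove i ∈ s := fun i => by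
    simp [Finset.mem_insert, hne i]
  set rest : Fin n → ℂ := fun i => ((b i).1 : ℂ) +
    if j.succAbove i ∈ s then 0 else R (j.succAbove i) * character 1 (b i).2 with hrest
  have p1 : ∀ a : ℝ × ℝ, (fun i => (((j.insertNth a b : Fin (n + 1) → ℝ × ℝ) i).1 : ℂ) +
      circleShift s R (j.insertNth a b) i) = j.insertNth (a.1 + R j * character 1 a.2) rest := by
    intro a
    funext i
    refine Fin.succAboveCases j ?_ (fun i => ?_) i
    · simp [circleShift, hj]
    · simp [circleShift, hrest]
  have p2 : ∀ a : ℝ × ℝ, (fun i => (((j.insertNth a b : Fin (n + 1) → ℝ × ℝ) i).1 : ℂ) +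
      circleShift (insert j s) R (j.insertNth a b) i) = j.insertNth (a.1 : ℂ) rest := by
    intro a
    funext i
    refine Fin.succAboveCases j ?_ (fun i => ?_) i
    · simp [circleShift]
    · simp [circleShift, hrest, hne i]
  set κ : ℂ := ∏ i, circleKernel s R α μ (j.succAbove i) (b i) with hκ
  have k1 : ∀ a : ℝ × ℝ, ∏ i, circleKernel s R α μ i ((j.insertNth a b : Fin (n + 1) → ℝ × ℝ) i) =
      κ * (character (-(α j)) a.2 * (hermiteEval (μ j) a.1 : ℝ)) := by
    intro a
    rw [Fin.prod_univ_succAbove _ j]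
    simp only [Fin.insertNth_apply_same, Fin.insertNth_apply_succAbove]
    rw [mul_comm, circleKernel, if_neg hj]
  have k2 : ∀ a : ℝ × ℝ,
      ∏ i, circleKernel (insert j s) R α μ i ((j.insertNth a b : Fin (n + 1) → ℝ × ℝ) i) =
      κ * ((R j ^ α j / (α j).factorial * hermiteEval (μ j + α j) a.1 : ℝ) : ℂ) := by
    intro a
    rw [Fin.prod_univ_succAbove _ j]
    simp only [Fin.insertNth_apply_same, Fin.insertNth_apply_succAbove]
    rw [mul_comm, circleKernel, if_pos (Finset.mem_insert_self _ _), hκ]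
    congr 1
    refine Finset.prod_congr rfl fun i _ => ?_
    simp only [circleKernel, hmem]
  simp only [p1, p2, k1, k2, mul_smul κ]
  rw [integral_smul, integral_smul]
  congr 1
  have hrestmem : ∀ w : ℂ, ‖w‖ < ρ j → (j.insertNth w (fun i =>
      if j.succAbove i ∈ s then 0 else R (j.succAbove i) * character 1 (b i).2) :
        Fin (n + 1) → ℂ) ∈ polydisc ρ := by
    intro w hw i
    refine Fin.succAboveCases j ?_ (fun i => ?_) i
    · simpa using hw
    · simp only [Fin.insertNth_apply_succAbove]
      split_ifs
      · simpa using (hR _).trans (hRρ _)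
      · rw [norm_mul, norm_character, mul_one, Complex.norm_real, Real.norm_of_nonneg (hR _).le]
        exact hRρ _
  -- Separating real base point and displacement shows that the slice is majorized by φ at the real
  -- base point: the displacements of the other coordinates stay inside the polydisc.
  have hsplit : ∀ (y : ℝ) (w : ℂ), (j.insertNth (y + w) rest : Fin (n + 1) → ℂ) = fun i =>
      (((j.insertNth y (fun i => (b i).1) : Fin (n + 1) → ℝ) i : ℝ) : ℂ) +
      (j.insertNth w (fun i =>
      if j.succAbove i ∈ s then 0 else R (j.succAbove i) * character 1 (b i).2) :
        Fin (n + 1) → ℂ) i := by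
    intro y w
    funext i
    refine Fin.succAboveCases j ?_ (fun i => ?_) i
    · simp
    · simp [hrest]
  refine integral_character_hermiteEval_smul (h := fun w => F (j.insertNth w rest)) (ρ := ρ j)
    (φ := fun y => φ (j.insertNth y fun i => (b i).1)) ?_ (hR j) (hRρ j) hb ?_ (α j) (μ j)
  · refine hF.diff.comp (Differentiable.differentiableOn ?_) fun w hw => ?_
    · rw [differentiable_pi]
      intro i
      refine Fin.succAboveCases j ?_ (fun i => ?_) i
      · simp only [Fin.insertNth_apply_same]; fun_prop
      · simp only [Fin.insertNth_apply_succAbove]; fun_prop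
    · intro i
      refine Fin.succAboveCases j ?_ (fun i => ?_) i
      · simpa [strip₁] using hw
      · have := add_mem_strip (hrestmem 0 (by simpa using (hR j).trans (hRρ j)))
          (j.insertNth 0 (fun i => (b i).1))
        rw [← hsplit] at this
        simpa using this (j.succAbove i)
  · intro y w hw
    rw [hsplit]
    exact hF.bound _ _ (hrestmem w hw)

end Coordinate

/-! ### Hermite coefficients as circle averages, and their weighted square sum -/

section Bound

variable {X : Type*} [NormedAddCommGroup X] [InnerProductSpace ℂ X] [CompleteSpace X] {N : ℕ}
  {ρ R : Fin N → ℝ} {φ : (Fin N → ℝ) → ℝ} {F : (Fin N → ℂ) → X}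

theorem integral_circleKernel_smul_eq (hF : StripBound ρ φ F) (hR : ∀ j, 0 < R j)
    (hRρ : ∀ j, R j < ρ j) (s : Finset (Fin N)) (α μ : Fin N → ℕ) :
    ∫ ω, (∏ j, circleKernel ∅ R α μ j (ω j)) •
      F (fun i => ((ω i).1 : ℂ) + circleShift ∅ R ω i) ∂gaussAnglePi N =
    ∫ ω, (∏ i, circleKernel s R α μ i (ω i)) •
      F (fun i => ((ω i).1 : ℂ) + circleShift s R ω i) ∂gaussAnglePi N := by
  induction s using Finset.induction_on with
  | empty => rfl
  | insert j s hj ih =>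
    rw [ih]
    rcases N with _ | n
    · exact j.elim0
    · exact integral_circleKernel_smul_insert hF hR hRρ s α μ hj

/-- Once every coordinate is converted, no displacement remains and the integrand depends on the
Gaussian variables alone. The square roots of factorials come from normalizing the Hermite
polynomials. -/
theorem integral_circleKernel_smul_eq_hermiteCoeff (hF : StripBound ρ φ F) (hR : ∀ j, 0 < R j)
    (hRρ : ∀ j, R j < ρ j) (α μ : Fin N → ℕ) :
    ∫ ω, (∏ j, circleKernel ∅ R α μ j (ω j)) •
      F (fun i => ((ω i).1 : ℂ) + circleShift ∅ R ω i) ∂gaussAnglePi N =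
    (∏ j, (R j ^ α j / (α j).factorial * √((μ j + α j).factorial : ℝ))) •
      hermiteCoeff (fun y => F fun i => (y i : ℂ)) (fun j => μ j + α j) := by
  rw [integral_circleKernel_smul_eq hF hR hRρ Finset.univ]
  have h1 : ∀ ω : Fin N → ℝ × ℝ, (∏ i, circleKernel Finset.univ R α μ i (ω i)) •
      F (fun i => ((ω i).1 : ℂ) + circleShift Finset.univ R ω i) =
      (fun y : Fin N → ℝ => (∏ j, (R j ^ α j / (α j).factorial * √((μ j + α j).factorial : ℝ))) •
        (hermiteProd (fun j => μ j + α j) y • F fun i => (y i : ℂ))) (fun j => (ω j).1) := by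
    intro ω
    have e1 : (fun i => ((ω i).1 : ℂ) + circleShift Finset.univ R ω i) =
      fun i => ((ω i).1 : ℂ) := by funext i; simp [circleShift]
    have e2 : ∏ i, circleKernel Finset.univ R α μ i (ω i) =
        (((∏ j, (R j ^ α j / (α j).factorial * √((μ j + α j).factorial : ℝ))) *
          hermiteProd (fun j => μ j + α j) (fun j => (ω j).1) : ℝ) : ℂ) := by
      rw [hermiteProd, ← Finset.prod_mul_distrib, Complex.ofReal_prod]
      refine Finset.prod_congr rfl fun j _ => ?_
      rw [circleKernel, if_pos (Finset.mem_univ _), hermiteN]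
      congr 1
      have : √((μ j + α j).factorial : ℝ) ≠ 0 := by positivity
      field_simp
    rw [e1, e2, Complex.coe_smul, mul_smul]
  simp only [h1]
  have hcont : Continuous (fun y : Fin N → ℝ => F fun i => (y i : ℂ)) := by
    refine hF.diff.continuousOn.comp_continuous (by fun_prop) fun y => ?_
    have h0 : (0 : Fin N → ℂ) ∈ polydisc ρ := fun j => by simpa using (hR j).trans (hRρ j)
    simpa using add_mem_strip h0 y
  have hcont2 : Continuous (hermiteProd (fun j => μ j + α j)) :=
    continuous_finsetProd _ fun j _ => (continuous_hermiteN _).comp (continuous_apply j)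
  have hmp := measurePreserving_fst_gaussAnglePi N
  have hmap := integral_map (μ := gaussAnglePi N) (φ := fun (ω : Fin N → ℝ × ℝ) j => (ω j).1)
    (f := fun y : Fin N → ℝ =>
      (∏ j, (R j ^ α j / (α j).factorial * √((μ j + α j).factorial : ℝ))) •
        (hermiteProd (fun j => μ j + α j) y • F fun i => (y i : ℂ))) hmp.measurable.aemeasurable
    ((hcont2.smul hcont).const_smul _).aestronglyMeasurable
  rw [hmp.map_eq] at hmap
  rw [← hmap, integral_smul]
  rfl

/-- The product of characters and Hermite polynomials. -/
def charHermite (α μ : Fin N → ℕ) (ω : Fin N → ℝ × ℝ) : ℂ :=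
  ∏ j, (character (α j) (ω j).2 * (hermiteN (μ j) (ω j).1 : ℝ))

theorem integral_charHermite (α μ α' μ' : Fin N → ℕ) :
    ∫ ω, (starRingEnd ℂ) (charHermite α μ ω) * charHermite α' μ' ω ∂gaussAnglePi N =
      if α = α' ∧ μ = μ' then 1 else 0 := by
  have h1 : ∀ ω : Fin N → ℝ × ℝ, (starRingEnd ℂ) (charHermite α μ ω) * charHermite α' μ' ω =
      ∏ j, (fun (j : Fin N) (a : ℝ × ℝ) =>
        ((hermiteN (μ j) a.1 * hermiteN (μ' j) a.1 : ℝ) : ℂ) *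
          character (-(α j) + α' j) a.2) j (ω j) := by
    intro ω
    rw [charHermite, charHermite, map_prod, ← Finset.prod_mul_distrib]
    refine Finset.prod_congr rfl fun j _ => ?_
    rw [map_mul, conj_character, Complex.conj_ofReal]
    simp only [← character_mul]
    push_cast
    ring
  simp only [h1]
  rw [integral_fintype_prod_eq_prod (μ := fun _ : Fin N => gaussAngle)
    (f := fun (j : Fin N) (a : ℝ × ℝ) => ((hermiteN (μ j) a.1 * hermiteN (μ' j) a.1 : ℝ) : ℂ) *
          character (-(α j) + α' j) a.2)]
  have h2 : ∀ j, ∫ a : ℝ × ℝ, ((hermiteN (μ j) a.1 * hermiteN (μ' j) a.1 : ℝ) : ℂ) *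
      character (-(α j) + α' j) a.2 ∂gaussAngle = if α j = α' j ∧ μ j = μ' j then 1 else 0 := by
    intro j
    rw [integral_prod_mul (fun y : ℝ => ((hermiteN (μ j) y * hermiteN (μ' j) y : ℝ) : ℂ))
      (fun θ => character (-(α j) + α' j) θ), integral_complex_ofReal, integral_hermiteN_mul,
      integral_character]
    have : (-(α j : ℤ) + α' j = 0) ↔ α j = α' j := by omega
    simp only [this]
    by_cases h3 : α j = α' j <;> by_cases h4 : μ j = μ' j <;> simp [h3, h4]
  simp only [h2]
  split_ifs with h
  · obtain ⟨rfl, rfl⟩ := h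
    simp
  · rw [Finset.prod_eq_zero_iff]
    have h' : ¬ ∀ j, α j = α' j ∧ μ j = μ' j := fun h5 =>
      h ⟨funext fun j => (h5 j).1, funext fun j => (h5 j).2⟩
    push Not at h'
    obtain ⟨j, hj⟩ := h'
    exact ⟨j, Finset.mem_univ _, by rw [if_neg (fun h6 => hj h6.1 h6.2)]⟩

theorem conj_charHermite (α μ : Fin N → ℕ) (ω : Fin N → ℝ × ℝ) :
    (starRingEnd ℂ) (charHermite α μ ω) =
      ((∏ j, (√((μ j).factorial : ℝ))⁻¹ : ℝ) : ℂ) * ∏ j, circleKernel ∅ R α μ j (ω j) := by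
  rw [charHermite, map_prod, Complex.ofReal_prod, ← Finset.prod_mul_distrib]
  refine Finset.prod_congr rfl fun j _ => ?_
  rw [map_mul, conj_character, Complex.conj_ofReal, circleKernel, if_neg (by simp), hermiteN]
  push_cast
  ring

theorem memLp_charHermite (α μ : Fin N → ℕ) : MemLp (charHermite α μ) 2 (gaussAnglePi N) := by
  have h := ((memLp_prod_circleKernel ∅ (fun _ : Fin N => (1 : ℝ)) α μ).const_mul
    ((∏ j, (√((μ j).factorial : ℝ))⁻¹ : ℝ) : ℂ)).star
  refine h.ae_eq (ae_of_all _ fun ω => ?_)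
  have := conj_charHermite (R := fun _ => 1) α μ ω
  simp only [Pi.star_apply]
  rw [← this]
  exact star_star _

/-- The weighted square summability of the Hermite coefficients of a holomorphic function. -/
theorem sum_weight_mul_hermiteCoeff_sq_le (hF : StripBound ρ φ F) (hR : ∀ j, 0 < R j)
    (hRρ : ∀ j, R j < ρ j) (S : Finset (Fin N → ℕ)) (a : (Fin N → ℕ) → Fin N → ℕ)
    (ha : ∀ ν j, a ν j ≤ ν j) :
    ∑ ν ∈ S, (∏ j, ((R j ^ a ν j / (a ν j).factorial) ^ 2 *
      ((ν j).factorial / (ν j - a ν j).factorial))) *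
        ‖hermiteCoeff (fun y => F fun i => (y i : ℂ)) ν‖ ^ 2 ≤ ∫ y, φ y ^ 2 ∂gammaFin N := by
  classical
  have hG := memLp_comp_circleShift hF hR hRρ ∅
  have hB := sum_norm_sq_integral_le (S := S) (G := fun ω : Fin N → ℝ × ℝ =>
    F (fun i => ((ω i).1 : ℂ) + circleShift ∅ R ω i)) (μ := gaussAnglePi N)
    (ψ := fun ν => charHermite (a ν) (fun j => ν j - a ν j)) hG
    -- The pair (a(ν), ν - a(ν)) determines ν as its sum, so the chosen functions are orthonormal
    -- even though the order of differentiation varies with ν.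
    (fun ν => memLp_charHermite _ _) (fun ν ν' => by
      rw [integral_charHermite]
      refine if_congr ⟨fun h => ?_, fun h => by subst h; simp⟩ rfl rfl
      funext j
      have h1 := congrFun h.1 j
      have h2 := congrFun h.2 j
      have h3 := ha ν j
      have h4 := ha ν' j
      omega)
  have hsq : ∫ ω : Fin N → ℝ × ℝ, ‖F (fun i => ((ω i).1 : ℂ) + circleShift ∅ R ω i)‖ ^ 2
      ∂gaussAnglePi N ≤ ∫ y, φ y ^ 2 ∂gammaFin N := by
    have hmp := measurePreserving_fst_gaussAnglePi N
    have hInt : Integrable (fun ω : Fin N → ℝ × ℝ => φ (fun j => (ω j).1) ^ 2) (gaussAnglePi N) :=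
      (hF.memLp.comp_measurePreserving hmp).integrable_sq
    have hmap := integral_map (μ := gaussAnglePi N) (φ := fun (ω : Fin N → ℝ × ℝ) j => (ω j).1)
      (f := fun y : Fin N → ℝ => φ y ^ 2) hmp.measurable.aemeasurable (by
        rw [hmp.map_eq]; exact hF.memLp.integrable_sq.aestronglyMeasurable)
    rw [hmp.map_eq] at hmap
    rw [hmap]
    refine integral_mono (hG.integrable_norm_pow (by simp)) hInt fun ω => ?_
    exact pow_le_pow_left₀ (norm_nonneg _)
      (hF.bound _ _ (circleShift_mem_polydisc hR hRρ ∅ ω)) 2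
  refine le_trans (le_of_eq (Finset.sum_congr rfl fun ν _ => ?_)) (hB.trans hsq)
  simp only [conj_charHermite (R := R), mul_smul]
  rw [integral_smul, integral_circleKernel_smul_eq_hermiteCoeff hF hR hRρ, Complex.coe_smul,
    smul_smul, norm_smul, mul_pow, Real.norm_eq_abs, sq_abs]
  have hν : (fun j => ν j - a ν j + a ν j) = ν := funext fun j => Nat.sub_add_cancel (ha ν j)
  rw [hν]
  congr 1
  rw [← Finset.prod_mul_distrib, ← Finset.prod_pow]
  refine Finset.prod_congr rfl fun j _ => ?_
  rw [Nat.sub_add_cancel (ha ν j), mul_pow, mul_pow, inv_pow, Real.sq_sqrt (by positivity),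
    Real.sq_sqrt (by positivity)]
  ring

end Bound

/-! ### Pointwise convergence of Hermite series -/

/-- Fatou's lemma along a sequence of finite partial sums, followed by the triangle inequality. -/
theorem eLpNorm_le_tsum_of_hasSum {Ω X ι : Type*} [MeasurableSpace Ω] {μ : Measure Ω}
    [NormedAddCommGroup X] [Countable ι] {F : ι → Ω → X} {f : Ω → X}
    (hF : ∀ i, AEStronglyMeasurable (F i) μ) (h : ∀ x, HasSum (fun i => F i x) (f x)) :
    eLpNorm f 2 μ ≤ ∑' i, eLpNorm (F i) 2 μ := by
  classical
  obtain ⟨s, hs⟩ := exists_seq_tendsto (atTop : Filter (Finset ι))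
  have h1 : eLpNorm f 2 μ ≤ liminf (fun n => eLpNorm (∑ i ∈ s n, F i) 2 μ) atTop := by
    refine Lp.eLpNorm_lim_le_liminf_eLpNorm (fun n => ?_) f (ae_of_all _ fun x => ?_)
    · exact Finset.aestronglyMeasurable_sum _ fun i _ => hF i
    · simp only [Finset.sum_apply]
      exact (h x).comp hs
  refine h1.trans (liminf_le_of_le (by isBoundedDefault) fun b hb => ?_)
  obtain ⟨n, hn⟩ := hb.exists
  exact (hn.trans (eLpNorm_sum_le (fun i _ => hF i) (by norm_num))).trans (ENNReal.sum_le_tsum _)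

section Completeness

variable {N : ℕ}

theorem continuous_hermiteProd (ν : Fin N → ℕ) : Continuous (hermiteProd ν) :=
  continuous_finsetProd _ fun j _ => (continuous_hermiteN _).comp (continuous_apply j)

instance : IsProbabilityMeasure (gammaFin N) := by unfold gammaFin; infer_instance

theorem memLp_prod_gammaFin {g : Fin N → ℝ → ℝ} (hc : ∀ j, Continuous (g j))
    (hg : ∀ j, MemLp (g j) 2 gauss) : MemLp (fun y : Fin N → ℝ => ∏ j, g j (y j)) 2 (gammaFin N) := by
  have hcont : Continuous (fun y : Fin N → ℝ => ∏ j, g j (y j)) :=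
    continuous_finsetProd _ fun j _ => (hc j).comp (continuous_apply j)
  rw [memLp_two_iff_integrable_sq hcont.aestronglyMeasurable]
  have := Integrable.fintype_prod (μ := fun _ : Fin N => gauss) (f := fun j a => g j a ^ 2)
    fun j => (hg j).integrable_sq
  refine this.congr (ae_of_all _ fun ω => ?_)
  simp only [Finset.prod_pow]

theorem memLp_hermiteProd (ν : Fin N → ℕ) : MemLp (hermiteProd ν) 2 (gammaFin N) :=
  memLp_prod_gammaFin (fun j => continuous_hermiteN (ν j)) fun j => memLp_hermiteN _ 2 (by simp)

theorem integral_hermiteProd_mul (ν ν' : Fin N → ℕ) :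
    ∫ y, hermiteProd ν y * hermiteProd ν' y ∂gammaFin N = if ν = ν' then 1 else 0 := by
  simp only [hermiteProd, ← Finset.prod_mul_distrib]
  rw [gammaFin, integral_fintype_prod_eq_prod (μ := fun _ : Fin N => gaussianReal 0 1)
    (f := fun (j : Fin N) (a : ℝ) => hermiteN (ν j) a * hermiteN (ν' j) a)]
  simp only [integral_hermiteN_mul]
  split_ifs with h
  · subst h; simp
  · rw [Finset.prod_eq_zero_iff]
    obtain ⟨j, hj⟩ := Function.ne_iff.1 h
    exact ⟨j, Finset.mem_univ _, if_neg hj⟩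

/-- Monomials are linear combinations of Hermite polynomials. -/
theorem exists_pow_eq_sum_hermiteN (k : ℕ) :
    ∃ c : ℕ → ℝ, ∀ x : ℝ, x ^ k = ∑ i ∈ Finset.range (k + 1), c i * hermiteN i x := by
  have hspan : ∀ k : ℕ, (fun x : ℝ => x ^ k) ∈
      Submodule.span ℝ ((fun i => hermiteN i) '' (Finset.range (k + 1) : Set ℕ)) := by
    have hE : ∀ i k : ℕ, i ≤ k → (hermiteEval i : ℝ → ℝ) ∈
        Submodule.span ℝ ((fun i => hermiteN i) '' (Finset.range (k + 1) : Set ℕ)) := by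
      intro i k hik
      have : (hermiteEval i : ℝ → ℝ) = √(i.factorial : ℝ) • hermiteN i := by
        ext x
        have : √(i.factorial : ℝ) ≠ 0 := by positivity
        simp only [Pi.smul_apply, smul_eq_mul, hermiteN]
        field_simp
      rw [this]
      exact Submodule.smul_mem _ _ (Submodule.subset_span ⟨i, by simp; omega, rfl⟩)
    intro k
    induction k with
    | zero =>
      refine Submodule.subset_span ⟨0, by simp, ?_⟩
      ext x; simp
    | succ k ih =>
      have hmul : ∀ g ∈ Submodule.span ℝ ((fun i => hermiteN i) '' (Finset.range (k + 1) : Set ℕ)),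
          (fun x : ℝ => x * g x) ∈
          Submodule.span ℝ ((fun i => hermiteN i) '' (Finset.range (k + 1 + 1) : Set ℕ)) := by
        intro g hg
        induction hg using Submodule.span_induction with
        | mem g hg =>
          obtain ⟨i, hi, rfl⟩ := hg
          have hi' : i ≤ k := by simp at hi; omega
          have e : (fun x : ℝ => x * hermiteN i x) = (√(i.factorial : ℝ))⁻¹ •
              (fun x : ℝ => x * hermiteEval i x) := by
            ext x; simp only [Pi.smul_apply, smul_eq_mul, hermiteN]; ring
          change (fun x : ℝ => x * hermiteN i x) ∈ _
          rw [e]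
          refine Submodule.smul_mem _ _ ?_
          rcases i with _ | i
          · have : (fun x : ℝ => x * hermiteEval 0 x) = hermiteEval 1 := by ext; simp
            rw [this]; exact hE _ _ (by omega)
          · have : (fun x : ℝ => x * hermiteEval (i + 1) x) =
                hermiteEval (i + 2) + ((i : ℝ) + 1) • hermiteEval i := by
              ext x; simp [hermiteEval_add_two]
            rw [this]
            exact Submodule.add_mem _ (hE _ _ (by omega)) (Submodule.smul_mem _ _ (hE _ _ (by omega)))
        | zero =>
          have : (fun x : ℝ => x * (0 : ℝ → ℝ) x) = 0 := by ext; simp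
          rw [this]
          exact Submodule.zero_mem _
        | add f g _ _ hf hg =>
          convert Submodule.add_mem _ hf hg using 1
          ext x; simp [mul_add]
        | smul a g _ hg =>
          convert Submodule.smul_mem _ a hg using 1
          ext x; simp only [Pi.smul_apply, smul_eq_mul]; ring
      convert hmul _ ih using 1
      ext x; ring
  obtain ⟨c, hc⟩ := (Submodule.mem_span_image_finset_iff_exists_fun ℝ).1 (hspan k)
  refine ⟨fun i => if h : i ∈ Finset.range (k + 1) then c ⟨i, h⟩ else 0, fun x => ?_⟩
  have := congrFun hc.symm x
  rw [Finset.sum_apply] at this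
  rw [← Finset.sum_coe_sort]
  refine this.trans (Finset.sum_congr rfl fun i _ => ?_)
  simp

theorem integrable_smul_of_memLp {X : Type*} [NormedAddCommGroup X] [NormedSpace ℝ X]
    {g : (Fin N → ℝ) → ℝ} {d : (Fin N → ℝ) → X}
    (hg : MemLp g 2 (gammaFin N)) (hd : MemLp d 2 (gammaFin N)) :
    Integrable (fun y => g y • d y) (gammaFin N) :=
  memLp_one_iff_integrable.1 (MemLp.smul (𝕜 := ℝ) (p := 2) (q := 2) (r := 1) hd hg)

variable {X : Type*} [NormedAddCommGroup X] [InnerProductSpace ℂ X]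

theorem integral_monomial_smul_eq_zero {d : (Fin N → ℝ) → X} (hd : MemLp d 2 (gammaFin N))
    (h0 : ∀ ν, hermiteCoeff d ν = 0) (k : Fin N → ℕ) :
    ∫ y, (∏ j, y j ^ k j) • d y ∂gammaFin N = 0 := by
  choose c hc using fun j => exists_pow_eq_sum_hermiteN (k j)
  have h1 : ∀ y : Fin N → ℝ, (∏ j, y j ^ k j) • d y =
      ∑ ν ∈ Fintype.piFinset fun j => Finset.range (k j + 1),
        (∏ j, c j (ν j)) • (hermiteProd ν y • d y) := by
    intro y
    have : ∏ j, y j ^ k j = ∏ j, ∑ i ∈ Finset.range (k j + 1), c j i * hermiteN i (y j) :=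
      Finset.prod_congr rfl fun j _ => hc j (y j)
    rw [this, Finset.prod_univ_sum, Finset.sum_smul]
    refine Finset.sum_congr rfl fun ν _ => ?_
    rw [Finset.prod_mul_distrib, mul_smul, hermiteProd]
  simp only [h1]
  have hInt : ∀ ν : Fin N → ℕ, Integrable (fun y => (∏ j, c j (ν j)) • (hermiteProd ν y • d y))
      (gammaFin N) := fun ν => (integrable_smul_of_memLp (memLp_hermiteProd ν) hd).smul _
  rw [integral_finsetSum _ fun ν _ => hInt ν]
  refine Finset.sum_eq_zero fun ν _ => ?_
  rw [integral_smul]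
  have := h0 ν
  rw [hermiteCoeff] at this
  rw [this, smul_zero]

theorem memLp_exp_abs (t : ℝ) : MemLp (fun x => Real.exp |t * x|) 2 gauss := by
  have hc : Continuous (fun x => Real.exp |t * x|) := by fun_prop
  rw [memLp_two_iff_integrable_sq hc.aestronglyMeasurable]
  refine ((integrable_exp_mul_gaussianReal (2 * t)).add
    (integrable_exp_mul_gaussianReal (-(2 * t)))).mono' (hc.pow 2).aestronglyMeasurable
    (ae_of_all _ fun x => ?_)
  rw [Real.norm_eq_abs, abs_of_nonneg (by positivity), ← Real.exp_nat_mul]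
  simp only [Pi.add_apply]
  have e1 := Real.exp_pos (2 * t * x)
  have e2 := Real.exp_pos (-(2 * t) * x)
  rcases abs_cases (t * x) with ⟨h, _⟩ | ⟨h, _⟩ <;> rw [h]
  · have : ((2 : ℕ) : ℝ) * (t * x) = 2 * t * x := by push_cast; ring
    rw [this]; linarith
  · have : ((2 : ℕ) : ℝ) * -(t * x) = -(2 * t) * x := by push_cast; ring
    rw [this]; linarith

/-- Replace each exponential factor by its Taylor polynomials, against which d integrates to zero.
The limit is dominated by ‖d‖ ∏ exp|t_j y_j|, integrable since Gaussian exponentials lie in L². -/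
theorem integral_exp_smul_eq_zero {d : (Fin N → ℝ) → X} (hd : MemLp d 2 (gammaFin N))
    (h0 : ∀ ν, hermiteCoeff d ν = 0) (t : Fin N → ℝ) :
    ∫ y, Complex.exp ((∑ j, t j * y j : ℝ) * Complex.I) • d y ∂gammaFin N = 0 := by
  set E : ℕ → (Fin N → ℝ) → ℂ := fun n y =>
    ∏ j, ∑ k ∈ Finset.range n, (t j * y j * Complex.I) ^ k / (k.factorial : ℂ) with hE
  have hE0 : ∀ n, ∫ y, E n y • d y ∂gammaFin N = 0 := by
    intro n
    have h1 : ∀ y : Fin N → ℝ, E n y • d y =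
        ∑ k ∈ Fintype.piFinset fun _ : Fin N => Finset.range n,
          (∏ j, ((t j * Complex.I) ^ k j / ((k j).factorial : ℂ))) • ((∏ j, y j ^ k j) • d y) := by
      intro y
      rw [hE]
      simp only
      rw [Finset.prod_univ_sum, Finset.sum_smul]
      refine Finset.sum_congr rfl fun k _ => ?_
      rw [← Complex.coe_smul, smul_smul]
      congr 1
      push_cast
      rw [← Finset.prod_mul_distrib]
      refine Finset.prod_congr rfl fun j _ => ?_
      ring
    have hInt : ∀ k : Fin N → ℕ, Integrable (fun y : Fin N → ℝ => (∏ j, y j ^ k j) • d y)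
        (gammaFin N) := by
      intro k
      refine integrable_smul_of_memLp (memLp_prod_gammaFin (g := fun j x => x ^ k j)
        (fun j => continuous_pow _) fun j => ?_) hd
      obtain ⟨c, hc⟩ := exists_pow_eq_sum_hermiteN (k j)
      simp only [hc]
      exact memLp_finsetSum _ fun i _ => (memLp_hermiteN i 2 (by simp)).const_mul _
    simp only [h1]
    have hInt' : ∀ k : Fin N → ℕ, Integrable (fun y : Fin N → ℝ =>
        (∏ j, ((t j * Complex.I) ^ k j / ((k j).factorial : ℂ))) • ((∏ j, y j ^ k j) • d y))
        (gammaFin N) := fun k => (hInt k).smul _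
    rw [integral_finsetSum _ fun k _ => hInt' k]
    refine Finset.sum_eq_zero fun k _ => ?_
    rw [integral_smul, integral_monomial_smul_eq_zero hd h0, smul_zero]
  have hpart : ∀ (n : ℕ) (a : ℝ),
      ‖∑ k ∈ Finset.range n, ((a : ℂ) * Complex.I) ^ k / (k.factorial : ℂ)‖ ≤ Real.exp |a| := by
    intro n a
    refine (norm_sum_le _ _).trans ?_
    refine le_trans (le_of_eq ?_) (Real.sum_le_exp_of_nonneg (abs_nonneg a) n)
    refine Finset.sum_congr rfl fun k _ => ?_
    simp
  have hlim : Tendsto (fun n => ∫ y, E n y • d y ∂gammaFin N) atTop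
      (𝓝 (∫ y, Complex.exp ((∑ j, t j * y j : ℝ) * Complex.I) • d y ∂gammaFin N)) := by
    refine tendsto_integral_of_dominated_convergence
      (fun y => ‖(∏ j, Real.exp |t j * y j|) • d y‖) (fun n => ?_) ?_ (fun n => ae_of_all _ fun y => ?_)
      (ae_of_all _ fun y => ?_)
    · refine AEStronglyMeasurable.smul (Continuous.aestronglyMeasurable ?_) hd.1
      rw [hE]; fun_prop
    · refine (integrable_smul_of_memLp (memLp_prod_gammaFin (g := fun j x => Real.exp |t j * x|)
        (fun j => by fun_prop) fun j => memLp_exp_abs (t j)) hd).norm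
    · rw [norm_smul, norm_smul]
      refine mul_le_mul_of_nonneg_right ?_ (norm_nonneg _)
      rw [hE]
      simp only [norm_prod, Real.norm_eq_abs, Real.abs_exp]
      refine Finset.prod_le_prod (fun j _ => norm_nonneg _) fun j _ => ?_
      have := hpart n (t j * y j)
      push_cast at this
      exact this
    · refine Tendsto.smul_const ?_ _
      have : Complex.exp ((∑ j, t j * y j : ℝ) * Complex.I) =
          ∏ j, Complex.exp (t j * y j * Complex.I) := by
        rw [← Complex.exp_sum]
        push_cast
        rw [Finset.sum_mul]
      rw [this]
      refine tendsto_finsetProd _ fun j _ => ?_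
      have h := (NormedSpace.expSeries_div_hasSum_exp (𝔸 := ℂ) (t j * y j * Complex.I)).tendsto_sum_nat
      rw [← Complex.exp_eq_exp_ℂ] at h
      exact h
  simp only [hE0] at hlim
  exact (tendsto_nhds_unique hlim tendsto_const_nhds)

theorem charFunDual_withDensity_ofReal {h : (Fin N → ℝ) → ℝ} (hc : Continuous h)
    (L : StrongDual ℝ (Fin N → ℝ)) :
    charFunDual ((gammaFin N).withDensity fun y => ENNReal.ofReal (h y)) L =
      ∫ y, ((max (h y) 0 : ℝ) : ℂ) * Complex.exp (L y * Complex.I) ∂gammaFin N := by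
  rw [charFunDual_apply, integral_withDensity_eq_integral_toReal_smul (by fun_prop)
    (ae_of_all _ fun _ => ENNReal.ofReal_lt_top)]
  refine integral_congr_ae (ae_of_all _ fun y => ?_)
  simp only [ENNReal.toReal_ofReal']
  rw [← Complex.coe_smul, smul_eq_mul]

/-- The positive and negative parts of h are densities of finite measures with equal characteristic
functions. So h vanishes almost everywhere, hence everywhere by continuity and full support of the
Gaussian measure. -/
theorem eq_zero_of_integral_exp_eq_zero {h : (Fin N → ℝ) → ℝ} (hc : Continuous h)
    (hi : Integrable h (gammaFin N))
    (h0 : ∀ t : Fin N → ℝ,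
      ∫ y, Complex.exp ((∑ j, t j * y j : ℝ) * Complex.I) * (h y : ℂ) ∂gammaFin N = 0) :
    h = 0 := by
  have : IsFiniteMeasure ((gammaFin N).withDensity fun y => ENNReal.ofReal (h y)) :=
    isFiniteMeasure_withDensity_ofReal hi.2
  have : IsFiniteMeasure ((gammaFin N).withDensity fun y => ENNReal.ofReal (-h y)) :=
    isFiniteMeasure_withDensity_ofReal hi.neg.2
  have hL : ∀ (L : StrongDual ℝ (Fin N → ℝ)) (y : Fin N → ℝ),
      L y = ∑ j, L (Pi.single j 1) * y j := by
    intro L y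
    conv_lhs => rw [pi_eq_sum_univ' y]
    simp [mul_comm]
  have hInt : ∀ (L : StrongDual ℝ (Fin N → ℝ)) (g : (Fin N → ℝ) → ℝ), Integrable g (gammaFin N) →
      Integrable (fun y => (g y : ℂ) * Complex.exp (L y * Complex.I)) (gammaFin N) := by
    intro L g hg
    refine hg.ofReal.mul_bdd (c := 1) (Continuous.aestronglyMeasurable (by fun_prop))
      (ae_of_all _ fun y => ?_)
    rw [Complex.norm_exp_ofReal_mul_I]
  have heq : (gammaFin N).withDensity (fun y => ENNReal.ofReal (h y)) =
      (gammaFin N).withDensity (fun y => ENNReal.ofReal (-h y)) := by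
    refine Measure.ext_of_charFunDual ?_
    ext L
    rw [charFunDual_withDensity_ofReal hc, charFunDual_withDensity_ofReal (h := fun y => -h y) hc.neg, ← sub_eq_zero,
      ← integral_sub (hInt L (fun y => max (h y) 0) hi.pos_part)
        (hInt L (fun y => max (-h y) 0) hi.neg.pos_part),
      ← h0 fun j => L (Pi.single j 1)]
    refine integral_congr_ae (ae_of_all _ fun y => ?_)
    simp only [← hL]
    rw [← sub_mul, mul_comm, ← Complex.ofReal_sub]
    congr 2
    rcases le_total 0 (h y) with hy | hy
    · rw [max_eq_left hy, max_eq_right (by linarith), sub_zero]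
    · rw [max_eq_right hy, max_eq_left (by linarith)]; ring
  have hae := (withDensity_eq_iff (by fun_prop) (by fun_prop) hi.lintegral_lt_top.ne).1 heq
  have hopen : Measure.IsOpenPosMeasure (gaussianReal 0 1) :=
    (gaussianReal_absolutelyContinuous' 0 one_ne_zero).isOpenPosMeasure
  have : Measure.IsOpenPosMeasure (gammaFin N) := by unfold gammaFin; infer_instance
  refine (Continuous.ae_eq_iff_eq (gammaFin N) hc continuous_const).1 ?_
  filter_upwards [hae] with y hy
  rcases lt_trichotomy (h y) 0 with hlt | hy0 | hgt
  · rw [ENNReal.ofReal_of_nonpos hlt.le] at hy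
    have := ENNReal.ofReal_eq_zero.1 hy.symm
    linarith
  · exact hy0
  · rw [ENNReal.ofReal_of_nonpos (by linarith : -h y ≤ 0)] at hy
    have := ENNReal.ofReal_eq_zero.1 hy
    linarith

/-- A continuous square integrable function is determined by its Hermite coefficients. -/
theorem eq_zero_of_hermiteCoeff_eq_zero [CompleteSpace X] {d : (Fin N → ℝ) → X} (hc : Continuous d)
    (hd : MemLp d 2 (gammaFin N)) (h0 : ∀ ν, hermiteCoeff d ν = 0) : d = 0 := by
  funext y₀
  -- Testing against the vector d(y₀) itself reduces to the real scalar case, and the value at y₀ is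
  -- ‖d(y₀)‖².
  set L : X →L[ℝ] ℝ := Complex.reCLM.comp ((innerSL ℂ (d y₀)).restrictScalars ℝ) with hL
  have hd1 : MemLp (fun y => L (d y)) 2 (gammaFin N) := hd.continuousLinearMap_comp L
  have hd2 : MemLp (fun y => ((L (d y) : ℝ) : ℂ)) 2 (gammaFin N) := hd1.ofReal
  have hco : ∀ ν, hermiteCoeff (fun y => ((L (d y) : ℝ) : ℂ)) ν = 0 := by
    intro ν
    have h1 := (Complex.ofRealCLM.comp L).integral_comp_comm
      (integrable_smul_of_memLp (memLp_hermiteProd ν) hd)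
    have h2 := h0 ν
    rw [hermiteCoeff] at h2 ⊢
    rw [h2, map_zero] at h1
    rw [← h1]
    refine integral_congr_ae (ae_of_all _ fun y => ?_)
    simp
  have hz := eq_zero_of_integral_exp_eq_zero (h := fun y => L (d y)) (L.continuous.comp hc)
    (hd1.integrable (by norm_num)) fun t => integral_exp_smul_eq_zero hd2 hco t
  have h3 : L (d y₀) = 0 := congrFun hz y₀
  have h4 : (inner ℂ (d y₀) (d y₀)).re = 0 := h3
  have h5 := inner_self_eq_norm_sq (𝕜 := ℂ) (d y₀)
  rw [RCLike.re_to_complex, h4] at h5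
  exact norm_eq_zero.1 (pow_eq_zero_iff two_ne_zero |>.1 h5.symm)

theorem eLpNorm_hermiteProd_smul (ν : Fin N → ℕ) (x : X) :
    eLpNorm (fun y => hermiteProd ν y • x) 2 (gammaFin N) = ENNReal.ofReal ‖x‖ := by
  have h1 : eLpNorm (hermiteProd ν) 2 (gammaFin N) = 1 := by
    rw [eLpNorm_two_eq (memLp_hermiteProd ν)]
    simp only [sq, integral_hermiteProd_mul]
    simp
  have h2 : eLpNorm (fun y => hermiteProd ν y • x) 2 (gammaFin N) =
      eLpNorm (fun y => ‖x‖ • hermiteProd ν y) 2 (gammaFin N) := by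
    refine eLpNorm_congr_norm_ae (ae_of_all _ fun y => ?_)
    rw [norm_smul, norm_smul, norm_norm, mul_comm]
  rw [h2, show (fun y => ‖x‖ • hermiteProd ν y) = ‖x‖ • hermiteProd ν from rfl,
    eLpNorm_const_smul, h1, mul_one, enorm_norm, ofReal_norm]

theorem abs_hermiteProd_le {m : ℕ} (ν : Fin N → ℕ) {y : Fin N → ℝ} {B : ℝ}
    (hy : ∀ j, y j ^ 2 ≤ 4 * m) (hB : ∀ j, christoffelInv (m + 1) (y j) ≤ B) :
    |hermiteProd ν y| ≤ √B ^ N := by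
  rw [hermiteProd, Finset.abs_prod]
  refine (Finset.prod_le_prod (fun j _ => abs_nonneg _) (g := fun _ => √B) fun j _ => ?_).trans
    (by simp)
  rw [← Real.sqrt_sq_eq_abs]
  exact Real.sqrt_le_sqrt ((hermiteN_sq_le m (ν j) (y j) (hy j)).trans (hB j))

/-- Uniformity in ν comes from `hermiteN_sq_le`: on a bounded set all degrees are controlled by one
fixed continuous function. -/
theorem exists_bound_hermiteProd (m : ℕ) : ∃ B : ℝ, ∀ (ν : Fin N → ℕ) (y : Fin N → ℝ),
    (∀ j, y j ^ 2 ≤ 4 * m) → |hermiteProd ν y| ≤ B := by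
  have hc : Continuous (christoffelInv (m + 1)) :=
    continuous_finsetSum _ fun l _ => (continuous_hermiteN l).pow 2
  obtain ⟨B, hB⟩ := (isCompact_Icc (a := -(2 * √(m : ℝ))) (b := 2 * √(m : ℝ))).exists_bound_of_continuousOn
    hc.continuousOn
  refine ⟨√B ^ N, fun ν y hy => abs_hermiteProd_le ν hy fun j => ?_⟩
  refine (le_abs_self _).trans (hB (y j) ?_)
  rw [Set.mem_Icc, ← abs_le]
  refine abs_le_of_sq_le_sq ?_ (by positivity)
  rw [mul_pow, Real.sq_sqrt (by positivity)]
  linarith [hy j]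

/-- The Hermite series of a continuous function with summable coefficients converges pointwise. -/
theorem hasSum_hermiteProd_smul [CompleteSpace X] {f : (Fin N → ℝ) → X} (hc : Continuous f)
    (hf : MemLp f 2 (gammaFin N)) (hs : Summable fun ν => ‖hermiteCoeff f ν‖) (y : Fin N → ℝ) :
    HasSum (fun ν => hermiteProd ν y • hermiteCoeff f ν) (f y) := by
  have hex : ∀ y : Fin N → ℝ, ∃ m : ℕ, ∀ j, y j ^ 2 < 4 * m := by
    intro y
    obtain ⟨m, hm⟩ := exists_nat_gt (∑ j, y j ^ 2)
    refine ⟨m, fun j => ?_⟩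
    have := Finset.single_le_sum (f := fun j => y j ^ 2) (fun i _ => sq_nonneg _) (Finset.mem_univ j)
    have h2 : (0 : ℝ) ≤ m := by positivity
    linarith
  have hsum : ∀ y : Fin N → ℝ, Summable fun ν => hermiteProd ν y • hermiteCoeff f ν := by
    intro y
    obtain ⟨m, hm⟩ := hex y
    obtain ⟨B, hB⟩ := exists_bound_hermiteProd (N := N) m
    refine Summable.of_norm_bounded (hs.mul_left B) fun ν => ?_
    rw [norm_smul, Real.norm_eq_abs]
    exact mul_le_mul_of_nonneg_right (hB ν y fun j => (hm j).le) (norm_nonneg _)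
  -- The sum g is continuous by locally uniform convergence and lies in L² by summability of the
  -- coefficients. Termwise integration gives it the coefficients of f, so completeness forces f = g
  -- at every point.
  set g : (Fin N → ℝ) → X := fun y => ∑' ν, hermiteProd ν y • hermiteCoeff f ν with hg
  have hgs : ∀ y, HasSum (fun ν => hermiteProd ν y • hermiteCoeff f ν) (g y) := fun y =>
    (hsum y).hasSum
  have hgc : Continuous g := by
    rw [continuous_iff_continuousAt]
    intro y
    obtain ⟨m, hm⟩ := hex y
    obtain ⟨B, hB⟩ := exists_bound_hermiteProd (N := N) m
    have ho : IsOpen {y : Fin N → ℝ | ∀ j, y j ^ 2 < 4 * m} := by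
      rw [Set.ofPred_forall]
      exact isOpen_iInter_of_finite fun j => isOpen_lt (by fun_prop) continuous_const
    refine ContinuousOn.continuousAt (s := {y : Fin N → ℝ | ∀ j, y j ^ 2 < 4 * m}) ?_
      (ho.mem_nhds hm)
    refine continuousOn_tsum (fun ν => ((continuous_hermiteProd ν).smul
      continuous_const).continuousOn) (hs.mul_left B) fun ν y hy => ?_
    rw [norm_smul, Real.norm_eq_abs]
    exact mul_le_mul_of_nonneg_right (hB ν y fun j => (hy j).le) (norm_nonneg _)
  have hgm : MemLp g 2 (gammaFin N) := by
    refine ⟨hgc.aestronglyMeasurable, ?_⟩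
    refine (eLpNorm_le_tsum_of_hasSum (F := fun ν y => hermiteProd ν y • hermiteCoeff f ν)
      (fun ν => ((continuous_hermiteProd ν).smul
      continuous_const).aestronglyMeasurable) hgs).trans_lt ?_
    rw [tsum_congr fun ν => eLpNorm_hermiteProd_smul ν (hermiteCoeff f ν)]
    exact hs.tsum_ofReal_lt_top
  have hgcoeff : ∀ μ, hermiteCoeff g μ = hermiteCoeff f μ := by
    intro μ
    have hInt : ∀ ν, Integrable (fun y => hermiteProd μ y * hermiteProd ν y) (gammaFin N) :=
      fun ν => MemLp.integrable_mul (p := 2) (q := 2) (memLp_hermiteProd μ) (memLp_hermiteProd ν)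
    have hF : ∀ ν, Integrable (fun y => hermiteProd μ y • hermiteProd ν y • hermiteCoeff f ν)
        (gammaFin N) := by
      intro ν
      simp only [smul_smul]
      exact (hInt ν).smul_const _
    have hle : ∀ ν, ∫ y, ‖hermiteProd μ y • hermiteProd ν y • hermiteCoeff f ν‖ ∂gammaFin N ≤
        ‖hermiteCoeff f ν‖ := by
      intro ν
      have h1 : ∀ κ : Fin N → ℕ, Integrable (fun y => hermiteProd κ y ^ 2) (gammaFin N) :=
        fun κ => (memLp_hermiteProd κ).integrable_sq
      have h2 : ∫ y, ((hermiteProd μ y ^ 2 + hermiteProd ν y ^ 2) / 2 * ‖hermiteCoeff f ν‖)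
          ∂gammaFin N = ‖hermiteCoeff f ν‖ := by
        rw [integral_mul_const, integral_div, integral_add (h1 μ) (h1 ν)]
        simp only [sq, integral_hermiteProd_mul]
        norm_num
      rw [← h2]
      refine integral_mono (hF ν).norm ((((h1 μ).add (h1 ν)).div_const 2).mul_const _) fun y => ?_
      simp only [norm_smul, Real.norm_eq_abs, ← mul_assoc]
      refine mul_le_mul_of_nonneg_right ?_ (norm_nonneg _)
      nlinarith [sq_nonneg (|hermiteProd μ y| - |hermiteProd ν y|), sq_abs (hermiteProd μ y),
        sq_abs (hermiteProd ν y)]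
    have h3 := hasSum_integral_of_summable_integral_norm hF
      (Summable.of_nonneg_of_le (fun ν => integral_nonneg fun _ => norm_nonneg _) hle hs)
    have h4 : ∀ ν, ∫ y, hermiteProd μ y • hermiteProd ν y • hermiteCoeff f ν ∂gammaFin N =
        if ν = μ then hermiteCoeff f μ else 0 := by
      intro ν
      simp only [smul_smul]
      rw [integral_smul_const, integral_hermiteProd_mul]
      split_ifs with h5 h6 h6
      · rw [h5, one_smul]
      · exact absurd h5.symm h6
      · exact absurd h6.symm h5
      · rw [zero_smul]
    simp only [h4] at h3
    have h6 := h3.unique (hasSum_ite_eq μ (hermiteCoeff f μ))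
    rw [← h6, hermiteCoeff]
    refine integral_congr_ae (ae_of_all _ fun y => ?_)
    exact ((hgs y).const_smul (hermiteProd μ y)).tsum_eq.symm
  have hz : f - g = 0 := by
    refine eq_zero_of_hermiteCoeff_eq_zero (hc.sub hgc) (hf.sub hgm) fun ν => ?_
    have h1 : hermiteCoeff (f - g) ν = hermiteCoeff f ν - hermiteCoeff g ν := by
      simp only [hermiteCoeff, Pi.sub_apply, smul_sub]
      exact integral_sub (integrable_smul_of_memLp (memLp_hermiteProd ν) hf)
        (integrable_smul_of_memLp (memLp_hermiteProd ν) hgm)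
    rw [h1, hgcoeff, sub_self]
  have : f y = g y := congrFun (sub_eq_zero.1 hz) y
  rw [this]
  exact hgs y

end Completeness

/-! ### Smolyak interpolation of Hermite polynomials -/

/-- Distributivity: choice functions on T correspond to multiindices below μ, since those vanish off
T. -/
theorem sum_Icc_zero_prod (μ : ℕ →₀ ℕ) {T : Finset ℕ} (hT : μ.support ⊆ T) (g : ℕ → ℕ → ℝ) :
    ∑ κ ∈ Finset.Icc 0 μ, ∏ j ∈ T, g j (κ j) =
      ∏ j ∈ T, ∑ k ∈ Finset.range (μ j + 1), g j k := by
  classical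
  rw [Finset.prod_sum]
  have hz : ∀ κ : ℕ →₀ ℕ, κ ≤ μ → ∀ j ∉ T, κ j = 0 := by
    intro κ hκ j hj
    have h1 : μ j = 0 := Finsupp.notMem_support_iff.1 fun h => hj (hT h)
    have h2 := hκ j
    omega
  refine Finset.sum_bij' (fun κ _ j _ => κ j)
    (fun q _ => Finsupp.onFinset T (fun j => if h : j ∈ T then q j h else 0) fun j hj => by
      by_contra h
      simp [h] at hj) ?_ ?_ ?_ ?_ ?_
  · intro κ hκ
    rw [Finset.mem_Icc] at hκ
    simp only [Finset.mem_pi, Finset.mem_range]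
    intro j _
    exact Nat.lt_succ_of_le (hκ.2 j)
  · intro q hq
    simp only [Finset.mem_pi, Finset.mem_range] at hq
    rw [Finset.mem_Icc]
    refine ⟨zero_le, fun j => ?_⟩
    simp only [Finsupp.onFinset_apply]
    split_ifs with h
    · exact Nat.lt_succ_iff.1 (hq j h)
    · exact Nat.zero_le _
  · intro κ hκ
    rw [Finset.mem_Icc] at hκ
    ext j
    simp only [Finsupp.onFinset_apply]
    split_ifs with h
    · rfl
    · exact (hz κ hκ.2 j h).symm
  · intro q hq
    funext j hj
    simp [hj]
  · intro κ _
    exact (Finset.prod_attach T fun j => g j (κ j)).symm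

/-- The tensorized Hermite polynomial on `ℝ^∞`. -/
def hermiteSeq (ν : ℕ →₀ ℕ) (y : ℕ → ℝ) : ℝ := ∏ j ∈ ν.support, hermiteN (ν j) (y j)

theorem hermiteSeq_eq_prod {ν : ℕ →₀ ℕ} {T : Finset ℕ} (hT : ν.support ⊆ T) (y : ℕ → ℝ) :
    hermiteSeq ν y = ∏ j ∈ T, hermiteN (ν j) (y j) := by
  refine Finset.prod_subset hT fun j _ hj => ?_
  rw [Finsupp.notMem_support_iff.1 hj, hermiteN_zero]

@[simp] theorem lagrangeBasis_zero_zero (y : ℝ) : lagrangeBasis 0 0 y = 1 := by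
  simp [lagrangeBasis]

section Smolyak

variable {X : Type*} [NormedAddCommGroup X] [InnerProductSpace ℂ X]

/-- The operator acts factorwise. A common T is needed because a coordinate with μ_j = 0 < ν_j still
contributes the factor I_0 h_{ν_j}, which need not be 1. -/
theorem tensorInterp_hermiteSeq (μ ν : ℕ →₀ ℕ) (x : X) (y : ℕ → ℝ) {T : Finset ℕ}
    (hμ : μ.support ⊆ T) (hν : ν.support ⊆ T) :
    tensorInterp μ (fun y => hermiteSeq ν y • x) y =
      (∏ j ∈ T, interp (μ j) (hermiteN (ν j)) (y j)) • x := by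
  simp only [interp]
  rw [← sum_Icc_zero_prod μ hμ (fun j k => lagrangeBasis (μ j) k (y j) *
    hermiteN (ν j) (gaussHermite (μ j) k)), Finset.sum_smul, tensorInterp]
  refine Finset.sum_congr rfl fun κ hκ => ?_
  rw [Finset.mem_Icc] at hκ
  have h1 : ∏ j ∈ μ.support, lagrangeBasis (μ j) (κ j) (y j) =
      ∏ j ∈ T, lagrangeBasis (μ j) (κ j) (y j) := by
    refine Finset.prod_subset hμ fun j _ hj => ?_
    have h2 : μ j = 0 := Finsupp.notMem_support_iff.1 hj
    have h3 : κ j = 0 := by have := hκ.2 j; omega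
    rw [h2, h3, lagrangeBasis_zero_zero]
  rw [h1, hermiteSeq_eq_prod hν, Complex.coe_smul, smul_smul, Finset.prod_mul_distrib]
  rfl

theorem tensorDiff_hermiteSeq (μ ν : ℕ →₀ ℕ) (x : X) (y : ℕ → ℝ) {T : Finset ℕ}
    (hμ : μ.support ⊆ T) (hν : ν.support ⊆ T) :
    tensorDiff μ (fun y => hermiteSeq ν y • x) y =
      (∏ j ∈ T, interpDiff (μ j) (hermiteN (ν j)) (y j)) • x := by
  classical
  have hsub : ∀ s ∈ μ.support.powerset, ∀ j,
      (μ - ∑ j ∈ s, Finsupp.single j 1 : ℕ →₀ ℕ) j = if j ∈ s then μ j - 1 else μ j := by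
    intro s _ j
    rw [Finsupp.tsub_apply, Finsupp.finsetSum_apply]
    simp only [Finsupp.single_apply, Finset.sum_ite_eq']
    split_ifs <;> simp
  have hsupp : ∀ s ∈ μ.support.powerset,
      (μ - ∑ j ∈ s, Finsupp.single j 1 : ℕ →₀ ℕ).support ⊆ T := by
    intro s hs j hj
    refine hμ (Finsupp.mem_support_iff.2 fun h => ?_)
    rw [Finsupp.mem_support_iff, hsub s hs, h] at hj
    simp at hj
  set A : ℕ → ℝ := fun j => interp (μ j) (hermiteN (ν j)) (y j)
  set B : ℕ → ℝ := fun j => interp (μ j - 1) (hermiteN (ν j)) (y j)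
  have h1 : ∏ j ∈ T, interpDiff (μ j) (hermiteN (ν j)) (y j) =
      (∏ j ∈ T \ μ.support, A j) * ∏ j ∈ μ.support, (A j - B j) := by
    rw [← Finset.prod_sdiff hμ]
    congr 1
    · refine Finset.prod_congr rfl fun j hj => ?_
      have h2 : μ j = 0 := Finsupp.notMem_support_iff.1 (Finset.mem_sdiff.1 hj).2
      simp [interpDiff, h2, A]
    · refine Finset.prod_congr rfl fun j hj => ?_
      have h2 : μ j ≠ 0 := Finsupp.mem_support_iff.1 hj
      simp [interpDiff, h2, A, B]
  rw [h1, Finset.prod_sub, Finset.mul_sum, Finset.sum_smul, tensorDiff]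
  refine Finset.sum_congr rfl fun s hs => ?_
  rw [tensorInterp_hermiteSeq _ ν x y (hsupp s hs) hν]
  have hsT : s ⊆ μ.support := Finset.mem_powerset.1 hs
  have h3 : ∏ j ∈ T, interp ((μ - ∑ j ∈ s, Finsupp.single j 1 : ℕ →₀ ℕ) j) (hermiteN (ν j)) (y j) =
      (∏ j ∈ T \ μ.support, A j) * ((∏ j ∈ μ.support \ s, A j) * ∏ j ∈ s, B j) := by
    rw [← Finset.prod_sdiff hμ, ← Finset.prod_sdiff hsT]
    refine congrArg₂ (· * ·) (Finset.prod_congr rfl fun j hj => ?_)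
      (congrArg₂ (· * ·) (Finset.prod_congr rfl fun j hj => ?_)
        (Finset.prod_congr rfl fun j hj => ?_))
    · rw [hsub s hs, if_neg fun h => (Finset.mem_sdiff.1 hj).2 (hsT h)]
    · rw [hsub s hs, if_neg (Finset.mem_sdiff.1 hj).2]
    · rw [hsub s hs, if_pos hj]
  rw [h3]
  have h4 : ((-1 : ℂ)) ^ s.card = (((-1 : ℝ) ^ s.card : ℝ) : ℂ) := by push_cast; rfl
  rw [h4, Complex.coe_smul, smul_smul]
  congr 1
  ring

theorem tensorDiff_hermiteSeq_of_le {μ ν : ℕ →₀ ℕ} (h : μ ≤ ν) (x : X) (y : ℕ → ℝ) :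
    tensorDiff μ (fun y => hermiteSeq ν y • x) y =
      (∏ j ∈ ν.support, interpDiff (μ j) (hermiteN (ν j)) (y j)) • x :=
  tensorDiff_hermiteSeq μ ν x y (Finsupp.support_mono h) subset_rfl

/-- In a coordinate with μ_j > ν_j both interpolants in the difference reproduce degree ν_j, so that
factor is zero. -/
theorem tensorDiff_hermiteSeq_of_not_le {μ ν : ℕ →₀ ℕ} (h : ¬ μ ≤ ν) (x : X) (y : ℕ → ℝ) :
    tensorDiff μ (fun y => hermiteSeq ν y • x) y = 0 := by
  classical
  rw [tensorDiff_hermiteSeq μ ν x y Finset.subset_union_left Finset.subset_union_right]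
  rw [Finsupp.le_def] at h
  push Not at h
  obtain ⟨j, hj⟩ := h
  rw [Finset.prod_eq_zero (i := j) _ (interpDiff_hermiteN_of_lt hj _), zero_smul]
  exact Finset.mem_union_left _ (Finsupp.mem_support_iff.2 (by omega))

open Classical in
theorem smolyak_hermiteSeq (Λ : Finset (ℕ →₀ ℕ)) (ν : ℕ →₀ ℕ) (x : X) (y : ℕ → ℝ) :
    smolyak Λ (fun y => hermiteSeq ν y • x) y =
      (∑ μ ∈ Λ.filter (· ≤ ν), ∏ j ∈ ν.support, interpDiff (μ j) (hermiteN (ν j)) (y j)) • x := by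
  rw [smolyak, Finset.sum_smul, Finset.sum_filter]
  refine Finset.sum_congr rfl fun μ _ => ?_
  split_ifs with h
  · exact tensorDiff_hermiteSeq_of_le h x y
  · exact tensorDiff_hermiteSeq_of_not_le h x y

/-- The Smolyak operator reproduces the Hermite polynomials with index in `Λ`. -/
theorem smolyak_hermiteSeq_of_mem {Λ : Finset (ℕ →₀ ℕ)} (hΛ : IsLowerSet (Λ : Set (ℕ →₀ ℕ)))
    {ν : ℕ →₀ ℕ} (hν : ν ∈ Λ) (x : X) (y : ℕ → ℝ) :
    smolyak Λ (fun y => hermiteSeq ν y • x) y = hermiteSeq ν y • x := by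
  classical
  rw [smolyak_hermiteSeq]
  -- Downward closedness enters here: the surviving indices fill the whole box below ν, over which
  -- the univariate differences telescope.
  have h1 : Λ.filter (· ≤ ν) = Finset.Icc 0 ν := by
    ext μ
    simp only [Finset.mem_filter, Finset.mem_Icc, zero_le, true_and]
    exact ⟨fun h => h.2, fun h => ⟨hΛ h hν, h⟩⟩
  rw [h1, sum_Icc_zero_prod ν subset_rfl fun j k => interpDiff k (hermiteN (ν j)) (y j)]
  simp only [sum_interpDiff, interp_hermiteN_of_le le_rfl]
  rfl

theorem hasSum_tensorInterp {ι : Type*} {g : ι → (ℕ → ℝ) → X} {f : (ℕ → ℝ) → X}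
    (h : ∀ y, HasSum (fun i => g i y) (f y)) (μ : ℕ →₀ ℕ) (y : ℕ → ℝ) :
    HasSum (fun i => tensorInterp μ (g i) y) (tensorInterp μ f y) := by
  unfold tensorInterp
  exact hasSum_sum fun κ _ => (h _).const_smul _

theorem hasSum_smolyak {ι : Type*} {g : ι → (ℕ → ℝ) → X} {f : (ℕ → ℝ) → X}
    (h : ∀ y, HasSum (fun i => g i y) (f y)) (Λ : Finset (ℕ →₀ ℕ)) (y : ℕ → ℝ) :
    HasSum (fun i => smolyak Λ (g i) y) (smolyak Λ f y) := by
  unfold smolyak tensorDiff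
  exact hasSum_sum fun μ _ => hasSum_sum fun s _ => (hasSum_tensorInterp h _ y).const_smul _

/-- A coordinate outside the supports has order zero, and its single node χ_{0,0} is 0. Only values
at points supported in the first N coordinates are used. -/
theorem smolyak_congr {Λ : Finset (ℕ →₀ ℕ)} {N : ℕ} (hN : ∀ ν ∈ Λ, ν.support ⊆ Finset.range N)
    {f g : (ℕ → ℝ) → X} (hfg : ∀ y : ℕ → ℝ, (∀ j, N ≤ j → y j = 0) → f y = g y) (y : ℕ → ℝ) :
    smolyak Λ f y = smolyak Λ g y := by
  unfold smolyak tensorDiff tensorInterp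
  refine Finset.sum_congr rfl fun ν hν => Finset.sum_congr rfl fun s _ => ?_
  congr 1
  refine Finset.sum_congr rfl fun κ hκ => ?_
  rw [hfg]
  intro j hj
  rw [Finset.mem_Icc] at hκ
  have h1 : ν j = 0 := Finsupp.notMem_support_iff.1 fun h => by
    have := Finset.mem_range.1 (hN ν hν h)
    omega
  have h2 : (ν - ∑ j ∈ s, Finsupp.single j 1 : ℕ →₀ ℕ) j = 0 := by
    rw [Finsupp.tsub_apply, h1, zero_tsub]
  have h3 : κ j = 0 := by have := hκ.2 j; omega
  rw [gridPoint, h2, h3, gaussHermite_zero_zero]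

theorem continuous_smolyak (Λ : Finset (ℕ →₀ ℕ)) (f : (ℕ → ℝ) → X) : Continuous (smolyak Λ f) := by
  unfold smolyak tensorDiff tensorInterp
  refine continuous_finsetSum _ fun ν _ => continuous_finsetSum _ fun s _ =>
    (continuous_finsetSum _ fun κ _ => ?_).const_smul _
  refine (Complex.continuous_ofReal.comp (continuous_finsetProd _ fun j _ =>
    (continuous_lagrangeBasis _ _).comp (continuous_apply j))).smul continuous_const

end Smolyak

/-! ### Norms over the infinite product -/

theorem eLpNorm_prod_gammaInf (s : Finset ℕ) {g : ℕ → ℝ → ℝ} (hg : ∀ j, Continuous (g j)) :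
    eLpNorm (fun y : ℕ → ℝ => ∏ j ∈ s, g j (y j)) 2 gammaInf = ∏ j ∈ s, eLpNorm (g j) 2 gauss := by
  have h2 : ∀ {Ω : Type} [MeasurableSpace Ω] (μ : Measure Ω) (f : Ω → ℝ),
      eLpNorm f 2 μ = (∫⁻ x, ‖f x‖ₑ ^ (2 : ℝ) ∂μ) ^ (1 / (2 : ℝ)) := by
    intro Ω _ μ f
    rw [eLpNorm_eq_lintegral_rpow_enorm_toReal (by simp) (by simp)]
    simp
  rw [h2]
  have h3 : ∀ y : ℕ → ℝ, ‖∏ j ∈ s, g j (y j)‖ₑ ^ (2 : ℝ) =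
      ∏ j ∈ s, ‖g j (y j)‖ₑ ^ (2 : ℝ) := by
    intro y
    rw [ENNReal.prod_rpow_of_nonneg (by norm_num), ← ofReal_norm, norm_prod,
      ENNReal.ofReal_prod_of_nonneg fun j _ => norm_nonneg _]
    simp only [ofReal_norm]
  simp only [h3]
  have hm : ∀ j, Measurable (fun x : ℝ => ‖g j x‖ₑ ^ (2 : ℝ)) := fun j =>
    ((hg j).measurable.enorm).pow_const _
  have hind : iIndepFun (fun (j : ℕ) (y : ℕ → ℝ) => ‖g j (y j)‖ₑ ^ (2 : ℝ)) gammaInf :=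
    iIndepFun_infinitePi (P := fun _ : ℕ => gaussianReal 0 1) hm
  rw [lintegral_prod_eq_prod_lintegral_of_indepFun s _ hind fun j =>
    (hm j).comp (measurable_pi_apply j), ← ENNReal.prod_rpow_of_nonneg (by norm_num)]
  refine Finset.prod_congr rfl fun j _ => ?_
  have hmp : MeasurePreserving (Function.eval j) gammaInf gauss :=
    measurePreserving_eval_infinitePi (fun _ : ℕ => gaussianReal 0 1) j
  rw [h2, ← hmp.lintegral_comp (hm j)]

theorem continuous_hermiteSeq (ν : ℕ →₀ ℕ) : Continuous (hermiteSeq ν) :=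
  continuous_finsetProd _ fun j _ => (continuous_hermiteN _).comp (continuous_apply j)

theorem eLpNorm_hermiteSeq (ν : ℕ →₀ ℕ) : eLpNorm (hermiteSeq ν) 2 gammaInf = 1 := by
  have := eLpNorm_prod_gammaInf ν.support (g := fun j => hermiteN (ν j)) fun j =>
    continuous_hermiteN _
  simp only [eLpNorm_hermiteN, Finset.prod_const_one] at this
  exact this

theorem eLpNorm_fun_smul_const {Ω X : Type*} [MeasurableSpace Ω] (μ : Measure Ω)
    [NormedAddCommGroup X] [NormedSpace ℝ X] (f : Ω → ℝ) (x : X) :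
    eLpNorm (fun y => f y • x) 2 μ = ENNReal.ofReal ‖x‖ * eLpNorm f 2 μ := by
  have h2 : eLpNorm (fun y => f y • x) 2 μ = eLpNorm (‖x‖ • f) 2 μ := by
    refine eLpNorm_congr_norm_ae (ae_of_all _ fun y => ?_)
    rw [Pi.smul_apply, norm_smul, norm_smul, norm_norm, mul_comm]
  rw [h2, eLpNorm_const_smul, enorm_norm, ofReal_norm]

theorem one_le_prod_eight_mul_sq (ν : ℕ →₀ ℕ) : 1 ≤ ∏ j ∈ ν.support, 8 * (ν j : ℝ) ^ 2 := by
  rw [← Finset.prod_const_one (s := ν.support)]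
  refine Finset.prod_le_prod (fun _ _ => zero_le_one) fun j hj => ?_
  have h1 : (1 : ℝ) ≤ ν j := by
    exact_mod_cast Nat.one_le_iff_ne_zero.2 (Finsupp.mem_support_iff.1 hj)
  nlinarith

/-- Stability of Smolyak interpolation on Hermite polynomials. -/
theorem eLpNorm_hermiteSeq_sub_smolyak_le {X : Type*} [NormedAddCommGroup X]
    [InnerProductSpace ℂ X] (Λ : Finset (ℕ →₀ ℕ)) (ν : ℕ →₀ ℕ) (x : X) :
    eLpNorm (fun y => hermiteSeq ν y • x - smolyak Λ (fun y => hermiteSeq ν y • x) y) 2 gammaInf ≤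
      ENNReal.ofReal (‖x‖ * (2 * ∏ j ∈ ν.support, 8 * (ν j : ℝ) ^ 2)) := by
  classical
  have hcI : ∀ μ : ℕ →₀ ℕ, Continuous fun y : ℕ → ℝ =>
      ∏ j ∈ ν.support, interpDiff (μ j) (hermiteN (ν j)) (y j) := fun μ =>
    continuous_finsetProd _ fun j _ => (continuous_interpDiff _ _).comp (continuous_apply j)
  have h1 : (fun y => hermiteSeq ν y • x - smolyak Λ (fun y => hermiteSeq ν y • x) y) =
      fun y => (hermiteSeq ν - ∑ μ ∈ Λ.filter (· ≤ ν), fun y : ℕ → ℝ =>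
        ∏ j ∈ ν.support, interpDiff (μ j) (hermiteN (ν j)) (y j)) y • x := by
    funext y
    rw [smolyak_hermiteSeq, Pi.sub_apply, sub_smul, Finset.sum_apply]
  rw [h1, eLpNorm_fun_smul_const, ENNReal.ofReal_mul (norm_nonneg _)]
  gcongr
  refine (eLpNorm_sub_le (continuous_hermiteSeq ν).aestronglyMeasurable
    (Finset.aestronglyMeasurable_sum _ fun μ _ => (hcI μ).aestronglyMeasurable)
    (by norm_num)).trans ?_
  rw [eLpNorm_hermiteSeq, two_mul, ENNReal.ofReal_add
    (zero_le_one.trans (one_le_prod_eight_mul_sq ν)) (zero_le_one.trans (one_le_prod_eight_mul_sq ν))]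
  refine add_le_add ?_ ?_
  · rw [← ENNReal.ofReal_one]
    exact ENNReal.ofReal_le_ofReal (one_le_prod_eight_mul_sq ν)
  refine (eLpNorm_sum_le (fun μ _ => (hcI μ).aestronglyMeasurable) (by norm_num)).trans ?_
  have h2 : ∀ μ : ℕ →₀ ℕ, eLpNorm (fun y : ℕ → ℝ =>
      ∏ j ∈ ν.support, interpDiff (μ j) (hermiteN (ν j)) (y j)) 2 gammaInf ≤
      ENNReal.ofReal (∏ j ∈ ν.support, 2 * ((μ j : ℝ) + 1)) := by
    intro μ
    rw [eLpNorm_prod_gammaInf ν.support (g := fun j => interpDiff (μ j) (hermiteN (ν j)))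
      fun j => continuous_interpDiff _ _, ENNReal.ofReal_prod_of_nonneg fun j _ => by positivity]
    exact Finset.prod_le_prod' fun j _ => eLpNorm_interpDiff_hermiteN_le _ _
  refine (Finset.sum_le_sum fun μ _ => h2 μ).trans ?_
  rw [← ENNReal.ofReal_sum_of_nonneg fun μ _ => Finset.prod_nonneg fun j _ => by positivity]
  refine ENNReal.ofReal_le_ofReal ?_
  -- Enlarging to the full box makes the bound independent of Λ. It then factorizes into sums
  -- bounded by 2(n+1)² ≤ 8n², valid as n = ν_j ≥ 1 on the support.
  have hsub : Λ.filter (· ≤ ν) ⊆ Finset.Icc 0 ν := by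
    intro μ hμ
    exact Finset.mem_Icc.2 ⟨zero_le, (Finset.mem_filter.1 hμ).2⟩
  refine (Finset.sum_le_sum_of_subset_of_nonneg hsub fun μ _ _ =>
    Finset.prod_nonneg fun j _ => by positivity).trans ?_
  rw [sum_Icc_zero_prod ν subset_rfl fun _ k => 2 * ((k : ℝ) + 1)]
  refine Finset.prod_le_prod (fun j _ => Finset.sum_nonneg fun k _ => by positivity) fun j hj => ?_
  have hν1 : (1 : ℝ) ≤ ν j := by
    exact_mod_cast Nat.one_le_iff_ne_zero.2 (Finsupp.mem_support_iff.1 hj)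
  calc ∑ k ∈ Finset.range (ν j + 1), 2 * ((k : ℝ) + 1)
      ≤ ∑ k ∈ Finset.range (ν j + 1), 2 * ((ν j : ℝ) + 1) := by
        refine Finset.sum_le_sum fun k hk => ?_
        have : (k : ℝ) ≤ ν j := by exact_mod_cast Nat.lt_succ_iff.1 (Finset.mem_range.1 hk)
        linarith
    _ = 2 * ((ν j : ℝ) + 1) ^ 2 := by simp; ring
    _ ≤ 8 * (ν j : ℝ) ^ 2 := by nlinarith

/-! ### Passing between finitely and infinitely many variables -/

/-- A multiindex in `N` variables, extended by zero. -/
def extendIndex {N : ℕ} (ν : Fin N → ℕ) : ℕ →₀ ℕ :=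
  Finsupp.onFinset (Finset.range N) (fun j => if h : j < N then ν ⟨j, h⟩ else 0) fun j hj => by
    by_contra h
    rw [Finset.mem_range] at h
    simp [h] at hj

@[simp] theorem extendIndex_apply {N : ℕ} (ν : Fin N → ℕ) (i : Fin N) :
    extendIndex ν i = ν i := by
  simp [extendIndex]

theorem support_extendIndex_subset {N : ℕ} (ν : Fin N → ℕ) :
    (extendIndex ν).support ⊆ Finset.range N := Finsupp.support_onFinset_subset

theorem extendIndex_injective (N : ℕ) : Function.Injective (extendIndex (N := N)) := by
  intro ν ν' h
  funext i
  rw [← extendIndex_apply ν, h, extendIndex_apply]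

theorem prod_support_extendIndex {N : ℕ} (ν : Fin N → ℕ) (g : ℕ → ℕ → ℝ) (hg : ∀ j, g j 0 = 1) :
    ∏ j ∈ (extendIndex ν).support, g j (extendIndex ν j) = ∏ i : Fin N, g i (ν i) := by
  rw [Finset.prod_subset (support_extendIndex_subset ν) fun j _ hj => by
    rw [Finsupp.notMem_support_iff.1 hj, hg], Finset.prod_range]
  simp

theorem hermiteSeq_extendIndex {N : ℕ} (ν : Fin N → ℕ) (y : ℕ → ℝ) :
    hermiteSeq (extendIndex ν) y = hermiteProd ν (fun i => y i) :=
  prod_support_extendIndex ν (fun j n => hermiteN n (y j)) fun _ => hermiteN_zero _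

/-! ### Sums over multiindices -/

/-- `∏_{j ∈ supp ν} B_j ν_j^s`. -/
def prodWeight (B : ℕ → ℝ) (s : ℝ) (ν : ℕ →₀ ℕ) : ℝ := ∏ j ∈ ν.support, B j * (ν j : ℝ) ^ s

/-- A finite set of multiindices lies in the box below its supremum. The sum over that box
factorizes into terms at most 1 + A_j ∑ c ≤ exp(A_j ∑ c), so partial sums are bounded by the
exponential of a convergent series. -/
theorem summable_prod_support {A c : ℕ → ℝ} (hA : ∀ j, 0 ≤ A j) (hc : ∀ n, 0 ≤ c n)
    (hAs : Summable A) (hcs : Summable c) :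
    Summable fun ν : ℕ →₀ ℕ => ∏ j ∈ ν.support, A j * c (ν j) := by
  classical
  refine summable_of_sum_le (c := Real.exp ((∑' j, A j) * ∑' n, c n))
    (fun ν => Finset.prod_nonneg fun j _ => mul_nonneg (hA j) (hc _)) fun u => ?_
  set μ : ℕ →₀ ℕ := u.sup id with hμ
  set g : ℕ → ℕ → ℝ := fun j k => if k = 0 then 1 else A j * c k with hg
  have hg0 : ∀ j k, 0 ≤ g j k := by
    intro j k
    simp only [hg]
    split_ifs
    · exact zero_le_one
    · exact mul_nonneg (hA j) (hc k)
  have hle : ∀ ν ∈ u, ν ≤ μ := fun ν hν => Finset.le_sup (f := id) hν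
  have h1 : ∀ ν ≤ μ, ∏ j ∈ ν.support, A j * c (ν j) = ∏ j ∈ μ.support, g j (ν j) := by
    intro ν hν
    have h2 : ∏ j ∈ ν.support, A j * c (ν j) = ∏ j ∈ ν.support, g j (ν j) := by
      refine Finset.prod_congr rfl fun j hj => ?_
      simp only [hg]
      rw [if_neg (Finsupp.mem_support_iff.1 hj)]
    rw [h2]
    refine Finset.prod_subset (Finsupp.support_mono hν) fun j _ hj => ?_
    simp only [hg]
    rw [if_pos (Finsupp.notMem_support_iff.1 hj)]
  calc ∑ ν ∈ u, ∏ j ∈ ν.support, A j * c (ν j)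
      = ∑ ν ∈ u, ∏ j ∈ μ.support, g j (ν j) := Finset.sum_congr rfl fun ν hν => h1 ν (hle ν hν)
    _ ≤ ∑ ν ∈ Finset.Icc 0 μ, ∏ j ∈ μ.support, g j (ν j) :=
        Finset.sum_le_sum_of_subset_of_nonneg
          (fun ν hν => Finset.mem_Icc.2 ⟨zero_le, hle ν hν⟩)
          fun ν _ _ => Finset.prod_nonneg fun j _ => hg0 _ _
    _ = ∏ j ∈ μ.support, ∑ k ∈ Finset.range (μ j + 1), g j k := sum_Icc_zero_prod μ subset_rfl g
    _ ≤ ∏ j ∈ μ.support, Real.exp (A j * ∑' n, c n) := by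
        refine Finset.prod_le_prod (fun j _ => Finset.sum_nonneg fun k _ => hg0 j k) fun j _ => ?_
        rw [Finset.sum_range_succ']
        have h3 : ∑ k ∈ Finset.range (μ j), g j (k + 1) ≤ A j * ∑' n, c n := by
          simp only [hg, Nat.add_eq_zero_iff, one_ne_zero, and_false, if_false]
          rw [← Finset.mul_sum]
          refine mul_le_mul_of_nonneg_left ?_ (hA j)
          have h4 := Summable.sum_le_tsum (Finset.range (μ j + 1)) (fun n _ => hc n) hcs
          rw [Finset.sum_range_succ'] at h4
          linarith [hc 0]
        have h5 := Real.add_one_le_exp (A j * ∑' n, c n)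
        have h6 : g j 0 = 1 := by simp [hg]
        linarith
    _ = Real.exp ((∑ j ∈ μ.support, A j) * ∑' n, c n) := by
        rw [← Real.exp_sum, Finset.sum_mul]
    _ ≤ Real.exp ((∑' j, A j) * ∑' n, c n) := by
        refine Real.exp_le_exp.2 (mul_le_mul_of_nonneg_right ?_ (tsum_nonneg hc))
        exact Summable.sum_le_tsum _ (fun j _ => hA j) hAs

section Weight

variable {B : ℕ → ℝ} {s t : ℝ}

theorem one_le_prodWeight (hB : ∀ j, 1 ≤ B j) (hs : 0 < s) (ν : ℕ →₀ ℕ) :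
    1 ≤ prodWeight B s ν := by
  rw [prodWeight, ← Finset.prod_const_one (s := ν.support)]
  refine Finset.prod_le_prod (fun _ _ => zero_le_one) fun j hj => ?_
  have h1 : (1 : ℝ) ≤ ν j := by
    exact_mod_cast Nat.one_le_iff_ne_zero.2 (Finsupp.mem_support_iff.1 hj)
  exact one_le_mul_of_one_le_of_one_le (hB j) (Real.one_le_rpow h1 hs.le)

theorem prodWeight_mono (hB : ∀ j, 1 ≤ B j) (hs : 0 < s) {μ ν : ℕ →₀ ℕ} (h : μ ≤ ν) :
    prodWeight B s μ ≤ prodWeight B s ν := by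
  classical
  have hν1 : ∀ j ∈ ν.support, (1 : ℝ) ≤ ν j := fun j hj => by
    exact_mod_cast Nat.one_le_iff_ne_zero.2 (Finsupp.mem_support_iff.1 hj)
  have hB0 : ∀ j, 0 ≤ B j := fun j => zero_le_one.trans (hB j)
  have hsub := Finsupp.support_mono h
  calc prodWeight B s μ ≤ ∏ j ∈ μ.support, B j * (ν j : ℝ) ^ s := by
        refine Finset.prod_le_prod (fun j _ => mul_nonneg (hB0 j) (by positivity)) fun j _ => ?_
        refine mul_le_mul_of_nonneg_left (Real.rpow_le_rpow (by positivity) ?_ hs.le) (hB0 j)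
        exact_mod_cast h j
    _ ≤ prodWeight B s ν := by
        rw [prodWeight, ← Finset.prod_sdiff hsub]
        refine le_mul_of_one_le_left (Finset.prod_nonneg fun j _ =>
          mul_nonneg (hB0 j) (by positivity)) ?_
        rw [← Finset.prod_const_one (s := ν.support \ μ.support)]
        refine Finset.prod_le_prod (fun _ _ => zero_le_one) fun j hj => ?_
        exact one_le_mul_of_one_le_of_one_le (hB j)
          (Real.one_le_rpow (hν1 j (Finset.mem_sdiff.1 hj).1) hs.le)

theorem isLowerSet_indexSet_prodWeight (hB : ∀ j, 1 ≤ B j) (hs : 0 < s) (ε : ℝ) :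
    IsLowerSet (indexSet (prodWeight B s) ε) := by
  intro ν μ h hν
  have h1 : 0 < prodWeight B s μ := zero_lt_one.trans_le (one_le_prodWeight hB hs μ)
  exact le_trans hν (inv_anti₀ h1 (prodWeight_mono hB hs h))

/-- Take A_j = B_j^{-t} and c_n = D(1+n) n^{-st} in `summable_prod_support`. The factor 1 + n costs
one power, so the condition is st > 2 and not st > 1. -/
theorem summable_prodWeight_rpow (hB : ∀ j, 1 ≤ B j) (hBs : Summable fun j => B j ^ (-t))
    (hst : 2 < s * t) {D : ℝ} (hD : 0 ≤ D) :
    Summable fun ν : ℕ →₀ ℕ => prodWeight B s ν ^ (-t) * ∏ j ∈ ν.support, D * (1 + (ν j : ℝ)) := by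
  have hB0 : ∀ j, 0 ≤ B j := fun j => zero_le_one.trans (hB j)
  have hc : Summable fun n : ℕ => D * (1 + (n : ℝ)) * (n : ℝ) ^ (-(s * t)) := by
    have h1 : Summable fun n : ℕ => (n : ℝ) ^ (1 - s * t) := by
      rw [Real.summable_nat_rpow]; linarith
    refine Summable.of_nonneg_of_le (fun n => by positivity) (fun n => ?_) (h1.mul_left (2 * D))
    rcases Nat.eq_zero_or_pos n with rfl | hn
    · rw [Nat.cast_zero, Real.zero_rpow (by linarith : -(s * t) ≠ 0),
        Real.zero_rpow (by linarith : 1 - s * t ≠ 0)]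
      simp
    · have hn1 : (1 : ℝ) ≤ n := by exact_mod_cast hn
      have h2 : (n : ℝ) ^ (1 - s * t) = n * (n : ℝ) ^ (-(s * t)) := by
        rw [sub_eq_add_neg, Real.rpow_add (by positivity), Real.rpow_one]
      rw [h2]
      have h3 : 0 ≤ D * (n : ℝ) ^ (-(s * t)) := by positivity
      nlinarith
  refine (summable_prod_support (fun j => Real.rpow_nonneg (hB0 j) (-t))
    (fun n => by positivity) hBs hc).congr fun ν => ?_
  rw [prodWeight, ← Real.finsetProd_rpow _ _ fun j _ => mul_nonneg (hB0 j) (by positivity),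
    ← Finset.prod_mul_distrib]
  refine Finset.prod_congr rfl fun j _ => ?_
  rw [Real.mul_rpow (hB0 j) (by positivity), ← Real.rpow_mul (by positivity)]
  ring_nf

theorem rpow_neg_le_of_mem_indexSet (hB : ∀ j, 1 ≤ B j) (hs : 0 < s) (ht : 0 < t) {ε : ℝ}
    (hε : 0 < ε) {ν : ℕ →₀ ℕ} (hν : ν ∈ indexSet (prodWeight B s) ε) :
    ε ^ t ≤ prodWeight B s ν ^ (-t) := by
  have h1 : 0 < prodWeight B s ν := zero_lt_one.trans_le (one_le_prodWeight hB hs ν)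
  rw [Real.rpow_neg h1.le, ← Real.inv_rpow h1.le]
  exact Real.rpow_le_rpow hε.le hν ht.le

theorem finite_indexSet_prodWeight (hB : ∀ j, 1 ≤ B j) (hs : 0 < s) (ht : 0 < t)
    (hBs : Summable fun j => B j ^ (-t)) (hst : 2 < s * t) {ε : ℝ} (hε : 0 < ε) :
    (indexSet (prodWeight B s) ε).Finite := by
  have h1 := summable_prodWeight_rpow hB hBs hst zero_le_one
  have h2 := h1.tendsto_cofinite_zero.eventually (gt_mem_nhds (Real.rpow_pos_of_pos hε t))
  rw [Filter.eventually_cofinite] at h2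
  refine h2.subset fun ν hν => ?_
  simp only [Set.mem_ofPred_eq, not_lt]
  refine (rpow_neg_le_of_mem_indexSet hB hs ht hε hν).trans ?_
  have h3 : 0 < prodWeight B s ν := zero_lt_one.trans_le (one_le_prodWeight hB hs ν)
  refine le_mul_of_one_le_right (Real.rpow_nonneg h3.le _) ?_
  refine (Finset.prod_const_one (s := ν.support)).symm.le.trans
    (Finset.prod_le_prod (fun _ _ => zero_le_one) fun j _ => ?_)
  have : (0 : ℝ) ≤ ν j := by positivity
  linarith

theorem encard_pts_le (Λ : Finset (ℕ →₀ ℕ)) :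
    (pts (Λ : Set (ℕ →₀ ℕ))).encard ≤ (∑ ν ∈ Λ, (Finset.Icc 0 ν).card : ℕ) := by
  classical
  have h1 : pts (Λ : Set (ℕ →₀ ℕ)) ⊆
      (Λ.biUnion fun ν => (Finset.Icc 0 ν).image (gridPoint ν) : Finset (ℕ → ℝ)) := by
    rintro x ⟨ν, hν, μ, hμ, rfl⟩
    rw [Finset.mem_coe, Finset.mem_biUnion]
    exact ⟨ν, hν, Finset.mem_image_of_mem _ (Finset.mem_Icc.2 ⟨zero_le, hμ⟩)⟩
  refine (Set.encard_le_encard h1).trans ?_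
  rw [Set.encard_coe_eq_coe_finsetCard]
  exact_mod_cast Finset.card_biUnion_le.trans (Finset.sum_le_sum fun ν _ => Finset.card_image_le)

/-- An index ν contributes at most ∏(1 + ν_j) points, and ε^t ≤ c_ν^{-t} on the index set, so ε^t
times the count is at most the convergent series. -/
theorem encard_pts_indexSet_le (hB : ∀ j, 1 ≤ B j) (hs : 0 < s) (ht : 0 < t)
    (hBs : Summable fun j => B j ^ (-t)) (hst : 2 < s * t) {ε : ℝ} (hε : 0 < ε) {n : ℕ}
    (hn : ∑' ν : ℕ →₀ ℕ, prodWeight B s ν ^ (-t) * ∏ j ∈ ν.support, 1 * (1 + (ν j : ℝ)) ≤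
      n * ε ^ t) :
    (pts (indexSet (prodWeight B s) ε)).encard ≤ n := by
  set hfin := finite_indexSet_prodWeight hB hs ht hBs hst hε
  have h1 := encard_pts_le hfin.toFinset
  rw [hfin.coe_toFinset] at h1
  refine h1.trans ?_
  have h2 : (∑ ν ∈ hfin.toFinset, (Finset.Icc 0 ν).card : ℕ) ≤ n := by
    have hcard : ∀ ν : ℕ →₀ ℕ, ((Finset.Icc 0 ν).card : ℝ) =
        ∏ j ∈ ν.support, 1 * (1 + (ν j : ℝ)) := by
      intro ν
      have := sum_Icc_zero_prod ν subset_rfl fun _ _ => 1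
      simp only [Finset.prod_const_one, Finset.sum_const, nsmul_eq_mul, mul_one,
        Finset.card_range] at this
      rw [this]
      refine Finset.prod_congr rfl fun j _ => ?_
      push_cast; ring
    have hε' : 0 < ε ^ t := Real.rpow_pos_of_pos hε t
    have h3 : ((∑ ν ∈ hfin.toFinset, (Finset.Icc 0 ν).card : ℕ) : ℝ) * ε ^ t ≤ n * ε ^ t := by
      refine le_trans ?_ hn
      push_cast
      rw [Finset.sum_mul]
      refine le_trans (Finset.sum_le_sum fun ν hν => ?_) (Summable.sum_le_tsum hfin.toFinset
        (fun ν _ => ?_) (summable_prodWeight_rpow hB hBs hst zero_le_one))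
      · rw [hcard, mul_comm]
        refine mul_le_mul_of_nonneg_right (rpow_neg_le_of_mem_indexSet hB hs ht hε
          (hfin.mem_toFinset.1 hν)) ?_
        exact Finset.prod_nonneg fun j _ => by positivity
      · refine mul_nonneg (Real.rpow_nonneg ?_ _) (Finset.prod_nonneg fun j _ => by positivity)
        exact zero_le_one.trans (one_le_prodWeight hB hs ν)
    exact_mod_cast le_of_mul_le_mul_right h3 hε'
  exact_mod_cast h2

end Weight

/-! ### Lower bounds for the weights -/

/-- The order of differentiation used to bound the coefficient of degree `n`. -/
def diffOrder (S n : ℕ) : ℕ := if n < S then min n 1 else S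

theorem diffOrder_le (S n : ℕ) : diffOrder S n ≤ n := by
  unfold diffOrder; split_ifs <;> omega

/-- The univariate weight of the Hermite coefficient of degree `n`. -/
def coeffWeight (S : ℕ) (R : ℝ) (n : ℕ) : ℝ :=
  (R ^ diffOrder S n / (diffOrder S n).factorial) ^ 2 *
    ((n.factorial : ℝ) / (n - diffOrder S n).factorial)

theorem coeffWeight_zero (S : ℕ) (R : ℝ) : coeffWeight S R 0 = 1 := by
  have : diffOrder S 0 = 0 := Nat.le_zero.1 (diffOrder_le S 0)
  simp [coeffWeight, this]

/-- For n < S one differentiation suffices, because n^S ≤ S^S is a constant. For n ≥ S, S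
differentiations give a descending factorial comparable to n^S; of R^{2S} only R² is kept, the rest
being bounded below through R₀. -/
theorem le_coeffWeight {S : ℕ} (hS : 1 ≤ S) {R₀ R : ℝ} (hR₀ : 0 < R₀) (hR₀1 : R₀ ≤ 1)
    (hR : R₀ ≤ R) {n : ℕ} (hn : 1 ≤ n) :
    R₀ ^ (2 * (S - 1)) / ((S.factorial : ℝ) ^ 2 * (S : ℝ) ^ S) * (R ^ 2 * (n : ℝ) ^ S) ≤
      coeffWeight S R n := by
  have hR' : 0 < R := hR₀.trans_le hR
  have hS' : (1 : ℝ) ≤ S := by exact_mod_cast hS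
  have hn' : (1 : ℝ) ≤ n := by exact_mod_cast hn
  have hfac : (1 : ℝ) ≤ S.factorial := by exact_mod_cast S.factorial_pos
  have hRpow : R₀ ^ (2 * (S - 1)) ≤ 1 := pow_le_one₀ hR₀.le hR₀1
  rw [div_mul_eq_mul_div, div_le_iff₀ (by positivity)]
  rcases lt_or_ge n S with h | h
  · have ha : diffOrder S n = 1 := by unfold diffOrder; rw [if_pos h]; omega
    have hw : coeffWeight S R n = R ^ 2 * n := by
      obtain ⟨m, rfl⟩ : ∃ m, n = m + 1 := ⟨n - 1, by omega⟩
      have hf : ((m + 1).factorial : ℝ) = ((m : ℝ) + 1) * m.factorial := by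
        rw [Nat.factorial_succ]; push_cast; ring
      have : (m.factorial : ℝ) ≠ 0 := by positivity
      rw [coeffWeight, ha, hf, Nat.factorial_one, Nat.add_sub_cancel]
      push_cast
      field_simp
    rw [hw]
    have h1 : (n : ℝ) ^ S ≤ (S : ℝ) ^ S := by
      have : (n : ℝ) ≤ S := by exact_mod_cast h.le
      gcongr
    calc R₀ ^ (2 * (S - 1)) * (R ^ 2 * (n : ℝ) ^ S) ≤ 1 * (R ^ 2 * (S : ℝ) ^ S) := by gcongr
      _ = R ^ 2 * 1 * (1 * (S : ℝ) ^ S) := by ring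
      _ ≤ R ^ 2 * n * ((S.factorial : ℝ) ^ 2 * (S : ℝ) ^ S) := by
        gcongr
        exact one_le_pow₀ hfac
  · have ha : diffOrder S n = S := by unfold diffOrder; rw [if_neg (by omega)]
    have hd : (n.factorial : ℝ) / (n - S).factorial = n.descFactorial S := by
      rw [← Nat.factorial_mul_descFactorial h]
      have : ((n - S).factorial : ℝ) ≠ 0 := by positivity
      push_cast
      field_simp
    rw [coeffWeight, ha, hd]
    have h1 : (n : ℝ) ^ S ≤ (n.descFactorial S : ℝ) * (S : ℝ) ^ S := by
      have h2 : ((n + 1 - S : ℕ) : ℝ) ^ S ≤ n.descFactorial S := by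
        exact_mod_cast Nat.pow_sub_le_descFactorial n S
      -- The difference of the two sides is (n - S)(S - 1).
      have h3 : (n : ℝ) ≤ ((n + 1 - S : ℕ) : ℝ) * S := by
        rw [Nat.cast_sub (by omega)]
        push_cast
        have : (S : ℝ) ≤ n := by exact_mod_cast h
        nlinarith
      calc (n : ℝ) ^ S ≤ (((n + 1 - S : ℕ) : ℝ) * S) ^ S := by gcongr
        _ = ((n + 1 - S : ℕ) : ℝ) ^ S * (S : ℝ) ^ S := mul_pow _ _ _
        _ ≤ _ := by gcongr
    have h4 : (R ^ S / (S.factorial : ℝ)) ^ 2 * (n.descFactorial S : ℝ) *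
        ((S.factorial : ℝ) ^ 2 * (S : ℝ) ^ S) =
        R ^ (2 * (S - 1)) * (R ^ 2 * ((n.descFactorial S : ℝ) * (S : ℝ) ^ S)) := by
      obtain ⟨m, rfl⟩ : ∃ m, S = m + 1 := ⟨S - 1, by omega⟩
      simp only [Nat.add_sub_cancel]
      field_simp
      ring
    rw [h4]
    gcongr

/-! ### Error bounds -/

theorem coeffWeight_pos (S : ℕ) {R : ℝ} (hR : 0 < R) (n : ℕ) : 0 < coeffWeight S R n := by
  unfold coeffWeight; positivity

/-- Four powers of ν_j pay for the squared stability constant and the remaining ones for ν_j^s,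
while R_j² pays for B_j. The loss is one constant per active coordinate, not a global one, and is
absorbed by the factor D in the summability lemma. -/
theorem exists_prod_sq_mul_prodWeight_le {B R : ℕ → ℝ} {s κ R₀ : ℝ} (hκ : 0 ≤ κ) (hR₀ : 0 < R₀)
    (hR₀1 : R₀ ≤ 1) (hR : ∀ j, R₀ ≤ R j) (hB0 : ∀ j, 0 ≤ B j) (hB : ∀ j, B j ≤ κ * R j ^ 2)
    {S : ℕ} (hS : s + 4 ≤ S) (hS1 : 1 ≤ S) :
    ∃ D : ℝ, 0 ≤ D ∧ ∀ ν : ℕ →₀ ℕ,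
      (∏ j ∈ ν.support, 8 * (ν j : ℝ) ^ 2) ^ 2 * prodWeight B s ν ≤
        (∏ _j ∈ ν.support, D) * ∏ j ∈ ν.support, coeffWeight S (R j) (ν j) := by
  set κ₀ : ℝ := R₀ ^ (2 * (S - 1)) / ((S.factorial : ℝ) ^ 2 * (S : ℝ) ^ S) with hκ₀
  have hSpos : (0 : ℝ) < S := by exact_mod_cast hS1
  have hκ₀pos : 0 < κ₀ := by rw [hκ₀]; positivity
  refine ⟨64 * κ / κ₀, by positivity, fun ν => ?_⟩
  rw [prodWeight, ← Finset.prod_pow, ← Finset.prod_mul_distrib, ← Finset.prod_mul_distrib]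
  refine Finset.prod_le_prod (fun j _ => ?_) fun j hj => ?_
  · have := hB0 j
    positivity
  have hn : 1 ≤ ν j := Nat.one_le_iff_ne_zero.2 (Finsupp.mem_support_iff.1 hj)
  have hn' : (1 : ℝ) ≤ ν j := by exact_mod_cast hn
  have h1 : (ν j : ℝ) ^ 4 * (ν j : ℝ) ^ s ≤ (ν j : ℝ) ^ S := by
    rw [← Real.rpow_natCast _ S, ← Real.rpow_natCast _ 4, ← Real.rpow_add (by linarith)]
    exact Real.rpow_le_rpow_of_exponent_le hn' (by push_cast; linarith)
  have h2 := le_coeffWeight hS1 hR₀ hR₀1 (hR j) hn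
  rw [← hκ₀] at h2
  calc (8 * (ν j : ℝ) ^ 2) ^ 2 * (B j * (ν j : ℝ) ^ s)
      = 64 * (B j * ((ν j : ℝ) ^ 4 * (ν j : ℝ) ^ s)) := by ring
    _ ≤ 64 * (κ * R j ^ 2 * (ν j : ℝ) ^ S) := by
        gcongr
        exact hB j
    _ = 64 * κ / κ₀ * (κ₀ * (R j ^ 2 * (ν j : ℝ) ^ S)) := by field_simp
    _ ≤ _ := by gcongr

section Finite

variable {X : Type*} [NormedAddCommGroup X] [InnerProductSpace ℂ X]
  {B R : ℕ → ℝ} {s t D : ℝ} {S N : ℕ} {ρ : Fin N → ℝ} {φ : (Fin N → ℝ) → ℝ} {F : (Fin N → ℂ) → X}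

/-- Cauchy-Schwarz with weights w_ν: Bessel controls one factor, the convergent series the other.
The parameter θ serves twice: θ = 1 on all indices gives absolute summability, and θ = ε^{1-t} off Λ
gives the rate. -/
theorem sum_norm_hermiteCoeff_mul_le [CompleteSpace X] (hF : StripBound ρ φ F) (hR : ∀ j, 0 < R j)
    (hRρ : ∀ j : Fin N, R j < ρ j) (hB : ∀ j, 1 ≤ B j) (hs : 0 < s)
    (hBs : Summable fun j => B j ^ (-t)) (hst : 2 < s * t) (hD : 0 ≤ D)
    (hw : ∀ ν : ℕ →₀ ℕ, (∏ j ∈ ν.support, 8 * (ν j : ℝ) ^ 2) ^ 2 * prodWeight B s ν ≤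
        (∏ _j ∈ ν.support, D) * ∏ j ∈ ν.support, coeffWeight S (R j) (ν j))
    {θ : ℝ} (hθ : 0 ≤ θ) (T : Finset (Fin N → ℕ))
    (hT : ∀ ν ∈ T, (prodWeight B s (extendIndex ν))⁻¹ ≤ θ * prodWeight B s (extendIndex ν) ^ (-t)) :
    ∑ ν ∈ T, ‖hermiteCoeff (fun y => F fun i => (y i : ℂ)) ν‖ *
        (2 * ∏ j ∈ (extendIndex ν).support, 8 * (extendIndex ν j : ℝ) ^ 2) ≤
      √(∫ y, φ y ^ 2 ∂gammaFin N) * √(4 * θ *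
        ∑' ν : ℕ →₀ ℕ, prodWeight B s ν ^ (-t) * ∏ j ∈ ν.support, D * (1 + (ν j : ℝ))) := by
  classical
  set w : (Fin N → ℕ) → ℝ := fun ν => ∏ i : Fin N, coeffWeight S (R i) (ν i) with hwdef
  set P : (ℕ →₀ ℕ) → ℝ := fun ν => ∏ j ∈ ν.support, 8 * (ν j : ℝ) ^ 2 with hP
  set G : (ℕ →₀ ℕ) → ℝ := fun ν =>
    prodWeight B s ν ^ (-t) * ∏ j ∈ ν.support, D * (1 + (ν j : ℝ)) with hG
  set f : (Fin N → ℕ) → X := hermiteCoeff (fun y => F fun i => (y i : ℂ)) with hf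
  have hc : ∀ ν, 0 < prodWeight B s ν := fun ν =>
    zero_lt_one.trans_le (one_le_prodWeight hB hs ν)
  have hwpos : ∀ ν, 0 < w ν := fun ν => Finset.prod_pos fun i _ => coeffWeight_pos S (hR i) _
  have hG0 : ∀ ν, 0 ≤ G ν := fun ν =>
    mul_nonneg (Real.rpow_nonneg (hc ν).le _) (Finset.prod_nonneg fun j _ => by positivity)
  have hGs : Summable G := summable_prodWeight_rpow hB hBs hst hD
  have h1 : ∑ ν ∈ T, (√(w ν) * ‖f ν‖) ^ 2 ≤ ∫ y, φ y ^ 2 ∂gammaFin N := by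
    refine le_of_eq_of_le (Finset.sum_congr rfl fun ν _ => ?_)
      (sum_weight_mul_hermiteCoeff_sq_le hF (R := fun j : Fin N => R j) (fun j => hR j) hRρ T
        (fun ν j => diffOrder S (ν j)) fun ν j => diffOrder_le S _)
    rw [mul_pow, Real.sq_sqrt (hwpos ν).le]
    rfl
  have h2 : ∑ ν ∈ T, (2 * P (extendIndex ν) / √(w ν)) ^ 2 ≤ 4 * θ * ∑' ν, G ν := by
    have h3 : ∀ ν ∈ T, (2 * P (extendIndex ν) / √(w ν)) ^ 2 ≤ 4 * θ * G (extendIndex ν) := by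
      intro ν hν
      have h4 := hw (extendIndex ν)
      rw [prod_support_extendIndex ν (fun j n => coeffWeight S (R j) n)
        fun j => coeffWeight_zero S _] at h4
      rw [div_pow, Real.sq_sqrt (hwpos ν).le, div_le_iff₀ (hwpos ν), mul_pow]
      have h5 : ∏ _j ∈ (extendIndex ν).support, D ≤
          ∏ j ∈ (extendIndex ν).support, D * (1 + (extendIndex ν j : ℝ)) := by
        refine Finset.prod_le_prod (fun _ _ => hD) fun j _ => le_mul_of_one_le_right hD ?_
        have : (0 : ℝ) ≤ extendIndex ν j := by positivity
        linarith
      have hD0 : 0 ≤ ∏ _j ∈ (extendIndex ν).support, D := Finset.prod_nonneg fun _ _ => hD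
      have h6 : P (extendIndex ν) ^ 2 ≤
          (∏ _j ∈ (extendIndex ν).support, D) * w ν * (prodWeight B s (extendIndex ν))⁻¹ := by
        rw [← div_eq_mul_inv, le_div_iff₀ (hc _)]
        exact h4
      calc (2 : ℝ) ^ 2 * P (extendIndex ν) ^ 2
          ≤ 2 ^ 2 * ((∏ _j ∈ (extendIndex ν).support, D) * w ν *
              (θ * prodWeight B s (extendIndex ν) ^ (-t))) := by
            refine mul_le_mul_of_nonneg_left (h6.trans ?_) (by norm_num)
            exact mul_le_mul_of_nonneg_left (hT ν hν) (mul_nonneg hD0 (hwpos ν).le)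
        _ = 4 * θ * (prodWeight B s (extendIndex ν) ^ (-t) *
              ∏ _j ∈ (extendIndex ν).support, D) * w ν := by ring
        _ ≤ _ := by
            refine mul_le_mul_of_nonneg_right (mul_le_mul_of_nonneg_left
              (mul_le_mul_of_nonneg_left h5 (Real.rpow_nonneg (hc _).le _)) (by positivity))
              (hwpos ν).le
    refine (Finset.sum_le_sum h3).trans ?_
    rw [← Finset.mul_sum]
    refine mul_le_mul_of_nonneg_left ?_ (by positivity)
    rw [← Finset.sum_image (f := G) (g := extendIndex) fun a _ b _ h => extendIndex_injective N h]
    exact Summable.sum_le_tsum _ (fun ν _ => hG0 ν) hGs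
  calc ∑ ν ∈ T, ‖f ν‖ * (2 * P (extendIndex ν))
      = ∑ ν ∈ T, (√(w ν) * ‖f ν‖) * (2 * P (extendIndex ν) / √(w ν)) := by
        refine Finset.sum_congr rfl fun ν _ => ?_
        have := (Real.sqrt_pos.2 (hwpos ν)).ne'
        field_simp
    _ ≤ √(∑ ν ∈ T, (√(w ν) * ‖f ν‖) ^ 2) * √(∑ ν ∈ T, (2 * P (extendIndex ν) / √(w ν)) ^ 2) :=
        Real.sum_mul_le_sqrt_mul_sqrt _ _ _
    _ ≤ _ := mul_le_mul (Real.sqrt_le_sqrt h1) (Real.sqrt_le_sqrt h2) (Real.sqrt_nonneg _)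
        (Real.sqrt_nonneg _)

theorem StripBound.continuous (hF : StripBound ρ φ F) (hρ : ∀ j, 0 < ρ j) :
    Continuous fun y : Fin N → ℝ => F fun i => (y i : ℂ) := by
  refine hF.diff.continuousOn.comp_continuous (by fun_prop) fun y j => ?_
  simpa using hρ j

theorem StripBound.memLp_real (hF : StripBound ρ φ F) (hρ : ∀ j, 0 < ρ j) :
    MemLp (fun y : Fin N → ℝ => F fun i => (y i : ℂ)) 2 (gammaFin N) := by
  refine hF.memLp.of_le (hF.continuous hρ).aestronglyMeasurable (ae_of_all _ fun y => ?_)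
  have := hF.bound y 0 fun j => by simpa using hρ j
  simp only [Pi.zero_apply, add_zero] at this
  exact this.trans (le_abs_self _)

theorem eLpNorm_liftFin_sub_smolyak_le [CompleteSpace X] (hF : StripBound ρ φ F)
    (hR : ∀ j, 0 < R j)
    (hRρ : ∀ j : Fin N, R j < ρ j) (hB : ∀ j, 1 ≤ B j) (hs : 0 < s) (ht1 : t ≤ 1)
    (hBs : Summable fun j => B j ^ (-t)) (hst : 2 < s * t) (hD : 0 ≤ D)
    (hw : ∀ ν : ℕ →₀ ℕ, (∏ j ∈ ν.support, 8 * (ν j : ℝ) ^ 2) ^ 2 * prodWeight B s ν ≤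
        (∏ _j ∈ ν.support, D) * ∏ j ∈ ν.support, coeffWeight S (R j) (ν j))
    {ε : ℝ} (hε : 0 < ε) {Λ : Finset (ℕ →₀ ℕ)} (hΛ : (Λ : Set _) = indexSet (prodWeight B s) ε) :
    eLpNorm (fun y => liftFin (fun y => F fun i => (y i : ℂ)) y -
        smolyak Λ (liftFin fun y => F fun i => (y i : ℂ)) y) 2 gammaInf ≤
      ENNReal.ofReal (√(∫ y, φ y ^ 2 ∂gammaFin N) * √(4 * ε ^ (1 - t) *
        ∑' ν : ℕ →₀ ℕ, prodWeight B s ν ^ (-t) * ∏ j ∈ ν.support, D * (1 + (ν j : ℝ)))) := by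
  classical
  have hρ : ∀ j, 0 < ρ j := fun j => (hR j).trans (hRρ j)
  set f : (Fin N → ℕ) → X := hermiteCoeff (fun y => F fun i => (y i : ℂ)) with hf
  set P : (ℕ →₀ ℕ) → ℝ := fun ν => ∏ j ∈ ν.support, 8 * (ν j : ℝ) ^ 2 with hP
  have hc1 : ∀ ν, 1 ≤ prodWeight B s ν := one_le_prodWeight hB hs
  have hlow : IsLowerSet (Λ : Set (ℕ →₀ ℕ)) := hΛ ▸ isLowerSet_indexSet_prodWeight hB hs ε
  have hP1 : ∀ ν, 1 ≤ P ν := fun ν => one_le_prod_eight_mul_sq ν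
  have hsum : Summable fun ν => ‖f ν‖ := by
    refine summable_of_sum_le (c := √(∫ y, φ y ^ 2 ∂gammaFin N) * √(4 * 1 *
        ∑' ν : ℕ →₀ ℕ, prodWeight B s ν ^ (-t) * ∏ j ∈ ν.support, D * (1 + (ν j : ℝ))))
      (fun ν => norm_nonneg _) fun T => ?_
    refine le_trans (Finset.sum_le_sum fun ν _ => ?_) (sum_norm_hermiteCoeff_mul_le hF hR hRρ hB hs
      hBs hst hD hw zero_le_one T fun ν _ => ?_)
    · refine le_mul_of_one_le_right (norm_nonneg _) ?_
      have := hP1 (extendIndex ν)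
      simp only [hP] at this
      linarith
    · rw [one_mul, ← Real.rpow_neg_one]
      exact Real.rpow_le_rpow_of_exponent_le (hc1 _) (by linarith)
  have hexp : ∀ y : ℕ → ℝ, HasSum (fun ν : Fin N → ℕ => hermiteSeq (extendIndex ν) y • f ν)
      (liftFin (fun y => F fun i => (y i : ℂ)) y) := by
    intro y
    simp only [hermiteSeq_extendIndex]
    exact hasSum_hermiteProd_smul (hF.continuous hρ) (hF.memLp_real hρ) hsum _
  -- The Smolyak operator uses finitely many point values, so it commutes with the pointwise
  -- convergent Hermite series.
  have hdiff := fun y => (hexp y).sub (hasSum_smolyak hexp Λ y)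
  refine (eLpNorm_le_tsum_of_hasSum (fun ν => ?_) hdiff).trans ?_
  · refine Continuous.aestronglyMeasurable ?_
    exact ((continuous_hermiteSeq _).smul continuous_const).sub (continuous_smolyak _ _)
  set a : (Fin N → ℕ) → ℝ := fun ν =>
    if extendIndex ν ∈ Λ then 0 else ‖f ν‖ * (2 * P (extendIndex ν)) with ha
  have ha0 : ∀ ν, 0 ≤ a ν := by
    intro ν
    simp only [ha]
    have := hP1 (extendIndex ν)
    split_ifs
    · exact le_rfl
    · positivity
  have hafin : ∀ T : Finset (Fin N → ℕ), ∑ ν ∈ T, a ν ≤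
      √(∫ y, φ y ^ 2 ∂gammaFin N) * √(4 * ε ^ (1 - t) *
        ∑' ν : ℕ →₀ ℕ, prodWeight B s ν ^ (-t) * ∏ j ∈ ν.support, D * (1 + (ν j : ℝ))) := by
    intro T
    have h1 : ∑ ν ∈ T, a ν =
        ∑ ν ∈ T with extendIndex ν ∉ Λ, ‖f ν‖ * (2 * P (extendIndex ν)) := by
      rw [Finset.sum_filter]
      refine Finset.sum_congr rfl fun ν _ => ?_
      simp only [ha]
      split_ifs <;> simp_all
    rw [h1]
    refine sum_norm_hermiteCoeff_mul_le hF hR hRρ hB hs hBs hst hD hw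
      (Real.rpow_nonneg hε.le _) _ fun ν hν => ?_
    have h2 : (prodWeight B s (extendIndex ν))⁻¹ < ε := by
      have h3 : extendIndex ν ∉ (Λ : Set (ℕ →₀ ℕ)) := (Finset.mem_filter.1 hν).2
      rw [hΛ] at h3
      exact not_le.1 h3
    have hcp : 0 < prodWeight B s (extendIndex ν) := zero_lt_one.trans_le (hc1 _)
    have hci := inv_pos.2 hcp
    -- Splitting off the power 1 - t, which is nonnegative, trades smallness of c_ν^{-1} for a power
    -- of ε.
    calc (prodWeight B s (extendIndex ν))⁻¹
        = (prodWeight B s (extendIndex ν))⁻¹ ^ (1 - t) * (prodWeight B s (extendIndex ν))⁻¹ ^ t := by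
          rw [← Real.rpow_add hci]; simp
      _ ≤ ε ^ (1 - t) * (prodWeight B s (extendIndex ν))⁻¹ ^ t := by
          refine mul_le_mul_of_nonneg_right (Real.rpow_le_rpow hci.le h2.le (by linarith)) ?_
          exact Real.rpow_nonneg hci.le _
      _ = _ := by rw [Real.inv_rpow hcp.le, Real.rpow_neg hcp.le]
  have hle : ∀ ν, eLpNorm (fun y => hermiteSeq (extendIndex ν) y • f ν -
      smolyak Λ (fun y => hermiteSeq (extendIndex ν) y • f ν) y) 2 gammaInf ≤
      ENNReal.ofReal (a ν) := by
    intro ν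
    by_cases hν : extendIndex ν ∈ Λ
    · have h1 : (fun y => hermiteSeq (extendIndex ν) y • f ν -
          smolyak Λ (fun y => hermiteSeq (extendIndex ν) y • f ν) y) = 0 := by
        funext y
        rw [smolyak_hermiteSeq_of_mem hlow hν]
        simp
      rw [h1, eLpNorm_zero]
      exact zero_le
    · simp only [ha]
      rw [if_neg hν]
      exact eLpNorm_hermiteSeq_sub_smolyak_le Λ _ _
  refine (ENNReal.tsum_le_tsum hle).trans ?_
  rw [← ENNReal.ofReal_tsum_of_nonneg ha0 (summable_of_sum_le ha0 hafin)]
  exact ENNReal.ofReal_le_ofReal (Real.tsum_le_of_sum_le ha0 hafin)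

end Finite

/-! ### Point values -/

section PointEval

variable {X : Type*} [NormedAddCommGroup X] [InnerProductSpace ℂ X]
  {b : ℕ → ℝ} {ξ δ : ℝ} {u : (ℕ → ℝ) → X} {uN : (N : ℕ) → (Fin N → ℝ) → X}

theorem pointEval_eq_liftFin (hu : IsHolomorphicVia b ξ δ u uN) {N : ℕ} (hN : 0 < N)
    {y : ℕ → ℝ} (hy : ∀ j, N ≤ j → y j = 0) : pointEval uN y = liftFin (uN N) y := by
  classical
  have h : ∃ N : ℕ, 0 < N ∧ ∀ j, N ≤ j → y j = 0 := ⟨N, hN, hy⟩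
  unfold pointEval
  rw [dif_pos h]
  generalize hm : Nat.find h = m
  have hspec : 0 < m ∧ ∀ j, m ≤ j → y j = 0 := by
    have := Nat.find_spec h
    rwa [hm] at this
  have hmN : m ≤ N := by
    rw [← hm]
    exact Nat.find_min' h ⟨hN, hy⟩
  rcases hmN.eq_or_lt with rfl | hlt
  · rfl
  · unfold liftFin
    rw [hu.consistent m N hspec.1 hlt]
    congr 1
    funext i
    unfold padZero
    split_ifs with hi
    · rfl
    · exact (hspec.2 i (not_lt.1 hi)).symm

/-- The finitely many grid points have only finitely many nonzero coordinates, so their point values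
are those of u_N for all large N. -/
theorem smolyak_pointEval_eq (hu : IsHolomorphicVia b ξ δ u uN) (Λ : Finset (ℕ →₀ ℕ)) :
    ∀ᶠ N in atTop, smolyak Λ (pointEval uN) = smolyak Λ (liftFin (uN N)) := by
  obtain ⟨M, hM⟩ : ∃ M : ℕ, ∀ ν ∈ Λ, ν.support ⊆ Finset.range M := by
    classical
    obtain ⟨M, hM⟩ := (Λ.biUnion Finsupp.support).exists_nat_subset_range
    exact ⟨M, fun ν hν => (Finset.subset_biUnion_of_mem Finsupp.support hν).trans hM⟩
  filter_upwards [eventually_ge_atTop (M + 1)] with N hN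
  funext y
  refine smolyak_congr (N := N) (fun ν hν => (hM ν hν).trans ?_)
    (fun y hy => pointEval_eq_liftFin hu (by omega) hy) y
  exact Finset.range_subset_range.2 (by omega)

/-- With Λ fixed, the interpolant of u agrees with that of u_N for large N; the triangle inequality
and N → ∞ give the claim because E is independent of N. -/
theorem eLpNorm_sub_smolyak_pointEval_le (hu : IsHolomorphicVia b ξ δ u uN)
    (Λ : Finset (ℕ →₀ ℕ)) (hc : ∀ N, 0 < N → Continuous (uN N)) {E : ℝ≥0∞}
    (hE : ∀ N, 0 < N →
      eLpNorm (fun y => liftFin (uN N) y - smolyak Λ (liftFin (uN N)) y) 2 gammaInf ≤ E) :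
    eLpNorm (fun y => u y - smolyak Λ (pointEval uN) y) 2 gammaInf ≤ E := by
  have h1 : Tendsto (fun N => eLpNorm (fun y => u y - liftFin (uN N) y) 2 gammaInf + E) atTop
      (𝓝 (0 + E)) := hu.tendsto.add_const E
  rw [zero_add] at h1
  refine ge_of_tendsto h1 ?_
  filter_upwards [smolyak_pointEval_eq hu Λ, eventually_gt_atTop 0] with N hN hN0
  rw [hN]
  have hcont : Continuous (liftFin (uN N)) :=
    (hc N hN0).comp (by fun_prop : Continuous fun (y : ℕ → ℝ) (i : Fin N) => y i)
  have h2 : (fun y => u y - smolyak Λ (liftFin (uN N)) y) =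
      (fun y => u y - liftFin (uN N) y) +
        fun y => liftFin (uN N) y - smolyak Λ (liftFin (uN N)) y := by
    funext y; simp
  rw [h2]
  refine (eLpNorm_add_le ?_ ?_ one_le_two).trans ?_
  · exact hu.memLp.aestronglyMeasurable.sub hcont.aestronglyMeasurable
  · exact (hcont.sub (continuous_smolyak _ _)).aestronglyMeasurable
  · gcongr
    exact hE N hN0

end PointEval

/-! ### The weights of the theorem -/

section Radius

variable {b : ℕ → ℝ} {p ξ K : ℝ}

theorem summable_rpow_of_memℓp (hb : ∀ j, 0 < b j) (hp0 : 0 < p)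
    (hbp : Memℓp b (ENNReal.ofReal p)) : Summable fun j => b j ^ p := by
  have h := hbp.summable (by rwa [ENNReal.toReal_ofReal hp0.le])
  rw [ENNReal.toReal_ofReal hp0.le] at h
  refine h.congr fun j => ?_
  rw [Real.norm_of_nonneg (hb j).le]

theorem tsum_rpow_pos (hb : ∀ j, 0 < b j) (hs : Summable fun j => b j ^ p) :
    0 < ∑' j, b j ^ p :=
  hs.tsum_pos (fun j => (Real.rpow_pos_of_pos (hb j) p).le) 0 (Real.rpow_pos_of_pos (hb 0) p)

/-- `b_j^{p-1} ξ / ∑ b_i^p`, the radii of an admissible polydisc. -/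
def radius (b : ℕ → ℝ) (p ξ : ℝ) (j : ℕ) : ℝ := ξ / (∑' i, b i ^ p) * b j ^ (p - 1)

theorem radius_pos (hb : ∀ j, 0 < b j) (hξ : 0 < ξ) (hs : Summable fun j => b j ^ p) (j : ℕ) :
    0 < radius b p ξ j :=
  mul_pos (div_pos hξ (tsum_rpow_pos hb hs)) (Real.rpow_pos_of_pos (hb j) _)

theorem admissible_radius (hb : ∀ j, 0 < b j) (hξ : 0 < ξ) (hs : Summable fun j => b j ^ p)
    (N : ℕ) : Admissible b ξ fun j : Fin N => radius b p ξ j := by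
  refine ⟨fun j => radius_pos hb hξ hs j, ?_⟩
  have hβ := tsum_rpow_pos hb hs
  have h1 : ∀ j, b j * radius b p ξ j = ξ / (∑' i, b i ^ p) * b j ^ p := by
    intro j
    have : b j ^ p = b j * b j ^ (p - 1) := by
      rw [mul_comm, ← Real.rpow_add_one (hb j).ne', sub_add_cancel]
    rw [radius, this]
    ring
  simp only [h1]
  rw [← Finset.mul_sum, div_mul_eq_mul_div, div_le_iff₀ hβ]
  refine mul_le_mul_of_nonneg_left ?_ hξ.le
  rw [← Finset.sum_range fun j => b j ^ p]
  exact hs.sum_le_tsum _ fun j _ => (Real.rpow_pos_of_pos (hb j) p).le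

/-- Each b_j^p is at most the full sum β, so b_j ≤ β^{1/p}, and the power p - 1 ≤ 0 reverses this
into a positive lower bound. -/
theorem exists_le_radius (hb : ∀ j, 0 < b j) (hξ : 0 < ξ) (hp0 : 0 < p) (hp1 : p ≤ 1)
    (hs : Summable fun j => b j ^ p) : ∃ R₀ : ℝ, 0 < R₀ ∧ R₀ ≤ 1 ∧ ∀ j, R₀ ≤ radius b p ξ j / 2 := by
  have hβ := tsum_rpow_pos hb hs
  set β := ∑' j, b j ^ p with hβdef
  have h1 : 0 < ξ / β * β ^ ((p - 1) / p) / 2 :=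
    half_pos (mul_pos (div_pos hξ hβ) (Real.rpow_pos_of_pos hβ _))
  refine ⟨min 1 (ξ / β * β ^ ((p - 1) / p) / 2), lt_min one_pos h1, min_le_left _ _, fun j => ?_⟩
  refine (min_le_right _ _).trans ?_
  have h2 : b j ^ p ≤ β := hs.le_tsum j fun i _ => (Real.rpow_pos_of_pos (hb i) p).le
  have h3 : β ^ ((p - 1) / p) ≤ b j ^ (p - 1) := by
    have h4 : b j ^ (p - 1) = (b j ^ p) ^ ((p - 1) / p) := by
      rw [← Real.rpow_mul (hb j).le, mul_div_cancel₀ _ hp0.ne']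
    rw [h4]
    exact Real.rpow_le_rpow_of_nonpos (Real.rpow_pos_of_pos (hb j) p) h2
      (div_nonpos_of_nonpos_of_nonneg (by linarith) hp0.le)
  have h5 := mul_le_mul_of_nonneg_left h3 (div_pos hξ hβ).le
  rw [radius]
  linarith

/-- Only proportionality to b_j^{p-1} matters below; the constant is never needed explicitly. -/
theorem exists_varrho_eq (hb : ∀ j, 0 < b j) (hξ : 0 < ξ) (hs : Summable fun j => b j ^ p)
    (r : ℕ) : ∃ q : ℝ, 0 < q ∧ ∀ j, varrho b p ξ r j = b j ^ (p - 1) * q := by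
  refine ⟨_, ?_, fun j => rfl⟩
  have h1 : ∑' i, |b i| ^ p = ∑' i, b i ^ p := tsum_congr fun i => by rw [abs_of_pos (hb i)]
  rw [h1]
  have h2 := tsum_rpow_pos hb hs
  have h3 : (0 : ℝ) < r.factorial := by positivity
  positivity

theorem exists_max_varrho_le (hb : ∀ j, 0 < b j) (hξ : 0 < ξ) (hp0 : 0 < p) (hp1 : p ≤ 1)
    (hs : Summable fun j => b j ^ p) (hK : 0 < K) (r : ℕ) :
    ∃ κ : ℝ, 0 ≤ κ ∧
      ∀ j, max 1 (K * varrho b p ξ r j) ^ (2 * 1) ≤ κ * (radius b p ξ j / 2) ^ 2 := by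
  obtain ⟨R₀, hR₀, -, hR⟩ := exists_le_radius hb hξ hp0 hp1 hs
  obtain ⟨q, hq, hqe⟩ := exists_varrho_eq hb hξ hs r
  have hβ := tsum_rpow_pos hb hs
  set A : ℝ := R₀⁻¹ + K * q * 2 * (∑' i, b i ^ p) / ξ with hA
  have hA0 : 0 < K * q * 2 * (∑' i, b i ^ p) / ξ := by positivity
  refine ⟨A ^ 2, sq_nonneg _, fun j => ?_⟩
  rw [← mul_pow, mul_one]
  have hr := radius_pos hb hξ hs j
  have h1 : 1 ≤ R₀⁻¹ * (radius b p ξ j / 2) := by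
    rw [inv_mul_eq_div, one_le_div hR₀]
    exact hR j
  have h2 : K * varrho b p ξ r j =
      K * q * 2 * (∑' i, b i ^ p) / ξ * (radius b p ξ j / 2) := by
    rw [hqe, radius]
    field_simp
  refine pow_le_pow_left₀ (zero_le_one.trans (le_max_left _ _)) ?_ 2
  rw [hA, add_mul, h2]
  have h3 : 0 < K * q * 2 * (∑' i, b i ^ p) / ξ * (radius b p ξ j / 2) := by positivity
  exact max_le (by linarith) (by linarith)

/-- The exponent is chosen so that b_j^{2(p-1)} raised to it is exactly b_j^p. -/
theorem summable_max_varrho_rpow (hb : ∀ j, 0 < b j) (hξ : 0 < ξ) (hp0 : 0 < p) (hp1 : p < 1)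
    (hs : Summable fun j => b j ^ p) (hK : 0 < K) (r : ℕ) :
    Summable fun j => (max 1 (K * varrho b p ξ r j) ^ (2 * 1)) ^ (-(p / (2 * (1 - p)))) := by
  obtain ⟨q, hq, hqe⟩ := exists_varrho_eq hb hξ hs r
  have h1p : 0 < 1 - p := by linarith
  refine Summable.of_nonneg_of_le (fun j => by positivity) (fun j => ?_)
    (hs.mul_left (((K * q) ^ 2) ^ (-(p / (2 * (1 - p))))))
  have hbj := hb j
  have h1 : (((K * q) ^ 2) ^ (-(p / (2 * (1 - p))))) * b j ^ p =
      ((K * varrho b p ξ r j) ^ 2) ^ (-(p / (2 * (1 - p)))) := by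
    have h2 : b j ^ p = ((b j ^ (p - 1)) ^ 2) ^ (-(p / (2 * (1 - p)))) := by
      rw [← Real.rpow_natCast, ← Real.rpow_mul hbj.le, ← Real.rpow_mul hbj.le]
      congr 1
      push_cast
      field_simp
      ring
    rw [h2, ← Real.mul_rpow (by positivity) (by positivity), hqe]
    congr 1
    ring
  rw [h1]
  have h3 : 0 < K * varrho b p ξ r j := by rw [hqe]; positivity
  refine Real.rpow_le_rpow_of_nonpos (by positivity) ?_ (neg_nonpos.2 (by positivity))
  exact pow_le_pow_left₀ h3.le (le_max_right _ _) 2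

end Radius

/-! ### The error as a power of the threshold -/

section Main

variable {X : Type*} [NormedAddCommGroup X] [InnerProductSpace ℂ X] [CompleteSpace X]
  {b : ℕ → ℝ} {ξ δ p K τ : ℝ} {u : (ℕ → ℝ) → X} {uN : (N : ℕ) → (Fin N → ℝ) → X} {r : ℕ}

theorem exists_eLpNorm_sub_smolyak_le (hb : ∀ j, 0 < b j) (hξ : 0 < ξ) (hδ : 0 < δ) (hp0 : 0 < p)
    (hp : p < 2 / 3) (hs : Summable fun j => b j ^ p) (hu : IsHolomorphicVia b ξ δ u uN)
    (hτ : 0 < τ) (hK : 0 < K) {t : ℝ} (ht : t = p / (2 * (1 - p))) (hst : 2 < ((r : ℝ) - τ) * t) :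
    ∃ C : ℝ, 0 ≤ C ∧ ∀ ε : ℝ, 0 < ε → ∀ Λ : Finset (ℕ →₀ ℕ),
      (Λ : Set _) = indexSet (weight 1 K τ r (varrho b p ξ r)) ε →
      eLpNorm (fun y => u y - smolyak Λ (pointEval uN) y) 2 gammaInf ≤
        ENNReal.ofReal (C * ε ^ ((1 - t) / 2)) := by
  set B : ℕ → ℝ := fun j => max 1 (K * varrho b p ξ r j) ^ (2 * 1) with hBdef
  have hB : ∀ j, 1 ≤ B j := fun j => one_le_pow₀ (le_max_left _ _)
  have h1p : 0 < 1 - p := by linarith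
  have ht0 : 0 < t := by rw [ht]; positivity
  have ht1 : t ≤ 1 := by
    rw [ht, div_le_one (by positivity)]
    linarith
  have hs0 : 0 < (r : ℝ) - τ := (mul_pos_iff_of_pos_right ht0).1 (by linarith)
  have hBs : Summable fun j => B j ^ (-t) := by
    rw [ht]
    exact summable_max_varrho_rpow hb hξ hp0 (by linarith) hs hK r
  obtain ⟨R₀, hR₀, hR₀1, hR⟩ := exists_le_radius hb hξ hp0 (by linarith) hs
  obtain ⟨κ, hκ, hBκ⟩ := exists_max_varrho_le hb hξ hp0 (by linarith) hs hK r
  -- The integer order r + 4 covers s + 4 = r - τ + 4 since τ > 0. Halving the radii places the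
  -- circles strictly inside the polydiscs.
  obtain ⟨D, hD, hw⟩ := exists_prod_sq_mul_prodWeight_le (B := B)
    (R := fun j => radius b p ξ j / 2) (s := (r : ℝ) - τ) (S := r + 4) hκ hR₀ hR₀1 hR
    (fun j => zero_le_one.trans (hB j)) hBκ (by push_cast; linarith) (by omega)
  set Z : ℝ := ∑' ν : ℕ →₀ ℕ, prodWeight B ((r : ℝ) - τ) ν ^ (-t) *
    ∏ j ∈ ν.support, D * (1 + (ν j : ℝ)) with hZ
  refine ⟨δ * √(4 * Z), by positivity, fun ε hε Λ hΛ => ?_⟩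
  have hρ := fun N => admissible_radius hb hξ hs N
  have key : ∀ N, 0 < N → ∃ (φ : (Fin N → ℝ) → ℝ) (F : (Fin N → ℂ) → X),
      StripBound (fun j : Fin N => radius b p ξ j) φ F ∧ √(∫ y, φ y ^ 2 ∂gammaFin N) ≤ δ ∧
      uN N = fun y => F fun i => (y i : ℂ) := by
    intro N hN
    obtain ⟨φ, -, hφ, hφδ, h⟩ := hu.extension N hN
    obtain ⟨F, hF1, hF2, hF3⟩ := h _ (hρ N)
    refine ⟨φ, F, ⟨hφ, hF1, hF3⟩, ?_, funext fun y => (hF2 y).symm⟩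
    rw [eLpNorm_two_eq hφ] at hφδ
    exact (ENNReal.ofReal_le_ofReal_iff hδ.le).1 hφδ
  refine eLpNorm_sub_smolyak_pointEval_le hu Λ (fun N hN => ?_) fun N hN => ?_
  · obtain ⟨φ, F, hF, -, he⟩ := key N hN
    rw [he]
    exact hF.continuous (hρ N).1
  · obtain ⟨φ, F, hF, hφδ, he⟩ := key N hN
    rw [he]
    refine (eLpNorm_liftFin_sub_smolyak_le hF (R := fun j => radius b p ξ j / 2)
      (fun j => half_pos (radius_pos hb hξ hs j)) (fun j => half_lt_self (radius_pos hb hξ hs j))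
      hB hs0 ht1 hBs hst hD hw hε hΛ).trans (ENNReal.ofReal_le_ofReal ?_)
    have h1 : √(4 * ε ^ (1 - t) * Z) = √(4 * Z) * ε ^ ((1 - t) / 2) := by
      rw [mul_right_comm, Real.sqrt_mul' _ (Real.rpow_nonneg hε.le _), Real.sqrt_eq_rpow (ε ^ _),
        ← Real.rpow_mul hε.le]
      ring_nf
    rw [h1, mul_assoc]
    exact mul_le_mul_of_nonneg_right hφδ (by positivity)

end Main

end SparseGrid

end

theorem theorem6p13 {X : Type*} [NormedAddCommGroup X] [InnerProductSpace ℂ X] [CompleteSpace X]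
    [TopologicalSpace.SeparableSpace X]
    (b : ℕ → ℝ) (hb : ∀ j, 0 < b j) (ξ δ : ℝ) (hξ : 0 < ξ) (hδ : 0 < δ)
    (p : ℝ) (hp0 : 0 < p) (hp : p < 2 / 3) (hbp : Memℓp b (ENNReal.ofReal p))
    (u : (ℕ → ℝ) → X) (uN : (N : ℕ) → (Fin N → ℝ) → X)
    (hu : IsHolomorphicVia b ξ δ u uN)
    (r : ℕ) (τ K : ℝ) (hτ : 0 < τ) (hr : 2 < ((r : ℝ) - τ) * (p / (1 - p)) / 2) (hK : 0 < K)
    (Λ : ℝ → Set (ℕ →₀ ℕ))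
    (hΛ : ∀ ε, Λ ε = indexSet (weight 1 K τ r (varrho b p ξ r)) ε) :
    ∃ hfin : ∀ ε, 0 < ε → (Λ ε).Finite,
      (∀ ε, 0 < ε → IsLowerSet (Λ ε)) ∧
      ∃ C : ℝ, 0 < C ∧ ∀ n : ℕ, 0 < n → ∃ (ε : ℝ) (hε : 0 < ε),
        (pts (Λ ε)).encard ≤ n ∧
        eLpNorm (fun y => u y - smolyak (hfin ε hε).toFinset (pointEval uN) y) 2 gammaInf
          ≤ ENNReal.ofReal (C * (n : ℝ) ^ (-1 / p + 3 / 2)) := by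
  have hs : Summable fun j => b j ^ p := summable_rpow_of_memℓp hb hp0 hbp
  have h1p : 0 < 1 - p := by linarith
  set t : ℝ := p / (2 * (1 - p)) with ht
  have ht0 : 0 < t := by rw [ht]; positivity
  have hst : 2 < ((r : ℝ) - τ) * t := by
    refine hr.trans_eq ?_
    rw [ht]
    field_simp
  have hs0 : 0 < (r : ℝ) - τ := (mul_pos_iff_of_pos_right ht0).1 (by linarith)
  set B : ℕ → ℝ := fun j => max 1 (K * varrho b p ξ r j) ^ (2 * 1) with hBdef
  have hB : ∀ j, 1 ≤ B j := fun j => one_le_pow₀ (le_max_left _ _)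
  have hBs : Summable fun j => B j ^ (-t) :=
    summable_max_varrho_rpow hb hξ hp0 (by linarith) hs hK r
  have hΛ' : ∀ ε, Λ ε = indexSet (prodWeight B ((r : ℝ) - τ)) ε := hΛ
  have hfin : ∀ ε, 0 < ε → (Λ ε).Finite := fun ε hε => by
    rw [hΛ']
    exact finite_indexSet_prodWeight hB hs0 ht0 hBs hst hε
  refine ⟨hfin, fun ε _ => by
    rw [hΛ']
    exact isLowerSet_indexSet_prodWeight hB hs0 ε, ?_⟩
  obtain ⟨C, hC, hCε⟩ := exists_eLpNorm_sub_smolyak_le hb hξ hδ hp0 hp hs hu hτ hK ht hst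
  set Z : ℝ := ∑' ν : ℕ →₀ ℕ, prodWeight B ((r : ℝ) - τ) ν ^ (-t) *
    ∏ j ∈ ν.support, 1 * (1 + (ν j : ℝ)) with hZdef
  have hZ : 0 < Z := by
    refine (summable_prodWeight_rpow hB hBs hst zero_le_one).tsum_pos (fun ν => ?_) 0 ?_
    · exact mul_nonneg (Real.rpow_nonneg (zero_le_one.trans (one_le_prodWeight hB hs0 ν)) _)
        (Finset.prod_nonneg fun j _ => by positivity)
    · simp [prodWeight]
  -- The summand 1 only makes the constant positive, as C may be zero.
  refine ⟨C * Z ^ ((1 - t) / (2 * t)) + 1, by positivity, fun n hn => ?_⟩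
  have hn' : (0 : ℝ) < n := by exact_mod_cast hn
  have hε : 0 < (Z / n) ^ (1 / t) := by positivity
  -- This threshold solves Z ε^{-t} = n, so the counting bound equals n exactly.
  refine ⟨(Z / n) ^ (1 / t), hε, ?_, ?_⟩
  · rw [hΛ']
    refine encard_pts_indexSet_le hB hs0 ht0 hBs hst hε ?_
    rw [← Real.rpow_mul (by positivity), one_div_mul_cancel ht0.ne', Real.rpow_one,
      mul_div_cancel₀ _ hn'.ne']
  · refine (hCε _ hε _ ?_).trans (ENNReal.ofReal_le_ofReal ?_)
    · rw [Set.Finite.coe_toFinset, hΛ]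
    · have h1 : ((Z / n) ^ (1 / t)) ^ ((1 - t) / 2) =
          Z ^ ((1 - t) / (2 * t)) * (n : ℝ) ^ (-1 / p + 3 / 2) := by
        have h2 : 1 / t * ((1 - t) / 2) = (1 - t) / (2 * t) := by field_simp
        have h3 : -1 / p + 3 / 2 = -((1 - t) / (2 * t)) := by
          rw [ht]
          field_simp
          ring
        rw [← Real.rpow_mul (by positivity), h2, h3, Real.div_rpow hZ.le hn'.le,
          Real.rpow_neg hn'.le, div_eq_mul_inv]
      rw [h1, ← mul_assoc]
      exact mul_le_mul_of_nonneg_right (by linarith) (by positivity)
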